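/- **Setting.** For $z=(z_1,z_2)\in\mathbb R^{2d}$ let $\pi(z)f(t)=e^{2\pi i z_2\cdot t}f(t-z_1)$, let $j(z_1,z_2)=(z_2,-z_1)$, and let $\varphi(t)=e^{-\pi|t|^2}$ on $\mathbb R^d$ and $\Phi(z)=e^{-\pi|z|^2}$ on $\mathbb R^{2d}$. A weight $v:\mathbb R^{2d}\to[0,\infty)$ is *admissible* if it is continuous, $v(0)=1$, $v$ is even in each coordinate, $v(w+z)\le v(w)v(z)$ for all $w,z$, and $\lim_{n\to\infty}v(nz)^{1/n}=1$ for all $z$. Let $M^1_v(\mathbb R^d)$ be the space of all $f\in L^2(\mathbb R^d)$ with $\|f\|_{M^1_v}=\int_{\mathbb R^{2d}}|\langle f,\pi(z)\varphi\rangle|\,v(z)\,dz<\infty$, and let $M^{\infty,1}_{v\circ j^{-1}}(\mathbb R^{2d})$ be the space of all $\sigma\in\mathcal S'(\mathbb R^{2d})$ with $$\|\sigma\|_{M^{\infty,1}_{v\circ j^{-1}}}=\int_{\mathbb R^{2d}}\sup_{z\in\mathbb R^{2d}}|\langle\sigma,M_\zeta T_z\Phi\rangle|\,v(j^{-1}(\zeta))\,d\zeta<\infty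 ,$$ where $M_\zeta T_z\Phi(p)=e^{2\pi i\zeta\cdot p}\,\Phi(p-z)$ and $\langle\sigma,F\rangle=\sigma(\overline F)$. The Weyl transform $\sigma^w$ of $\sigma\in\mathcal S'(\mathbb R^{2d})$ is given by $\langle\sigma^wf,h\rangle=\langle\sigma,W(h,f)\rangle$ for $f,h\in\mathcal S(\mathbb R^d)$, where $W(h,f)(x,\xi)=\int_{\mathbb R^d} h(x+\tfrac t2)\overline{f(x-\tfrac t2)}e^{-2\pi i\xi\cdot t}\,dt$. For a lattice $\Lambda\subset\mathbb R^{2d}$ and a window $g\in M^1_v(\mathbb R^d)$ the Gabor matrix of $\sigma$ has the entries $$M(\sigma)_{\lambda\mu}=\langle\sigma^w\pi(\mu)g,\pi(\lambda)g\rangle,\qquad\lambda,\mu\in\Lambda .$$ It is *defined* if $g\in\mathcal S(\mathbb R^d)$, or if for some admissible weight $u$ with $g\in M^1_u(\mathbb R^d)$ the form $(f,h)\mapsto\langle\sigma^wf,h\rangle$ on $\mathcal S\cap M^1_u$ extends to a bounded sesquilinear form on $M^1_u\times M^1_u$; in the latter case the entries are values of this extension. A matrix $A=(a_{\lambda\mu})_{\lambda,\mu\in\Lambda}$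 belongs to $\mathcal C_v(\Lambda)$ if there is $h\in\ell^1_v(\Lambda)$ with $|a_{\lambda\mu}|\le h(\lambda-\mu)$ for all $\lambda,\mu\in\Lambda$; its norm $\|A\|_{\mathcal C_v}$ is the infimum of $\|h\|_{\ell^1_v}=\sum_{\lambda\in\Lambda}|h(\lambda)|v(\lambda)$ over all such $h$. All norms are set to $\infty$ outside the corresponding space. **Theorem.** Let $v$ be an admissible weight on $\mathbb R^{2d}$, let $\Lambda\subset\mathbb R^{2d}$ be a lattice, and let $g\in M^1_v(\mathbb R^d)$ be such that $\{\pi(\lambda)g:\lambda\in\Lambda\}$ is a Gabor frame for $L^2(\mathbb R^d)$. Then a symbol $\sigma\in\mathcal S'(\mathbb R^{2d})$ belongs to $M^{\infty,1}_{v\circ j^{-1}}(\mathbb R^{2d})$ if and only if its Gabor matrix $M(\sigma)$ is defined and belongs to $\mathcal C_v(\Lambda)$. Moreover, there are constants $0<c\le C<\infty$, depending only on $d$, $v$, $\Lambda$ and $g$, such that for all $\sigma\in\mathcal S'(\mathbb R^{2d})$ whose Gabor matrix is defined $$c\,\|\sigma\|_{M^{\infty,1}_{v\circ j^{-1}}}\le\|M(\sigma)\|_{\mathcal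 C_v}\le C\,\|\sigma\|_{M^{\infty,1}_{v\circ j^{-1}}} .$$ -/

import Mathlib

open MeasureTheory Filter Topology
open scoped ENNReal NNReal SchwartzMap ComplexConjugate

noncomputable section

/-- The configuration space `ℝ^d` with its Euclidean structure. -/
abbrev Config (d : ℕ) : Type := EuclideanSpace ℝ (Fin d)

/-- The time-frequency plane `ℝ^{2d}`, whose points are pairs `z = (z₁, z₂)`. -/
abbrev Phase (d : ℕ) : Type := Config d × Config d

/-- The time-frequency shift `π(z) f (t) = e^{2π i z₂·t} f (t - z₁)`. -/
def tfShift {d : ℕ} (z : Phase d) (f : Config d → ℂ) : Config d → ℂ :=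
  fun t => Complex.exp (2 * Real.pi * Complex.I * ((inner ℝ z.2 t : ℝ) : ℂ)) * f (t - z.1)

/-- The time-frequency shift `M_ζ T_z F` of a function on `ℝ^{2d}`. -/
def symbolShift {d : ℕ} (z ζ : Phase d) (F : Phase d → ℂ) : Phase d → ℂ :=
  fun p => Complex.exp (2 * Real.pi * Complex.I *
    ((inner ℝ ζ.1 p.1 + inner ℝ ζ.2 p.2 : ℝ) : ℂ)) * F (p - z)

/-- The Gaussian `e^{-π |t|²}` on `ℝ^d`. -/
def gaussianWindow (d : ℕ) : Config d → ℂ :=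
  fun t => ((Real.exp (-Real.pi * ‖t‖ ^ 2) : ℝ) : ℂ)

/-- The Gaussian `e^{-π |z|²}` on `ℝ^{2d}`. -/
def gaussianSymbol (d : ℕ) : Phase d → ℂ :=
  fun p => ((Real.exp (-Real.pi * (‖p.1‖ ^ 2 + ‖p.2‖ ^ 2)) : ℝ) : ℂ)

/-- The short-time Fourier transform `V_g f (z) = ⟨f, π(z) g⟩ = ∫ f · conj (π(z) g)`. -/
def stft {d : ℕ} (g f : Config d → ℂ) (z : Phase d) : ℂ :=
  ∫ t : Config d, f t * conj (tfShift z g t)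

/-- The cross-Wigner distribution
`W(f,h)(x,ξ) = ∫ f(x + t/2) conj (h(x - t/2)) e^{-2π i ξ·t} dt`. -/
def wigner {d : ℕ} (f h : Config d → ℂ) (p : Phase d) : ℂ :=
  ∫ t : Config d, f (p.1 + (1 / 2 : ℝ) • t) * conj (h (p.1 - (1 / 2 : ℝ) • t)) *
    Complex.exp (-(2 * Real.pi * Complex.I * ((inner ℝ p.2 t : ℝ) : ℂ)))

open Classical in
/-- The sesquilinear duality `⟨σ, F⟩ = σ(conj F)` of a tempered distribution `σ` on `ℝ^{2d}` with a
Schwartz function `F` (see `distPairing_eq`). It is only used for functions `F` that are Schwartz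
functions; for other `F` the value is set to `0`. -/
def distPairing {d : ℕ} (σ : 𝓢'(Phase d, ℂ)) (F : Phase d → ℂ) : ℂ :=
  if h : ∃ Ψ : 𝓢(Phase d, ℂ), ∀ p, Ψ p = conj (F p) then σ h.choose else 0

theorem distPairing_eq {d : ℕ} (σ : 𝓢'(Phase d, ℂ)) (F : Phase d → ℂ) (Ψ : 𝓢(Phase d, ℂ))
    (hΨ : ∀ p, Ψ p = conj (F p)) : distPairing σ F = σ Ψ := by
  have h : ∃ Ψ : 𝓢(Phase d, ℂ), ∀ p, Ψ p = conj (F p) := ⟨Ψ, hΨ⟩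
  have e : h.choose = Ψ := by
    ext p
    rw [h.choose_spec p, hΨ p]
  rw [distPairing, dif_pos h, e]

/-- The short-time Fourier transform `V_Φ σ (z, ζ) = ⟨σ, M_ζ T_z Φ⟩` of a symbol, taken with respect
to the Gaussian `Φ` on `ℝ^{2d}`. -/
def symbolStft {d : ℕ} (σ : 𝓢'(Phase d, ℂ)) (z ζ : Phase d) : ℂ :=
  distPairing σ (symbolShift z ζ (gaussianSymbol d))

/-- The sesquilinear form `⟨σ^w f, h⟩ = ⟨σ, W(h, f)⟩` of the Weyl transform of `σ`, for Schwartz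
functions `f`, `h`. -/
def weylForm {d : ℕ} (σ : 𝓢'(Phase d, ℂ)) (f h : Config d → ℂ) : ℂ :=
  distPairing σ (wigner h f)

/-- Admissible weights: continuous, normalised, even in each coordinate, submultiplicative, and
subject to the Gelfand-Raikov-Shilov condition `lim v(nz)^{1/n} = 1`. -/
structure AdmissibleWeight {d : ℕ} (v : Phase d → ℝ) : Prop where
  nonneg : ∀ z, 0 ≤ v z
  continuous : Continuous v
  map_zero : v 0 = 1
  even : ∀ z w : Phase d, (∀ i, |z.1 i| = |w.1 i|) → (∀ i, |z.2 i| = |w.2 i|) → v z = v w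
  submul : ∀ w z, v (w + z) ≤ v w * v z
  grs : ∀ z, Tendsto (fun n : ℕ => v (n • z) ^ (1 / (n : ℝ))) atTop (𝓝 1)

/-- The norm of the modulation space `M^1_v(ℝ^d)`, measured with the Gaussian window. -/
def m1Norm {d : ℕ} (v : Phase d → ℝ) (f : Config d → ℂ) : ℝ≥0∞ :=
  ∫⁻ z : Phase d, ‖stft (gaussianWindow d) f z‖ₑ * ENNReal.ofReal (v z)

/-- Membership in `M^1_v(ℝ^d)`, which for `v ≥ 1` is a subspace of `L²(ℝ^d)`. -/
def MemM1 {d : ℕ} (v : Phase d → ℝ) (f : Config d → ℂ) : Prop :=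
  MemLp f 2 (volume : Measure (Config d)) ∧ m1Norm v f < ∞

/-- The norm of the weighted Sjöstrand class `M^{∞,1}_w(ℝ^{2d})`:
`∫ sup_z |V_Φ σ (z, ζ)| w(ζ) dζ`, with `Φ` the Gaussian. -/
def sjostrandNorm {d : ℕ} (w : Phase d → ℝ) (σ : 𝓢'(Phase d, ℂ)) : ℝ≥0∞ :=
  ∫⁻ ζ : Phase d, (⨆ z : Phase d, ‖symbolStft σ z ζ‖ₑ) * ENNReal.ofReal (w ζ)

/-- Membership of a symbol in `M^{∞,1}_w(ℝ^{2d})`. -/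
def MemSjostrand {d : ℕ} (w : Phase d → ℝ) (σ : 𝓢'(Phase d, ℂ)) : Prop :=
  sjostrandNorm w σ < ∞

/-- The inverse of `j(z₁, z₂) = (z₂, -z₁)`. -/
def jInv {d : ℕ} (ζ : Phase d) : Phase d := (-ζ.2, ζ.1)

/-- `{π(λ) g : λ ∈ Λ}` is a Gabor frame for `L²(ℝ^d)`. -/
def IsGaborFrame {d : ℕ} (g : Config d → ℂ) (Λ : Submodule ℤ (Phase d)) : Prop :=
  MemLp g 2 (volume : Measure (Config d)) ∧
  ∃ A B : ℝ≥0, 0 < A ∧ ∀ f : Config d → ℂ, MemLp f 2 (volume : Measure (Config d)) →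
    (A : ℝ≥0∞) * ∫⁻ t, ‖f t‖ₑ ^ 2 ≤ ∑' l : Λ, ‖stft g f (l : Phase d)‖ₑ ^ 2 ∧
    ∑' l : Λ, ‖stft g f (l : Phase d)‖ₑ ^ 2 ≤ (B : ℝ≥0∞) * ∫⁻ t, ‖f t‖ₑ ^ 2

/-- `B` extends the form `(f, h) ↦ ⟨σ^w f, h⟩` from Schwartz functions to a bounded sesquilinear
form on `M^1_u × M^1_u`. By density such an extension is unique on `M^1_u`. -/
structure IsWeylExtension {d : ℕ} (u : Phase d → ℝ) (σ : 𝓢'(Phase d, ℂ))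
    (B : (Config d → ℂ) → (Config d → ℂ) → ℂ) : Prop where
  add_left : ∀ f₁ f₂ h, MemM1 u f₁ → MemM1 u f₂ → MemM1 u h → B (f₁ + f₂) h = B f₁ h + B f₂ h
  smul_left : ∀ (c : ℂ) f h, MemM1 u f → MemM1 u h → B (c • f) h = c * B f h
  add_right : ∀ f h₁ h₂, MemM1 u f → MemM1 u h₁ → MemM1 u h₂ → B f (h₁ + h₂) = B f h₁ + B f h₂
  smul_right : ∀ (c : ℂ) f h, MemM1 u f → MemM1 u h → B f (c • h) = conj c * B f h
  bounded : ∃ C : ℝ≥0, ∀ f h, MemM1 u f → MemM1 u h →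
    ‖B f h‖ₑ ≤ (C : ℝ≥0∞) * m1Norm u f * m1Norm u h
  extends_schwartz : ∀ f h : 𝓢(Config d, ℂ), MemM1 u f → MemM1 u h → B f h = weylForm σ f h

/-- `M` is the Gabor matrix `M(σ)_{λμ} = ⟨σ^w π(μ) g, π(λ) g⟩`, `λ, μ ∈ Λ`. For a Schwartz window
`g` the entries are given by the duality of `𝓢'` and `𝓢`. For a window that need not be a Schwartz
function they are defined as soon as `σ^w` extends continuously to a space `M^1_u ∋ g` (where `u`
is admissible), and are then the values of the extension. -/
def IsGaborMatrix {d : ℕ} (g : Config d → ℂ) (Λ : Submodule ℤ (Phase d)) (σ : 𝓢'(Phase d, ℂ))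
    (M : Λ → Λ → ℂ) : Prop :=
  ((∃ G : 𝓢(Config d, ℂ), ∀ t, G t = g t) ∧
    ∀ l m : Λ, M l m = weylForm σ (tfShift (m : Phase d) g) (tfShift (l : Phase d) g)) ∨
  ∃ (u : Phase d → ℝ) (B : (Config d → ℂ) → (Config d → ℂ) → ℂ),
    AdmissibleWeight u ∧ MemM1 u g ∧ IsWeylExtension u σ B ∧
    ∀ l m : Λ, M l m = B (tfShift (m : Phase d) g) (tfShift (l : Phase d) g)

/-- Membership in `𝒞_v(Λ)`: `|a_{λμ}| ≤ h(λ - μ)` for some `h ∈ ℓ¹_v(Λ)`. -/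
def MemConvDom {d : ℕ} (v : Phase d → ℝ) {Λ : Submodule ℤ (Phase d)} (M : Λ → Λ → ℂ) : Prop :=
  ∃ h : Λ → ℝ, Summable (fun l : Λ => |h l| * v (l : Phase d)) ∧ ∀ l m, ‖M l m‖ ≤ h (l - m)

/-- The norm of `𝒞_v(Λ)`: the infimum of `‖h‖_{ℓ¹_v}` over all dominating `h` (possibly `∞`). -/
def convDomNorm {d : ℕ} (v : Phase d → ℝ) {Λ : Submodule ℤ (Phase d)} (M : Λ → Λ → ℂ) : ℝ≥0∞ :=
  ⨅ (h : Λ → ℝ) (_ : ∀ l m, ‖M l m‖ ≤ h (l - m)),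
    ∑' l : Λ, ‖h l‖ₑ * ENNReal.ofReal (v (l : Phase d))

end

/-!
The proof compares both conditions with a third one, on the matrix
`κ(w, z) = ⟨σ^w π(w)φ, π(z)φ⟩` of the Weyl operator with respect to the *continuous* family of
coherent states, where `φ` is the normalised Gaussian: `κ` is dominated by a convolution kernel,
`|κ(w, z)| ≤ H(z - w)` with `∫ H v < ∞`.

*Sjöstrand class and `κ`.* The cross-Wigner distribution of two coherent states is a modulated
translate of the Gaussian `e^{-2π|p|²}`. Hence `|κ(w, z)|` is, up to a constant, the short-time
Fourier transform of `σ` with this window at position `(w + z)/2` and frequency `j(z - w)`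
(`enorm_weylKernel`), and domination of `κ` says that the supremum over the positions is integrable
in the frequency. Passing between the windows `e^{-2π|p|²}` and `e^{-π|p|²}` is explicit: each is a
superposition of modulations or translates of the other (`enorm_narrow_window_le`,
`enorm_wide_window_le`). This gives `exists_kernel_bound_of_sjostrand` and
`exists_sjostrandNorm_le`.

*From `κ` to the Gabor matrix.* The coherent states form a Parseval frame, and the Weyl form of
Schwartz functions is the integral of `κ` against coherent state coefficients
(`weylForm_eq_integral`). Schwartz functions are dense in `M¹_u`, so a bounded extension of the form
can be estimated in the same way (`exists_gaborMatrix_bound_of_kernel`). The coefficients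
of `π(λ)g` are controlled by a translate of an integrable envelope of those of `g`, so a bound for
`κ` by convolution turns into one for the Gabor matrix.

*From the Gabor matrix to `κ`.* One needs expansions `π(w)φ = ∑ c(λ, w) π(λ)g` whose coefficients
are dominated by a `v`-integrable function of `λ - w`. They are `c(λ, w) = ⟨π(λ)g, S⁻¹π(w)φ⟩` with
the frame operator `S` (`exists_dual_coeff`), and their decay is a form of Wiener's lemma: the matrix of `S`
in coherent states is dominated by a kernel in the weighted `L¹`, and so is that of `S⁻¹`. This is
`exists_inverse_kernel_bound`, proved by Sjöstrand's commutator method. Let `χ` be a cutoff at scale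
`N` around `y`. Since `S` is bounded below, the local `L²` norm of the coefficients of `f` near `y`
is at most a multiple of that of `Sf`, plus the commutator of `χ` with the kernels. For shifts of
length at most `R` the cutoff hardly varies once `N` is large, and this part is absorbed; the shifts
longer than `R` contribute a convolution of the local norms with the tail of a weighted `L¹`
function, which is small for large `R`, so a Neumann series resolves the inequality. With these
coefficients, `exists_kernel_bound_of_gaborMatrix` bounds `κ` by the Gabor matrix; the series
converge in `M¹_u`, on which the extended Weyl form is bounded.

All constants depend on the weight, the lattice and the window only, so that the norm estimates
come out together with the equivalence.
-/

set_option linter.unusedSectionVars false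

/-! ### The `L²` norm of nonnegative functions and Minkowski's integral inequality -/

section L2Norm

variable {α β : Type*} [MeasurableSpace α] [MeasurableSpace β]

/-- The `L²` norm of a function with values in `[0, ∞]`. -/
noncomputable def l2norm (μ : Measure α) (f : α → ℝ≥0∞) : ℝ≥0∞ :=
  (∫⁻ z, f z ^ (2 : ℝ) ∂μ) ^ (1 / (2 : ℝ))

theorem l2norm_mono {μ : Measure α} {f g : α → ℝ≥0∞} (h : ∀ z, f z ≤ g z) :
    l2norm μ f ≤ l2norm μ g :=
  ENNReal.rpow_le_rpow
    (lintegral_mono fun z => ENNReal.rpow_le_rpow (h z) (by norm_num)) (by norm_num)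

theorem l2norm_add_le {μ : Measure α} {f g : α → ℝ≥0∞} (hf : Measurable f) (hg : Measurable g) :
    l2norm μ (fun z => f z + g z) ≤ l2norm μ f + l2norm μ g :=
  ENNReal.lintegral_Lp_add_le hf.aemeasurable hg.aemeasurable (by norm_num)

theorem lintegral_mul_le_l2norm {μ : Measure α} {f g : α → ℝ≥0∞} (hf : Measurable f)
    (hg : Measurable g) : ∫⁻ z, f z * g z ∂μ ≤ l2norm μ f * l2norm μ g := by
  have := ENNReal.lintegral_mul_le_Lp_mul_Lq μ (p := 2) (q := 2)
    (by constructor <;> norm_num) hf.aemeasurable hg.aemeasurable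
  simpa [l2norm] using this

theorem l2norm_const_mul {μ : Measure α} {f : α → ℝ≥0∞} (c : ℝ≥0∞) (hf : Measurable f) :
    l2norm μ (fun z => c * f z) = c * l2norm μ f := by
  simp only [l2norm, ENNReal.mul_rpow_of_nonneg _ _ (by norm_num : (0 : ℝ) ≤ 2)]
  rw [lintegral_const_mul _ (hf.pow_const _), ENNReal.mul_rpow_of_nonneg _ _ (by norm_num),
    ← ENNReal.rpow_mul]
  norm_num

theorem l2norm_comp_add_right {E : Type*} [AddGroup E] [MeasurableSpace E] [MeasurableAdd E]
    {μ : Measure E} [μ.IsAddRightInvariant] (f : E → ℝ≥0∞) (s : E) :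
    l2norm μ (fun z => f (z + s)) = l2norm μ f := by
  simp only [l2norm]
  rw [lintegral_add_right_eq_self (fun z => f z ^ (2 : ℝ)) s]

/-- Minkowski's integral inequality in `L²`, for nonnegative functions. -/
theorem l2norm_lintegral_le {μ : Measure α} {ν : Measure β} [SFinite μ] [SFinite ν]
    {κ : β → ℝ≥0∞} {G : β → α → ℝ≥0∞} (hκ : Measurable κ)
    (hG : Measurable (Function.uncurry G)) :
    l2norm μ (fun z => ∫⁻ s, κ s * G s z ∂ν) ≤ ∫⁻ s, κ s * l2norm μ (G s) ∂ν := by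
  have hGs : ∀ s, Measurable (G s) := fun s => hG.comp (measurable_const.prodMk measurable_id)
  have hGz : ∀ z, Measurable fun s => G s z := fun z =>
    hG.comp (measurable_id.prodMk measurable_const)
  have hn : Measurable fun s => l2norm μ (G s) := by
    unfold l2norm
    exact (Measurable.lintegral_prod_right' (f := fun p : β × α => G p.1 p.2 ^ (2 : ℝ))
      (hG.pow_const _)).pow_const _
  -- expand the square, interchange the integrals and apply the Cauchy-Schwarz inequality in `z`
  have key : ∫⁻ z, (∫⁻ s, κ s * G s z ∂ν) ^ (2 : ℝ) ∂μ
      ≤ (∫⁻ s, κ s * l2norm μ (G s) ∂ν) ^ (2 : ℝ) := by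
    calc ∫⁻ z, (∫⁻ s, κ s * G s z ∂ν) ^ (2 : ℝ) ∂μ
        = ∫⁻ z, ∫⁻ s, ∫⁻ t, (κ s * G s z) * (κ t * G t z) ∂ν ∂ν ∂μ := by
          refine lintegral_congr fun z => ?_
          rw [ENNReal.rpow_two, sq, ← lintegral_mul_const _ (hκ.fun_mul (hGz z))]
          refine lintegral_congr fun s => ?_
          rw [lintegral_const_mul _ (hκ.fun_mul (hGz z))]
      _ = ∫⁻ s, ∫⁻ z, ∫⁻ t, (κ s * G s z) * (κ t * G t z) ∂ν ∂μ ∂ν := by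
          rw [lintegral_lintegral_swap]
          refine (Measurable.lintegral_prod_right' (f := fun p : (α × β) × β =>
            (κ p.1.2 * G p.1.2 p.1.1) * (κ p.2 * G p.2 p.1.1)) ?_).aemeasurable
          refine Measurable.mul (Measurable.mul (by fun_prop) ?_) (Measurable.mul (by fun_prop) ?_)
          · exact hG.comp (f := fun p : (α × β) × β => (p.1.2, p.1.1)) (by fun_prop)
          · exact hG.comp (f := fun p : (α × β) × β => (p.2, p.1.1)) (by fun_prop)
      _ = ∫⁻ s, ∫⁻ t, ∫⁻ z, (κ s * G s z) * (κ t * G t z) ∂μ ∂ν ∂ν := by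
          refine lintegral_congr fun s => ?_
          rw [lintegral_lintegral_swap]
          refine Measurable.aemeasurable ?_
          refine Measurable.mul (Measurable.mul (by fun_prop) ?_) (Measurable.mul (by fun_prop) ?_)
          · exact (hGs s).comp (f := fun p : α × β => p.1) (by fun_prop)
          · exact hG.comp (f := fun p : α × β => (p.2, p.1)) (by fun_prop)
      _ ≤ ∫⁻ s, ∫⁻ t, (κ s * l2norm μ (G s)) * (κ t * l2norm μ (G t)) ∂ν ∂ν := by
          refine lintegral_mono fun s => lintegral_mono fun t => ?_
          calc ∫⁻ z, (κ s * G s z) * (κ t * G t z) ∂μ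
              = κ s * κ t * ∫⁻ z, G s z * G t z ∂μ := by
                rw [← lintegral_const_mul _ ((hGs s).fun_mul (hGs t))]
                refine lintegral_congr fun z => by ring
            _ ≤ κ s * κ t * (l2norm μ (G s) * l2norm μ (G t)) := by
                gcongr
                exact lintegral_mul_le_l2norm (hGs s) (hGs t)
            _ = _ := by ring
      _ = (∫⁻ s, κ s * l2norm μ (G s) ∂ν) ^ (2 : ℝ) := by
          rw [ENNReal.rpow_two, sq, ← lintegral_mul_const _ (hκ.fun_mul hn)]
          refine lintegral_congr fun s => ?_
          rw [lintegral_const_mul _ (hκ.fun_mul hn)]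
  calc l2norm μ (fun z => ∫⁻ s, κ s * G s z ∂ν)
      ≤ ((∫⁻ s, κ s * l2norm μ (G s) ∂ν) ^ (2 : ℝ)) ^ (1 / (2 : ℝ)) :=
        ENNReal.rpow_le_rpow key (by norm_num)
    _ = _ := by rw [← ENNReal.rpow_mul]; norm_num

end L2Norm

/-! ### Convolution inequalities in weighted `L¹` -/

section Iteration

variable {E : Type*} [AddCommGroup E] [MeasurableSpace E] [MeasurableAdd₂ E] [MeasurableNeg E]
  {μ : Measure E} [SFinite μ] [μ.IsAddLeftInvariant]

/-- Convolution of nonnegative functions. -/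
noncomputable def nconv (μ : Measure E) (m u : E → ℝ≥0∞) (y : E) : ℝ≥0∞ :=
  ∫⁻ s, m s * u (y - s) ∂μ

theorem measurable_nconv {m u : E → ℝ≥0∞} (hm : Measurable m) (hu : Measurable u) :
    Measurable (nconv μ m u) := by
  refine Measurable.lintegral_prod_right' (f := fun p : E × E => m p.2 * u (p.1 - p.2)) ?_
  fun_prop

theorem nconv_comm [μ.IsNegInvariant] (m u : E → ℝ≥0∞) (y : E) :
    nconv μ m u y = nconv μ u m y := by
  unfold nconv
  rw [← lintegral_sub_left_eq_self _ y]
  exact lintegral_congr fun s => by rw [sub_sub_cancel, mul_comm]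

/-- Young's inequality in `L¹` with a submultiplicative weight. -/
theorem lintegral_nconv_mul_le {m u ω : E → ℝ≥0∞} (hm : Measurable m) (hu : Measurable u)
    (hω : Measurable ω) (hsub : ∀ x y, ω (x + y) ≤ ω x * ω y) :
    ∫⁻ y, nconv μ m u y * ω y ∂μ ≤ (∫⁻ s, m s * ω s ∂μ) * ∫⁻ y, u y * ω y ∂μ := by
  calc ∫⁻ y, nconv μ m u y * ω y ∂μ
      ≤ ∫⁻ y, ∫⁻ s, (m s * ω s) * (u (y - s) * ω (y - s)) ∂μ ∂μ := by
        refine lintegral_mono fun y => ?_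
        unfold nconv
        rw [← lintegral_mul_const _ (by fun_prop)]
        refine lintegral_mono fun s => ?_
        calc m s * u (y - s) * ω y ≤ m s * u (y - s) * (ω s * ω (y - s)) := by
              gcongr
              simpa using hsub s (y - s)
          _ = _ := by ring
    _ = ∫⁻ s, ∫⁻ y, (m s * ω s) * (u (y - s) * ω (y - s)) ∂μ ∂μ := by
        rw [lintegral_lintegral_swap]
        exact Measurable.aemeasurable (by fun_prop)
    _ = ∫⁻ s, (m s * ω s) * ∫⁻ y, u y * ω y ∂μ ∂μ := by
        refine lintegral_congr fun s => ?_
        rw [lintegral_const_mul _ (by fun_prop)]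
        congr 1
        exact lintegral_sub_right_eq_self (fun y => u y * ω y) s
    _ = _ := by
        rw [lintegral_mul_const _ (hm.fun_mul hω)]

/-- The Neumann series that resolves the convolution inequality `a ≤ b + m * a`. -/
noncomputable def neumann (μ : Measure E) (m b : E → ℝ≥0∞) (y : E) : ℝ≥0∞ :=
  ∑' n : ℕ, ((nconv μ m)^[n] b) y

theorem measurable_nconv_iterate {m b : E → ℝ≥0∞} (hm : Measurable m) (hb : Measurable b) (n : ℕ) :
    Measurable ((nconv μ m)^[n] b) := by
  induction n with
  | zero => exact hb
  | succ n ih =>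
    rw [Function.iterate_succ_apply']
    exact measurable_nconv hm ih

theorem measurable_neumann {m b : E → ℝ≥0∞} (hm : Measurable m) (hb : Measurable b) :
    Measurable (neumann μ m b) :=
  Measurable.tsum fun n => measurable_nconv_iterate hm hb n

/-- A Neumann series is controlled in weighted `L¹` if the convolutor has norm at most `1/2`. -/
theorem lintegral_neumann_mul_le {m b ω : E → ℝ≥0∞} (hm : Measurable m) (hb : Measurable b)
    (hω : Measurable ω) (hsub : ∀ x y, ω (x + y) ≤ ω x * ω y)
    (hθ : ∫⁻ s, m s * ω s ∂μ ≤ 2⁻¹) :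
    ∫⁻ y, neumann μ m b y * ω y ∂μ ≤ 2 * ∫⁻ y, b y * ω y ∂μ := by
  have hn : ∀ n : ℕ, ∫⁻ y, ((nconv μ m)^[n] b) y * ω y ∂μ ≤ 2⁻¹ ^ n * ∫⁻ y, b y * ω y ∂μ := by
    intro n
    induction n with
    | zero => simp
    | succ n ih =>
      rw [Function.iterate_succ_apply']
      refine (lintegral_nconv_mul_le hm (measurable_nconv_iterate hm hb n) hω hsub).trans ?_
      rw [pow_succ', mul_assoc]
      gcongr
  unfold neumann
  simp_rw [← ENNReal.tsum_mul_right]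
  rw [lintegral_tsum fun n => ((measurable_nconv_iterate hm hb n).fun_mul hω).aemeasurable]
  refine (ENNReal.tsum_le_tsum hn).trans ?_
  rw [ENNReal.tsum_mul_right, ENNReal.tsum_geometric]
  gcongr
  simp

/-- A bounded solution of `a ≤ b + m * a` is dominated by the Neumann series of `b`. -/
theorem le_neumann {m b a ω : E → ℝ≥0∞} (hm : Measurable m) (hb : Measurable b)
    (hω1 : ∀ x, 1 ≤ ω x) (hθ : ∫⁻ s, m s * ω s ∂μ ≤ 2⁻¹) {M : ℝ≥0∞} (hM : M ≠ ∞)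
    (haM : ∀ y, a y ≤ M) (ha : ∀ y, a y ≤ b y + nconv μ m a y) (y : E) :
    a y ≤ neumann μ m b y := by
  have hm1 : ∫⁻ s, m s ∂μ ≤ 2⁻¹ := by
    refine (lintegral_mono fun s => ?_).trans hθ
    simpa using mul_le_mul_right (hω1 s) (m s)
  have hstep : ∀ n : ℕ, ∀ y, a y ≤ (∑ i ∈ Finset.range n, ((nconv μ m)^[i] b) y) + 2⁻¹ ^ n * M := by
    intro n
    induction n with
    | zero => intro y; simpa using haM y
    | succ n ih =>
      intro y
      refine (ha y).trans ?_
      have h1 : nconv μ m a y ≤ ∫⁻ s, (∑ i ∈ Finset.range n, m s * ((nconv μ m)^[i] b) (y - s))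
          + m s * (2⁻¹ ^ n * M) ∂μ := by
        refine lintegral_mono fun s => ?_
        rw [← Finset.mul_sum, ← mul_add]
        gcongr
        exact ih _
      have hmeas : ∀ i, Measurable fun s => m s * ((nconv μ m)^[i] b) (y - s) := fun i =>
        hm.mul ((measurable_nconv_iterate hm hb i).comp (by fun_prop))
      have h2 : nconv μ m a y ≤ (∑ i ∈ Finset.range n, ((nconv μ m)^[i + 1] b) y)
          + 2⁻¹ ^ (n + 1) * M := by
        refine h1.trans ?_
        rw [lintegral_add_right _ (by fun_prop), lintegral_finsetSum _ fun i _ => hmeas i,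
          lintegral_mul_const _ hm]
        simp_rw [Function.iterate_succ_apply']
        refine add_le_add le_rfl ?_
        rw [pow_succ', mul_assoc]
        gcongr
      refine (add_le_add le_rfl h2).trans (le_of_eq ?_)
      rw [Finset.sum_range_succ' (fun i => ((nconv μ m)^[i] b) y), ← add_assoc]
      simp only [Function.iterate_zero, id]
      rw [add_comm (b y)]
  have hlim : Tendsto (fun n : ℕ => (∑ i ∈ Finset.range n, ((nconv μ m)^[i] b) y) + 2⁻¹ ^ n * M)
      atTop (𝓝 (neumann μ m b y + 0 * M)) := by
    refine Tendsto.add (ENNReal.tendsto_nat_tsum _) ?_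
    refine ENNReal.Tendsto.mul_const ?_ (Or.inr hM)
    exact ENNReal.tendsto_pow_atTop_nhds_zero_of_lt_one (by simp)
  rw [zero_mul, add_zero] at hlim
  exact ge_of_tendsto' hlim fun n => hstep n y

end Iteration

/-! ### Continuous Parseval families and localisation -/

section Parseval

variable {E : Type*} [NormedAddCommGroup E] [SecondCountableTopology E] [MeasurableSpace E]
  [BorelSpace E] {μ : Measure E}
  {H : Type*} [NormedAddCommGroup H] [InnerProductSpace ℂ H]

/-- A continuous Parseval frame `(e_z)` of a Hilbert space: `∫ |⟨e_z, f⟩|² dμ(z) = ‖f‖²`. -/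
structure IsParsevalFamily (μ : Measure E) (e : E → H) : Prop where
  continuous : Continuous e
  parseval : ∀ f : H, l2norm μ (fun z => ‖inner ℂ (e z) f‖ₑ) = ‖f‖ₑ

namespace IsParsevalFamily

variable {e : E → H}

theorem continuous_coeff (he : IsParsevalFamily μ e) (f : H) :
    Continuous fun z => inner ℂ (e z) f :=
  he.continuous.inner continuous_const

theorem eLpNorm_two_eq_l2norm (F : E → ℂ) : eLpNorm F 2 μ = l2norm μ fun z => ‖F z‖ₑ := by
  rw [eLpNorm_eq_lintegral_rpow_enorm_toReal (by norm_num) (by norm_num)]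
  simp [l2norm]

theorem memLp_coeff (he : IsParsevalFamily μ e) (f : H) :
    MemLp (fun z => inner ℂ (e z) f) 2 μ := by
  refine ⟨(he.continuous_coeff f).aestronglyMeasurable, ?_⟩
  rw [eLpNorm_two_eq_l2norm, he.parseval]
  exact enorm_lt_top

/-- The coefficient map `f ↦ (z ↦ ⟨e_z, f⟩)` as an isometry into `L²`. -/
noncomputable def analysis (he : IsParsevalFamily μ e) : H →ₗᵢ[ℂ] Lp ℂ 2 μ where
  toFun f := (he.memLp_coeff f).toLp _
  map_add' f g := by
    rw [← MemLp.toLp_add]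
    exact MemLp.toLp_congr _ _ (Eventually.of_forall fun z => by simp)
  map_smul' c f := by
    rw [RingHom.id_apply, ← MemLp.toLp_const_smul]
    exact MemLp.toLp_congr _ _ (Eventually.of_forall fun z => by simp)
  norm_map' f := by
    have : ‖(he.memLp_coeff f).toLp _‖ = ‖f‖ := by
      rw [Lp.norm_toLp, eLpNorm_two_eq_l2norm, he.parseval]
      simp
    exact this

theorem analysis_coe (he : IsParsevalFamily μ e) (f : H) :
    he.analysis f =ᵐ[μ] fun z => inner ℂ (e z) f :=
  MemLp.coeFn_toLp (he.memLp_coeff f)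

/-- Polarised Parseval identity. -/
theorem inner_eq_integral (he : IsParsevalFamily μ e) (x f : H) :
    inner ℂ x f = ∫ w, conj (inner ℂ (e w) x) * inner ℂ (e w) f ∂μ := by
  rw [← he.analysis.inner_map_map, L2.inner_def]
  refine integral_congr_ae ?_
  filter_upwards [he.analysis_coe x, he.analysis_coe f] with w h1 h2
  rw [h1, h2, RCLike.inner_apply, mul_comm]

theorem integrable_coeff_mul (he : IsParsevalFamily μ e) (x : H) {F : E → ℂ} (hF : MemLp F 2 μ) :
    Integrable (fun w => conj (inner ℂ (e w) x) * F w) μ :=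
  MemLp.integrable_mul (p := 2) (q := 2) ((he.memLp_coeff x).star) hF

variable [CompleteSpace H]

/-- The synthesis map, adjoint to the coefficient map. -/
theorem exists_synthesis (he : IsParsevalFamily μ e) {F : E → ℂ} (hF : MemLp F 2 μ) :
    ∃ u : H, ∀ x : H, inner ℂ x u = ∫ w, conj (inner ℂ (e w) x) * F w ∂μ := by
  refine ⟨he.analysis.toContinuousLinearMap.adjoint (hF.toLp F), fun x => ?_⟩
  rw [ContinuousLinearMap.adjoint_inner_right, L2.inner_def]
  refine integral_congr_ae ?_
  filter_upwards [he.analysis_coe x, hF.coeFn_toLp] with w h1 h2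
  rw [LinearIsometry.coe_toContinuousLinearMap, h1, h2, RCLike.inner_apply, mul_comm]

end IsParsevalFamily

/-- The exponential cut-off `e^{-‖z - y‖ / N}` centred at `y`. -/
noncomputable def cutoff (N : ℝ) (y z : E) : ℝ := Real.exp (-(‖z - y‖ / N))

theorem cutoff_pos (N : ℝ) (y z : E) : 0 < cutoff N y z := Real.exp_pos _

theorem cutoff_le_one {N : ℝ} (hN : 0 < N) (y z : E) : cutoff N y z ≤ 1 := by
  rw [cutoff, Real.exp_le_one_iff]
  simp only [Left.neg_nonpos_iff]
  positivity

@[fun_prop]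
theorem continuous_cutoff (N : ℝ) : Continuous fun p : E × E => cutoff N p.1 p.2 := by
  unfold cutoff
  fun_prop

theorem cutoff_add_right (N : ℝ) (y z s : E) : cutoff N y (z + s) = cutoff N (y - s) z := by
  unfold cutoff
  congr 4
  abel

/-- A cut-off at a scale `N` much larger than `R` has small relative variation over distances up
to `R`. -/
theorem abs_cutoff_add_sub_le {N R : ℝ} (hN : 0 < N) {s : E} (hs : ‖s‖ ≤ R) (y z : E) :
    |cutoff N y (z + s) - cutoff N y z| ≤ (Real.exp (R / N) - 1) * cutoff N y z := by
  set t : ℝ := (‖z - y‖ - ‖z + s - y‖) / N with ht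
  have h1 : cutoff N y (z + s) = Real.exp t * cutoff N y z := by
    rw [cutoff, cutoff, ← Real.exp_add]
    congr 1
    rw [ht]
    ring
  have h2 : |t| ≤ R / N := by
    rw [ht, abs_div, abs_of_pos hN]
    gcongr
    refine (abs_norm_sub_norm_le _ _).trans ?_
    rw [show z - y - (z + s - y) = -s by abel, norm_neg]
    exact hs
  rw [h1, show Real.exp t * cutoff N y z - cutoff N y z = (Real.exp t - 1) * cutoff N y z by ring,
    abs_mul, abs_of_pos (cutoff_pos N y z)]
  refine mul_le_mul_of_nonneg_right ?_ (cutoff_pos N y z).le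
  have h3 := abs_le.1 h2
  have h4 : Real.exp t ≤ Real.exp (R / N) := Real.exp_le_exp.2 h3.2
  have h5 : Real.exp (-(R / N)) ≤ Real.exp t := Real.exp_le_exp.2 h3.1
  have h6 : Real.exp (-(R / N)) * Real.exp (R / N) = 1 := by
    rw [← Real.exp_add]; simp
  rw [abs_le]
  constructor
  · nlinarith [sq_nonneg (Real.exp (R / N) - 1), Real.exp_pos (R / N), Real.exp_pos (-(R/N)),
      Real.add_one_le_exp (R / N), sq_nonneg (Real.exp (R / N) - Real.exp (-(R/N)))]
  · linarith

/-- The `L²` norm of `|F|` localised near `y`. -/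
noncomputable def localNorm (μ : Measure E) (N : ℝ) (F : E → ℂ) (y : E) : ℝ≥0∞ :=
  l2norm μ fun z => ‖cutoff N y z‖ₑ * ‖F z‖ₑ

theorem localNorm_le {N : ℝ} (hN : 0 < N) (F : E → ℂ) (y : E) :
    localNorm μ N F y ≤ l2norm μ fun z => ‖F z‖ₑ := by
  refine l2norm_mono fun z => ?_
  refine mul_le_of_le_one_left' ?_
  rw [Real.enorm_eq_ofReal (cutoff_pos _ _ _).le]
  exact ENNReal.ofReal_le_one.2 (cutoff_le_one hN _ _)

/-- The kernel bound of the commutator of an integral operator, with kernel dominated by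
`κ(z - w)`, and the multiplication by the cut-off around `y`, applied to `F`. -/
noncomputable def commutatorBound (μ : Measure E) (N : ℝ) (κ : E → ℝ≥0∞) (F : E → ℂ) (y z : E) :
    ℝ≥0∞ :=
  ∫⁻ w, κ (z - w) * (‖cutoff N y w - cutoff N y z‖ₑ * ‖F w‖ₑ) ∂μ

/-- The `L²` norm of the difference of two translates of the cut-off, multiplied by `F`. -/
noncomputable def cutoffVariation (μ : Measure E) (N : ℝ) (F : E → ℂ) (y s : E) : ℝ≥0∞ :=
  l2norm μ fun z => ‖cutoff N y z - cutoff N y (z + s)‖ₑ * ‖F z‖ₑ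

theorem measurable_commutatorBound [SFinite μ] {N : ℝ} {κ : E → ℝ≥0∞} (hκ : Measurable κ)
    {F : E → ℂ} (hF : Continuous F) (y : E) : Measurable (commutatorBound μ N κ F y) := by
  refine Measurable.lintegral_prod_right' (f := fun p : E × E =>
    κ (p.1 - p.2) * (‖cutoff N y p.2 - cutoff N y p.1‖ₑ * ‖F p.2‖ₑ)) ?_
  have h1 : Measurable fun p : E × E => κ (p.1 - p.2) := hκ.comp (by fun_prop)
  have h2 : Measurable fun p : E × E => ‖cutoff N y p.2 - cutoff N y p.1‖ₑ := by
    have : Continuous fun p : E × E => cutoff N y p.2 - cutoff N y p.1 := by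
      unfold cutoff
      fun_prop
    exact this.measurable.enorm
  have h3 : Measurable fun p : E × E => ‖F p.2‖ₑ :=
    (hF.comp continuous_snd).measurable.enorm
  exact h1.mul (h2.mul h3)

variable [SFinite μ]

theorem measurable_localNorm {N : ℝ} {F : E → ℂ} (hF : Continuous F) :
    Measurable (localNorm μ N F) := by
  unfold localNorm l2norm
  refine (Measurable.lintegral_prod_right' (f := fun p : E × E =>
    (‖cutoff N p.1 p.2‖ₑ * ‖F p.2‖ₑ) ^ (2 : ℝ)) ?_).pow_const _
  have h2 : Measurable fun p : E × E => ‖cutoff N p.1 p.2‖ₑ :=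
    (continuous_cutoff N).measurable.enorm
  have h3 : Measurable fun p : E × E => ‖F p.2‖ₑ :=
    (hF.comp continuous_snd).measurable.enorm
  exact (h2.mul h3).pow_const _

variable [μ.IsAddLeftInvariant] [μ.IsNegInvariant]

/-- Minkowski's inequality for the commutator bound. -/
theorem l2norm_commutatorBound_le {N : ℝ} {κ : E → ℝ≥0∞} (hκ : Measurable κ)
    {F : E → ℂ} (hF : Continuous F) (y : E) :
    l2norm μ (commutatorBound μ N κ F y) ≤ ∫⁻ s, κ s * cutoffVariation μ N F y s ∂μ := by
  have h1 : commutatorBound μ N κ F y = fun z => ∫⁻ s, κ s *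
      (‖cutoff N y (z - s) - cutoff N y z‖ₑ * ‖F (z - s)‖ₑ) ∂μ := by
    ext z
    unfold commutatorBound
    rw [← lintegral_sub_left_eq_self _ z]
    simp only [sub_sub_cancel]
  rw [h1]
  refine (l2norm_lintegral_le (G := fun s z =>
    ‖cutoff N y (z - s) - cutoff N y z‖ₑ * ‖F (z - s)‖ₑ) hκ ?_).trans (le_of_eq ?_)
  · have h2 : Measurable fun p : E × E => ‖cutoff N y (p.2 - p.1) - cutoff N y p.2‖ₑ := by
      have : Continuous fun p : E × E => cutoff N y (p.2 - p.1) - cutoff N y p.2 := by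
        unfold cutoff
        fun_prop
      exact this.measurable.enorm
    have h3 : Measurable fun p : E × E => ‖F (p.2 - p.1)‖ₑ :=
      (hF.comp (continuous_snd.sub continuous_fst)).measurable.enorm
    exact h2.mul h3
  · refine lintegral_congr fun s => ?_
    congr 1
    unfold cutoffVariation
    rw [← l2norm_comp_add_right _ s]
    simp

theorem measurable_cutoffVariation {N : ℝ} {F : E → ℂ} (hF : Continuous F) (y : E) :
    Measurable (cutoffVariation μ N F y) := by
  unfold cutoffVariation l2norm
  refine (Measurable.lintegral_prod_right' (f := fun p : E × E =>
    (‖cutoff N y p.2 - cutoff N y (p.2 + p.1)‖ₑ * ‖F p.2‖ₑ) ^ (2 : ℝ)) ?_).pow_const _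
  have h2 : Measurable fun p : E × E => ‖cutoff N y p.2 - cutoff N y (p.2 + p.1)‖ₑ := by
    have : Continuous fun p : E × E => cutoff N y p.2 - cutoff N y (p.2 + p.1) := by
      unfold cutoff
      fun_prop
    exact this.measurable.enorm
  have h3 : Measurable fun p : E × E => ‖F p.2‖ₑ :=
    (hF.comp continuous_snd).measurable.enorm
  exact (h2.mul h3).pow_const _

/-- Near the diagonal the variation of the cut-off is a small multiple of the local norm. -/
theorem cutoffVariation_le_of_norm_le {N R : ℝ} (hN : 0 < N) {F : E → ℂ} (hF : Continuous F)
    (y : E) {s : E} (hs : ‖s‖ ≤ R) :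
    cutoffVariation μ N F y s ≤ ENNReal.ofReal (Real.exp (R / N) - 1) * localNorm μ N F y := by
  unfold localNorm
  have hm : Measurable fun z => ‖cutoff N y z‖ₑ * ‖F z‖ₑ := by
    have : Measurable fun z => cutoff N y z := by
      unfold cutoff
      fun_prop
    exact this.enorm.mul hF.measurable.enorm
  rw [← l2norm_const_mul _ hm]
  refine l2norm_mono fun z => ?_
  rw [← mul_assoc]
  gcongr
  rw [Real.enorm_eq_ofReal_abs, Real.enorm_eq_ofReal_abs, ← ENNReal.ofReal_mul' (abs_nonneg _),
    abs_of_pos (cutoff_pos N y z), abs_sub_comm]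
  exact ENNReal.ofReal_le_ofReal (abs_cutoff_add_sub_le hN hs y z)

/-- Away from the diagonal the variation of the cut-off is controlled by two local norms. -/
theorem cutoffVariation_le (N : ℝ) {F : E → ℂ} (hF : Continuous F) (y s : E) :
    cutoffVariation μ N F y s ≤ localNorm μ N F y + localNorm μ N F (y - s) := by
  have hm : ∀ y, Measurable fun z => ‖cutoff N y z‖ₑ * ‖F z‖ₑ := by
    intro y
    have : Measurable fun z => cutoff N y z := by
      unfold cutoff
      fun_prop
    exact this.enorm.mul hF.measurable.enorm
  refine le_trans ?_ (l2norm_add_le (hm y) (hm (y - s)))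
  refine l2norm_mono fun z => ?_
  rw [← add_mul, cutoff_add_right]
  gcongr
  exact enorm_sub_le

/-- Localising the solution of an operator equation: for an operator `T` with kernel dominated by
`κ(z - w)`, the localisation of `f` around `y` is mapped to the localisation of `T f`, up to
`commutatorBound`. -/
theorem IsParsevalFamily.enorm_sub_le_commutatorBound
    {H : Type*} [NormedAddCommGroup H] [InnerProductSpace ℂ H]
    {e : E → H} (he : IsParsevalFamily μ e)
    {T : H →L[ℂ] H} (hT : ∀ x y, inner ℂ (T x) y = inner ℂ x (T y)) {κ : E → ℝ≥0∞}
    (hκ : ∀ z w, ‖inner ℂ (e w) (T (e z))‖ₑ ≤ κ (z - w)) {N : ℝ} {f u : H} {y : E}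
    (hFy : MemLp (fun w => (cutoff N y w : ℂ) * inner ℂ (e w) f) 2 μ)
    (hu : ∀ x : H, inner ℂ x u =
      ∫ w, conj (inner ℂ (e w) x) * ((cutoff N y w : ℂ) * inner ℂ (e w) f) ∂μ) (z : E) :
    ‖inner ℂ (e z) (T u) - (cutoff N y z : ℂ) * inner ℂ (e z) (T f)‖ₑ ≤
      commutatorBound μ N κ (fun w => inner ℂ (e w) f) y z := by
  rw [← hT, ← hT, hu, he.inner_eq_integral (T (e z)) f, ← integral_const_mul,
    ← integral_sub (he.integrable_coeff_mul _ hFy)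
      ((he.integrable_coeff_mul _ (he.memLp_coeff f)).const_mul _)]
  refine (enorm_integral_le_lintegral_enorm _).trans (lintegral_mono fun w => ?_)
  have : conj (inner ℂ (e w) (T (e z))) * ((cutoff N y w : ℂ) * inner ℂ (e w) f) -
      (cutoff N y z : ℂ) * (conj (inner ℂ (e w) (T (e z))) * inner ℂ (e w) f) =
      conj (inner ℂ (e w) (T (e z))) * (((cutoff N y w - cutoff N y z : ℝ) : ℂ) *
        inner ℂ (e w) f) := by
    push_cast
    ring
  simp only [this, enorm_mul]
  gcongr
  · rw [RCLike.enorm_conj]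
    exact hκ z w
  · rw [← ofReal_norm, ← ofReal_norm, Complex.norm_real]

end Parseval

/-! ### Off-diagonal decay of the inverse of a localised operator -/

section Decay

variable {E : Type*} [NormedAddCommGroup E] [SecondCountableTopology E] [MeasurableSpace E]
  [BorelSpace E] {μ : Measure E} [SFinite μ] [μ.IsAddLeftInvariant] [μ.IsNegInvariant]
  {H : Type*} [NormedAddCommGroup H] [InnerProductSpace ℂ H] [CompleteSpace H]

/-- The exponential envelope `C e^{-‖s‖}`. -/
noncomputable def expEnvelope (C : ℝ) (s : E) : ℝ≥0∞ := ENNReal.ofReal (C * Real.exp (-‖s‖))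

@[fun_prop]
theorem measurable_expEnvelope (C : ℝ) : Measurable (expEnvelope C : E → ℝ≥0∞) := by
  unfold expEnvelope
  fun_prop

theorem enorm_cutoff_eq (N : ℝ) (y z : E) : ‖cutoff N y z‖ₑ = ENNReal.ofReal (cutoff N y z) :=
  Real.enorm_eq_ofReal (cutoff_pos _ _ _).le

theorem measurable_enorm_cutoff_mul (N : ℝ) (y : E) {F : E → ℂ} (hF : Continuous F) :
    Measurable fun z => ‖cutoff N y z‖ₑ * ‖F z‖ₑ := by
  have : Measurable fun z => cutoff N y z := by
    unfold cutoff
    fun_prop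
  exact this.enorm.mul hF.measurable.enorm

namespace IsParsevalFamily

variable {e : E → H}

/-- The local `L²` norm of the coefficients of `f` is controlled by that of `T f`, up to
commutators. -/
theorem localNorm_coeff_le (he : IsParsevalFamily μ e) {T : H →L[ℂ] H}
    (hT : ∀ x y, inner ℂ (T x) y = inner ℂ x (T y)) {A : ℝ} (hA : 0 < A)
    (hTA : ∀ x, A * ‖x‖ ≤ ‖T x‖) {Γ κ : E → ℝ≥0∞} (hΓm : Measurable Γ) (hκm : Measurable κ)
    (hΓ : ∀ z w, ‖inner ℂ (e w) (e z)‖ₑ ≤ Γ (z - w))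
    (hκ : ∀ z w, ‖inner ℂ (e w) (T (e z))‖ₑ ≤ κ (z - w)) {N : ℝ} (hN : 0 < N) (f : H) (y : E) :
    localNorm μ N (fun z => inner ℂ (e z) f) y ≤
      ENNReal.ofReal A⁻¹ * localNorm μ N (fun z => inner ℂ (e z) (T f)) y +
      ∫⁻ s, (Γ s + ENNReal.ofReal A⁻¹ * κ s) *
        cutoffVariation μ N (fun z => inner ℂ (e z) f) y s ∂μ := by
  set F : E → ℂ := fun z => inner ℂ (e z) f with hF
  have hFc : Continuous F := he.continuous_coeff f
  have hcm : Continuous fun w => (cutoff N y w : ℂ) := by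
    unfold cutoff
    fun_prop
  have hFy : MemLp (fun w => (cutoff N y w : ℂ) * inner ℂ (e w) f) 2 μ := by
    refine (he.memLp_coeff f).of_le (hcm.mul hFc).aestronglyMeasurable
      (Eventually.of_forall fun z => ?_)
    rw [norm_mul, Complex.norm_real, Real.norm_of_nonneg (cutoff_pos _ _ _).le]
    exact mul_le_of_le_one_left (norm_nonneg _) (cutoff_le_one hN _ _)
  -- `u` is the localisation of `f` around `y`: the synthesis of its coefficients times the cut-off.
  -- Its own coefficients differ from these products by a commutator with the projection onto the
  -- range of the coefficient map, whose kernel is dominated by `Γ`.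
  obtain ⟨u, hu⟩ := he.exists_synthesis hFy
  have hcut : ∀ z, ∀ c : ℂ, ‖(cutoff N y z : ℂ) * c‖ₑ = ‖cutoff N y z‖ₑ * ‖c‖ₑ := by
    intro z c
    rw [enorm_mul, ← ofReal_norm, ← ofReal_norm, Complex.norm_real, ofReal_norm]
  have h1 : localNorm μ N F y ≤ ‖u‖ₑ + l2norm μ (commutatorBound μ N Γ F y) := by
    rw [← he.parseval u]
    refine le_trans ?_ (l2norm_add_le (he.continuous_coeff u).measurable.enorm
      (measurable_commutatorBound hΓm hFc y))
    refine l2norm_mono fun z => ?_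
    have := he.enorm_sub_le_commutatorBound (T := ContinuousLinearMap.id ℂ H) (fun _ _ => rfl)
      (κ := Γ) hΓ hFy hu z
    simp only [ContinuousLinearMap.id_apply] at this
    rw [← hcut]
    calc ‖(cutoff N y z : ℂ) * F z‖ₑ
        = ‖inner ℂ (e z) u - (inner ℂ (e z) u - (cutoff N y z : ℂ) * F z)‖ₑ := by
          rw [sub_sub_cancel]
      _ ≤ _ := enorm_sub_le.trans (add_le_add le_rfl this)
  -- likewise `T u` is the localisation of `T f`, up to a commutator with `T`
  have h2 : ‖T u‖ₑ ≤ localNorm μ N (fun z => inner ℂ (e z) (T f)) y +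
      l2norm μ (commutatorBound μ N κ F y) := by
    rw [← he.parseval (T u)]
    refine le_trans ?_ (l2norm_add_le
      (measurable_enorm_cutoff_mul N y (he.continuous_coeff (T f)))
      (measurable_commutatorBound hκm hFc y))
    refine l2norm_mono fun z => ?_
    have := he.enorm_sub_le_commutatorBound hT hκ hFy hu z
    rw [← hcut]
    calc ‖inner ℂ (e z) (T u)‖ₑ
        = ‖(cutoff N y z : ℂ) * inner ℂ (e z) (T f) +
            (inner ℂ (e z) (T u) - (cutoff N y z : ℂ) * inner ℂ (e z) (T f))‖ₑ := by
          rw [add_sub_cancel]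
      _ ≤ _ := (enorm_add_le _ _).trans (add_le_add le_rfl this)
  have h3 : ‖u‖ₑ ≤ ENNReal.ofReal A⁻¹ * ‖T u‖ₑ := by
    rw [← ofReal_norm, ← ofReal_norm, ← ENNReal.ofReal_mul (by positivity)]
    refine ENNReal.ofReal_le_ofReal ?_
    rw [inv_mul_eq_div, le_div_iff₀ hA, mul_comm]
    exact hTA u
  have hv := measurable_cutoffVariation (μ := μ) (N := N) hFc y
  calc localNorm μ N F y ≤ ENNReal.ofReal A⁻¹ *
        (localNorm μ N (fun z => inner ℂ (e z) (T f)) y + l2norm μ (commutatorBound μ N κ F y)) +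
        l2norm μ (commutatorBound μ N Γ F y) := by
        refine h1.trans (add_le_add (h3.trans ?_) le_rfl)
        gcongr
    _ ≤ ENNReal.ofReal A⁻¹ * (localNorm μ N (fun z => inner ℂ (e z) (T f)) y +
          ∫⁻ s, κ s * cutoffVariation μ N F y s ∂μ) +
          ∫⁻ s, Γ s * cutoffVariation μ N F y s ∂μ := by
        gcongr
        · exact l2norm_commutatorBound_le hκm hFc y
        · exact l2norm_commutatorBound_le hΓm hFc y
    _ = _ := by
        rw [mul_add, add_assoc, ← lintegral_const_mul _ (hκm.fun_mul hv),
          ← lintegral_add_left (by fun_prop)]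
        congr 1
        refine lintegral_congr fun s => by ring

/-- The convolution inequality for the local norms: near the diagonal the cut-off varies slowly,
and the rest of the kernel is a convolution. -/
theorem localNorm_coeff_le_nconv (he : IsParsevalFamily μ e) {T : H →L[ℂ] H}
    (hT : ∀ x y, inner ℂ (T x) y = inner ℂ x (T y)) {A : ℝ} (hA : 0 < A)
    (hTA : ∀ x, A * ‖x‖ ≤ ‖T x‖) {Γ κ : E → ℝ≥0∞} (hΓm : Measurable Γ) (hκm : Measurable κ)
    (hΓ : ∀ z w, ‖inner ℂ (e w) (e z)‖ₑ ≤ Γ (z - w))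
    (hκ : ∀ z w, ‖inner ℂ (e w) (T (e z))‖ₑ ≤ κ (z - w)) {N R : ℝ} (hN : 0 < N)
    (hsmall : ENNReal.ofReal (Real.exp (R / N) - 1) *
      ∫⁻ s, (Γ s + ENNReal.ofReal A⁻¹ * κ s) ∂μ ≤ 4⁻¹)
    (htail : ∫⁻ s, {s | R < ‖s‖}.indicator (fun s => Γ s + ENNReal.ofReal A⁻¹ * κ s) s ∂μ ≤ 4⁻¹)
    (f : H) (y : E) :
    localNorm μ N (fun z => inner ℂ (e z) f) y ≤
      2 * ENNReal.ofReal A⁻¹ * localNorm μ N (fun z => inner ℂ (e z) (T f)) y +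
      nconv μ (fun s => 2 * {s | R < ‖s‖}.indicator (fun s => Γ s + ENNReal.ofReal A⁻¹ * κ s) s)
        (localNorm μ N (fun z => inner ℂ (e z) f)) y := by
  set F : E → ℂ := fun z => inner ℂ (e z) f with hF
  have hFc : Continuous F := he.continuous_coeff f
  set K : E → ℝ≥0∞ := fun s => Γ s + ENNReal.ofReal A⁻¹ * κ s with hK
  have hKm : Measurable K := by fun_prop
  set B : ℝ≥0∞ := ENNReal.ofReal A⁻¹ * localNorm μ N (fun z => inner ℂ (e z) (T f)) y with hB
  set a : E → ℝ≥0∞ := localNorm μ N F with ha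
  have ham : Measurable a := measurable_localNorm hFc
  set K₁ : E → ℝ≥0∞ := {s | R < ‖s‖}.indicator K with hK₁
  have hset : MeasurableSet {s : E | R < ‖s‖} := measurableSet_lt measurable_const measurable_norm
  have hK₁m : Measurable K₁ := hKm.indicator hset
  -- finiteness, needed to absorb a multiple of `a y` on the left
  have hay : a y ≠ ∞ := by
    refine ne_top_of_le_ne_top ?_ (localNorm_le hN F y)
    rw [he.parseval f]
    exact enorm_ne_top
  have hε : ENNReal.ofReal (Real.exp (R / N) - 1) ≠ ∞ := ENNReal.ofReal_ne_top
  have h1 : a y ≤ B + ∫⁻ s, K s * cutoffVariation μ N F y s ∂μ :=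
    he.localNorm_coeff_le hT hA hTA hΓm hκm hΓ hκ hN f y
  have h2 : ∫⁻ s, K s * cutoffVariation μ N F y s ∂μ ≤
      ∫⁻ s, (K s * (ENNReal.ofReal (Real.exp (R / N) - 1) * a y) +
        (K₁ s * a y + K₁ s * a (y - s))) ∂μ := by
    refine lintegral_mono fun s => ?_
    by_cases hs : R < ‖s‖
    · have : K₁ s = K s := Set.indicator_of_mem (show s ∈ {s : E | R < ‖s‖} from hs) K
      rw [this, ← mul_add]
      refine le_add_left ?_
      gcongr
      exact cutoffVariation_le N hFc y s
    · refine le_add_right ?_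
      gcongr
      exact cutoffVariation_le_of_norm_le hN hFc y (not_lt.1 hs)
  have h3 : a y ≤ B + (4⁻¹ * a y + (4⁻¹ * a y + nconv μ K₁ a y)) := by
    refine h1.trans (add_le_add le_rfl (h2.trans ?_))
    rw [lintegral_add_left (by fun_prop), lintegral_add_left (by fun_prop),
      lintegral_mul_const _ hKm, lintegral_mul_const _ hK₁m]
    refine add_le_add ?_ (add_le_add ?_ le_rfl)
    · rw [← mul_assoc, mul_comm (∫⁻ s, K s ∂μ)]
      gcongr
    · gcongr
  have h4 : a y + a y ≤ (2 * B + 2 * nconv μ K₁ a y) + a y := by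
    have h5 : (4⁻¹ : ℝ≥0∞) * a y + 4⁻¹ * a y = 2⁻¹ * a y := by
      rw [← add_mul]
      congr 1
      rw [← ENNReal.toReal_eq_toReal_iff' (by simp) (by simp),
        ENNReal.toReal_add (by simp) (by simp)]
      norm_num
    calc a y + a y = 2 * a y := by ring
      _ ≤ 2 * (B + (4⁻¹ * a y + (4⁻¹ * a y + nconv μ K₁ a y))) := by gcongr
      _ = 2 * (B + (2⁻¹ * a y + nconv μ K₁ a y)) := by rw [← add_assoc (4⁻¹ * a y), h5]
      _ = (2 * B + 2 * nconv μ K₁ a y) + (2 * 2⁻¹) * a y := by ring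
      _ = _ := by rw [ENNReal.mul_inv_cancel (by simp) (by simp), one_mul]
  have h6 := (ENNReal.add_le_add_iff_right hay).1 h4
  refine h6.trans (le_of_eq ?_)
  congr 1
  · rw [hB]; ring
  · unfold nconv
    rw [← lintegral_const_mul _ (by fun_prop)]
    refine lintegral_congr fun s => by ring

/-- Each coefficient is dominated by the local norm around it. -/
theorem enorm_coeff_le_localNorm (he : IsParsevalFamily μ e) {C : ℝ} (hC : 0 ≤ C)
    (hΓ : ∀ z w, ‖inner ℂ (e w) (e z)‖ₑ ≤ expEnvelope C (z - w)) {N : ℝ} (hN : 2 ≤ N) (f : H)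
    (y : E) :
    ‖inner ℂ (e y) f‖ₑ ≤ l2norm μ (fun z : E => ENNReal.ofReal (C * Real.exp (-(2⁻¹ * ‖z‖)))) *
      localNorm μ N (fun z => inner ℂ (e z) f) y := by
  rw [he.inner_eq_integral]
  refine (enorm_integral_le_lintegral_enorm _).trans ?_
  have h0 : l2norm μ (fun z : E => ENNReal.ofReal (C * Real.exp (-(2⁻¹ * ‖z‖)))) =
      l2norm μ (fun z : E => ENNReal.ofReal (C * Real.exp (-(2⁻¹ * ‖z - y‖)))) := by
    rw [← l2norm_comp_add_right (fun z : E => ENNReal.ofReal (C * Real.exp (-(2⁻¹ * ‖z‖)))) (-y)]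
    simp only [← sub_eq_add_neg]
  rw [h0]
  refine le_trans (lintegral_mono fun w => ?_) (lintegral_mul_le_l2norm (by fun_prop)
    (measurable_enorm_cutoff_mul N y (he.continuous_coeff f)))
  simp only
  rw [enorm_mul, ← mul_assoc, RCLike.enorm_conj]
  gcongr
  refine (hΓ y w).trans ?_
  rw [enorm_cutoff_eq, ← ENNReal.ofReal_mul (by positivity), expEnvelope]
  refine ENNReal.ofReal_le_ofReal ?_
  rw [mul_assoc, cutoff, ← Real.exp_add]
  gcongr
  have h1 : ‖w - y‖ / N ≤ ‖w - y‖ / 2 := by gcongr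
  rw [norm_sub_rev y w]
  linarith

/-- The local norms of the coefficients of `e_w` decay exponentially. -/
theorem localNorm_coeff_self_le {C : ℝ}
    (hΓ : ∀ z w, ‖inner ℂ (e w) (e z)‖ₑ ≤ expEnvelope C (z - w)) {N : ℝ} (hN : 2 ≤ N)
    (hC : 0 ≤ C) (w y : E) :
    localNorm μ N (fun z => inner ℂ (e z) (e w)) y ≤
      ENNReal.ofReal (Real.exp (-(N⁻¹ * ‖y - w‖))) *
        l2norm μ (fun z : E => ENNReal.ofReal (C * Real.exp (-(2⁻¹ * ‖z‖)))) := by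
  have h0 : l2norm μ (fun z : E => ENNReal.ofReal (C * Real.exp (-(2⁻¹ * ‖z‖)))) =
      l2norm μ (fun z : E => ENNReal.ofReal (C * Real.exp (-(2⁻¹ * ‖z - w‖)))) := by
    rw [← l2norm_comp_add_right (fun z : E => ENNReal.ofReal (C * Real.exp (-(2⁻¹ * ‖z‖)))) (-w)]
    simp only [← sub_eq_add_neg]
  rw [h0, ← l2norm_const_mul _ (by fun_prop)]
  refine l2norm_mono fun z => ?_
  refine (mul_le_mul_right (hΓ w z) _).trans ?_
  rw [enorm_cutoff_eq, expEnvelope, ← ENNReal.ofReal_mul (cutoff_pos _ _ _).le,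
    ← ENNReal.ofReal_mul (by positivity)]
  refine ENNReal.ofReal_le_ofReal ?_
  rw [cutoff, mul_left_comm, mul_left_comm (Real.exp (-(N⁻¹ * ‖y - w‖))), ← Real.exp_add,
    ← Real.exp_add]
  refine mul_le_mul_of_nonneg_left (Real.exp_le_exp.2 ?_) hC
  have hN0 : 0 < N := by linarith
  have h1 : ‖z - w‖ / N ≤ ‖z - w‖ / 2 := by gcongr
  have h2 : ‖y - w‖ ≤ ‖z - y‖ + ‖z - w‖ := by
    rw [norm_sub_rev z y]
    exact norm_sub_le_norm_sub_add_norm_sub _ _ _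
  have h3 : N⁻¹ * ‖y - w‖ ≤ ‖z - y‖ / N + ‖z - w‖ / N := by
    rw [← add_div, inv_mul_eq_div]
    gcongr
  rw [norm_sub_rev w z]
  linarith

/-- A function with finite integral has small integral off large balls. -/
theorem _root_.exists_lintegral_tail_le {K : E → ℝ≥0∞}
    (hfin : ∫⁻ s, K s ∂μ ≠ ∞) {ε : ℝ≥0∞} (hε : ε ≠ 0) :
    ∃ R : ℝ, 0 ≤ R ∧ ∫⁻ s, {s | R < ‖s‖}.indicator K s ∂μ ≤ ε := by
  have hset : ∀ R : ℝ, MeasurableSet {s : E | R < ‖s‖} := fun R =>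
    measurableSet_lt measurable_const measurable_norm
  have h1 : Tendsto (fun n : ℕ => (μ.withDensity K) {s : E | (n : ℝ) < ‖s‖}) atTop
      (𝓝 ((μ.withDensity K) (⋂ n : ℕ, {s : E | (n : ℝ) < ‖s‖}))) := by
    refine tendsto_measure_iInter_atTop (fun n => (hset n).nullMeasurableSet) ?_ ⟨0, ?_⟩
    · intro m n hmn s hs
      simp only [Set.mem_ofPred_eq] at hs ⊢
      exact lt_of_le_of_lt (by exact_mod_cast hmn) hs
    · refine ne_top_of_le_ne_top ?_ (measure_mono (Set.subset_univ _))
      rwa [withDensity_apply _ MeasurableSet.univ, Measure.restrict_univ]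
  have h2 : (⋂ n : ℕ, {s : E | (n : ℝ) < ‖s‖}) = ∅ := by
    ext s
    simp only [Set.mem_iInter, Set.mem_ofPred_eq, Set.mem_empty_iff_false, iff_false, not_forall,
      not_lt]
    exact exists_nat_ge _
  rw [h2, measure_empty] at h1
  obtain ⟨n, hn⟩ := (h1.eventually_lt_const (pos_iff_ne_zero.2 hε)).exists
  refine ⟨n, by positivity, ?_⟩
  rw [lintegral_indicator (hset n), ← withDensity_apply _ (hset n)]
  exact hn.le

/-- A noncommutative Wiener lemma. If a boundedly invertible self-adjoint operator `T` has a matrix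
`⟨e_w, T e_z⟩` dominated by a convolution kernel in weighted `L¹`, then so has its inverse. The
weight need only be submultiplicative and of subexponential growth. -/
theorem exists_inverse_kernel_bound (he : IsParsevalFamily μ e) {T : H →L[ℂ] H}
    (hT : ∀ x y, inner ℂ (T x) y = inner ℂ x (T y)) {A : ℝ} (hA : 0 < A)
    (hTA : ∀ x, A * ‖x‖ ≤ ‖T x‖) {C : ℝ} (hC : 0 ≤ C) {κ : E → ℝ≥0∞} (hκm : Measurable κ)
    (hΓ : ∀ z w, ‖inner ℂ (e w) (e z)‖ₑ ≤ expEnvelope C (z - w))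
    (hκ : ∀ z w, ‖inner ℂ (e w) (T (e z))‖ₑ ≤ κ (z - w)) {ω : E → ℝ≥0∞} (hω : Measurable ω)
    (hω1 : ∀ x, 1 ≤ ω x) (hsub : ∀ x y, ω (x + y) ≤ ω x * ω y)
    (hexp : ∀ δ : ℝ, 0 < δ → ∫⁻ x, ENNReal.ofReal (Real.exp (-(δ * ‖x‖))) * ω x ∂μ ≠ ∞)
    (hκω : ∫⁻ x, κ x * ω x ∂μ ≠ ∞) :
    ∃ 𝒜 : E → ℝ≥0∞, Measurable 𝒜 ∧ ∫⁻ x, 𝒜 x * ω x ∂μ ≠ ∞ ∧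
      ∀ (w : E) (f : H), T f = e w → ∀ y, ‖inner ℂ (e y) f‖ₑ ≤ 𝒜 (y - w) := by
  set K : E → ℝ≥0∞ := fun s => expEnvelope C s + ENNReal.ofReal A⁻¹ * κ s with hK
  have hKm : Measurable K := by fun_prop
  have hKω : ∫⁻ s, K s * ω s ∂μ ≠ ∞ := by
    have : ∀ s, K s * ω s = ENNReal.ofReal C * (ENNReal.ofReal (Real.exp (-(1 * ‖s‖))) * ω s) +
        ENNReal.ofReal A⁻¹ * (κ s * ω s) := by
      intro s
      rw [hK]
      simp only [expEnvelope, one_mul, ENNReal.ofReal_mul hC]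
      ring
    simp_rw [this]
    rw [lintegral_add_left (by fun_prop), lintegral_const_mul _ (by fun_prop),
      lintegral_const_mul _ (by fun_prop)]
    exact ENNReal.add_ne_top.2 ⟨ENNReal.mul_ne_top ENNReal.ofReal_ne_top (hexp 1 one_pos),
      ENNReal.mul_ne_top ENNReal.ofReal_ne_top hκω⟩
  have hK1 : ∫⁻ s, K s ∂μ ≠ ∞ := by
    refine ne_top_of_le_ne_top hKω (lintegral_mono fun s => ?_)
    simpa using mul_le_mul_right (hω1 s) (K s)
  obtain ⟨R, hR0, hR⟩ := exists_lintegral_tail_le (μ := μ) hKω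
    (ε := 4⁻¹) (by simp)
  have hRω : ∫⁻ s, {s | R < ‖s‖}.indicator K s * ω s ∂μ ≤ 4⁻¹ := by
    refine le_trans (le_of_eq ?_) hR
    refine lintegral_congr fun s => ?_
    by_cases hs : s ∈ {s : E | R < ‖s‖}
    · rw [Set.indicator_of_mem hs, Set.indicator_of_mem hs]
    · rw [Set.indicator_of_notMem hs, Set.indicator_of_notMem hs, zero_mul]
  have hR1 : ∫⁻ s, {s | R < ‖s‖}.indicator K s ∂μ ≤ 4⁻¹ := by
    refine (lintegral_mono fun s => ?_).trans hRω
    simpa using mul_le_mul_right (hω1 s) ({s | R < ‖s‖}.indicator K s)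
  -- the scale `N` of the cut-off is chosen after the radius `R` of the near-diagonal part
  obtain ⟨N, hN2, hNs⟩ : ∃ N : ℝ, 2 ≤ N ∧
      ENNReal.ofReal (Real.exp (R / N) - 1) * ∫⁻ s, K s ∂μ ≤ 4⁻¹ := by
    have h1 : Tendsto (fun N : ℝ => ENNReal.ofReal (Real.exp (R / N) - 1) * ∫⁻ s, K s ∂μ) atTop
        (𝓝 (ENNReal.ofReal (Real.exp 0 - 1) * ∫⁻ s, K s ∂μ)) := by
      refine ENNReal.Tendsto.mul_const ?_ (Or.inr hK1)
      refine ENNReal.tendsto_ofReal (Tendsto.sub_const ?_ 1)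
      exact (Real.continuous_exp.tendsto 0).comp (tendsto_const_nhds.div_atTop tendsto_id)
    simp only [Real.exp_zero, sub_self, ENNReal.ofReal_zero, zero_mul] at h1
    obtain ⟨N, hN, hN2⟩ := ((h1.eventually_lt_const (u := 4⁻¹) (by simp)).and
      (eventually_ge_atTop 2)).exists
    exact ⟨N, hN2, hN.le⟩
  have hN0 : 0 < N := by linarith
  -- `L` relates the local norms to the coefficients in both directions
  set L : ℝ≥0∞ := l2norm μ (fun z : E => ENNReal.ofReal (C * Real.exp (-(2⁻¹ * ‖z‖)))) with hL
  have hLfin : L ≠ ∞ := by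
    rw [hL, l2norm]
    refine ENNReal.rpow_ne_top_of_nonneg (by norm_num) ?_
    have : ∀ z : E, ENNReal.ofReal (C * Real.exp (-(2⁻¹ * ‖z‖))) ^ (2 : ℝ) ≤
        ENNReal.ofReal C ^ 2 * (ENNReal.ofReal (Real.exp (-(1 * ‖z‖))) * ω z) := by
      intro z
      rw [ENNReal.rpow_two, ENNReal.ofReal_mul hC, mul_pow]
      gcongr
      rw [sq, ← ENNReal.ofReal_mul (by positivity), ← Real.exp_add]
      refine le_trans (le_of_eq ?_) (le_mul_of_one_le_right' (hω1 z))
      congr 2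
      ring
    refine ne_top_of_le_ne_top ?_ (lintegral_mono this)
    rw [lintegral_const_mul _ (by fun_prop)]
    exact ENNReal.mul_ne_top (by simp) (hexp 1 one_pos)
  -- convolutor and inhomogeneity of the inequality satisfied by the local norms
  set m : E → ℝ≥0∞ := fun s => 2 * {s | R < ‖s‖}.indicator K s with hm
  have hset : MeasurableSet {s : E | R < ‖s‖} := measurableSet_lt measurable_const measurable_norm
  have hmm : Measurable m := (hKm.indicator hset).const_mul 2
  have hmω : ∫⁻ s, m s * ω s ∂μ ≤ 2⁻¹ := by
    simp only [hm, mul_assoc]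
    rw [lintegral_const_mul _ ((hKm.indicator hset).fun_mul hω)]
    refine (mul_le_mul_right hRω 2).trans (le_of_eq ?_)
    rw [← ENNReal.toReal_eq_toReal_iff' (by simp [ENNReal.mul_eq_top]) (by simp),
      ENNReal.toReal_mul]
    norm_num
  set b : E → ℝ≥0∞ := fun y =>
    2 * ENNReal.ofReal A⁻¹ * (ENNReal.ofReal (Real.exp (-(N⁻¹ * ‖y‖))) * L) with hb
  have hbm : Measurable b := by fun_prop
  refine ⟨fun y => L * neumann μ m b y, (measurable_neumann hmm hbm).const_mul L, ?_, ?_⟩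
  · simp only [mul_assoc]
    rw [lintegral_const_mul _ ((measurable_neumann hmm hbm).fun_mul hω)]
    refine ENNReal.mul_ne_top hLfin ?_
    refine ne_top_of_le_ne_top ?_ (lintegral_neumann_mul_le hmm hbm hω hsub hmω)
    refine ENNReal.mul_ne_top (by simp) ?_
    have : ∀ y, b y * ω y = 2 * ENNReal.ofReal A⁻¹ * L *
        (ENNReal.ofReal (Real.exp (-(N⁻¹ * ‖y‖))) * ω y) := fun y => by rw [hb]; ring
    simp_rw [this]
    rw [lintegral_const_mul _ (by fun_prop)]
    exact ENNReal.mul_ne_top (ENNReal.mul_ne_top (ENNReal.mul_ne_top (by simp)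
      ENNReal.ofReal_ne_top) hLfin) (hexp _ (by positivity))
  · intro w f hf y
    refine (he.enorm_coeff_le_localNorm hC hΓ hN2 f y).trans (mul_le_mul_right ?_ L)
    have hle : ∀ y, localNorm μ N (fun z => inner ℂ (e z) f) (y + w) ≤ neumann μ m b y := by
      intro y
      refine le_neumann (a := fun y => localNorm μ N (fun z => inner ℂ (e z) f) (y + w))
        hmm hbm hω1 hmω (M := ‖f‖ₑ) enorm_ne_top ?_ ?_ y
      · intro y
        refine (localNorm_le hN0 _ _).trans (le_of_eq (he.parseval f))
      · intro y
        refine (he.localNorm_coeff_le_nconv hT hA hTA (measurable_expEnvelope C) hκm hΓ hκ hN0 hNs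
          hR1 f (y + w)).trans ?_
        refine add_le_add ?_ (le_of_eq ?_)
        · rw [hf]
          refine (mul_le_mul_right (localNorm_coeff_self_le hΓ hN2 hC w (y + w)) _).trans
            (le_of_eq ?_)
          rw [add_sub_cancel_right]
        · unfold nconv
          refine lintegral_congr fun s => ?_
          rw [add_sub_right_comm]
    simpa using hle (y - w)

end IsParsevalFamily

end Decay

/-! ### Submultiplicative weights of subexponential growth -/

/-- Exponential decay beats polynomial growth. -/
theorem exists_exp_neg_mul_pow_le {a : ℝ} (ha : 0 < a) (n : ℕ) :
    ∃ D : ℝ, 0 ≤ D ∧ ∀ t : ℝ, 0 ≤ t → Real.exp (-(a * t)) * (1 + t) ^ n ≤ D := by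
  set s : ℝ := (max 1 (1 / a)) with hs
  have hs1 : 1 ≤ s := le_max_left _ _
  have hsa : 1 / a ≤ s := le_max_right _ _
  refine ⟨n.factorial * s ^ n * Real.exp 1, by positivity, fun t ht => ?_⟩
  have h1 : 1 + t ≤ s * (1 + a * t) := by
    have : 1 ≤ s * a := by
      calc 1 = 1 / a * a := by field_simp
        _ ≤ s * a := by gcongr
    nlinarith
  have h2 := Real.pow_div_factorial_le_exp (1 + a * t) (by positivity) n
  rw [div_le_iff₀ (by positivity)] at h2
  calc Real.exp (-(a * t)) * (1 + t) ^ n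
      ≤ Real.exp (-(a * t)) * (s * (1 + a * t)) ^ n := by gcongr
    _ = Real.exp (-(a * t)) * (s ^ n * (1 + a * t) ^ n) := by rw [mul_pow]
    _ ≤ Real.exp (-(a * t)) * (s ^ n * (Real.exp (1 + a * t) * n.factorial)) := by gcongr
    _ = n.factorial * s ^ n * (Real.exp (-(a * t)) * Real.exp (1 + a * t)) := by ring
    _ = _ := by
      rw [← Real.exp_add]
      congr 2
      ring

section Weights

variable {E : Type*} [NormedAddCommGroup E] [MeasurableSpace E]

/-- Symmetric submultiplicative weights `ω ≥ 1` of subexponential growth. -/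
structure SubexpWeight (ω : E → ℝ≥0∞) : Prop where
  measurable : Measurable ω
  one_le : ∀ x, 1 ≤ ω x
  submul : ∀ x y, ω (x + y) ≤ ω x * ω y
  neg : ∀ x, ω (-x) = ω x
  growth : ∀ δ : ℝ, 0 < δ → ∃ C : ℝ≥0, ∀ x, ω x ≤ C * ENNReal.ofReal (Real.exp (δ * ‖x‖))

/-- Functions that change by at most the factor `e^{‖y‖}` under a translation by `y`. -/
def Moderate (K : E → ℝ≥0∞) : Prop :=
  ∀ x y, K (x + y) ≤ ENNReal.ofReal (Real.exp ‖y‖) * K x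

theorem Moderate.neg {K : E → ℝ≥0∞} (hK : Moderate K) : Moderate fun x => K (-x) := by
  intro x y
  have := hK (-x) (-y)
  rwa [norm_neg, ← neg_add] at this

theorem Moderate.le_exp_one_mul {K : E → ℝ≥0∞} (hK : Moderate K) {x y : E} (hy : ‖y‖ ≤ 1) :
    K x ≤ ENNReal.ofReal (Real.exp 1) * K (x + y) := by
  have := hK (x + y) (-y)
  rw [add_neg_cancel_right, norm_neg] at this
  refine this.trans ?_
  gcongr

theorem moderate_expEnvelope {C : ℝ} (hC : 0 ≤ C) : Moderate (expEnvelope C : E → ℝ≥0∞) := by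
  intro x y
  unfold expEnvelope
  rw [← ENNReal.ofReal_mul (by positivity)]
  refine ENNReal.ofReal_le_ofReal ?_
  rw [mul_left_comm, ← Real.exp_add]
  gcongr
  have := norm_sub_norm_le x (-y)
  rw [norm_neg, sub_neg_eq_add] at this
  linarith

theorem Moderate.nconv [BorelSpace E] [SecondCountableTopology E] {μ : Measure E} {m u : E → ℝ≥0∞}
    (hm : Measurable m) (hum : Measurable u) (hu : Moderate u) : Moderate (nconv μ m u) := by
  intro x y
  unfold _root_.nconv
  rw [← lintegral_const_mul _ (by fun_prop)]
  refine lintegral_mono fun s => ?_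
  calc m s * u (x + y - s) ≤ m s * (ENNReal.ofReal (Real.exp ‖y‖) * u (x - s)) := by
        gcongr
        rw [add_sub_right_comm]
        exact hu _ _
    _ = _ := by ring

namespace SubexpWeight

variable {ω : E → ℝ≥0∞}

theorem ne_top (hω : SubexpWeight ω) (x : E) : ω x ≠ ∞ := by
  obtain ⟨C, hC⟩ := hω.growth 1 one_pos
  exact ne_top_of_le_ne_top (ENNReal.mul_ne_top ENNReal.coe_ne_top ENNReal.ofReal_ne_top) (hC x)

theorem le_mul_sub (hω : SubexpWeight ω) (x y : E) : ω x ≤ ω (x - y) * ω y := by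
  simpa using hω.submul (x - y) y

variable [BorelSpace E] [NormedSpace ℝ E] [FiniteDimensional ℝ E] {μ : Measure E}
  [μ.IsAddHaarMeasure]

theorem lintegral_exp_mul_ne_top (hω : SubexpWeight ω) {δ : ℝ} (hδ : 0 < δ) :
    ∫⁻ x, ENNReal.ofReal (Real.exp (-(δ * ‖x‖))) * ω x ∂μ ≠ ∞ := by
  obtain ⟨C, hC⟩ := hω.growth (δ / 2) (by positivity)
  set n : ℕ := Module.finrank ℝ E + 1 with hn
  have hint : ∫⁻ x : E, ENNReal.ofReal ((1 + ‖x‖) ^ (-(n : ℝ))) ∂μ ≠ ∞ := by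
    have h : Integrable (fun x : E => (1 + ‖x‖) ^ (-(n : ℝ))) μ :=
      integrable_one_add_norm (by rw [hn]; push_cast; linarith)
    have := h.hasFiniteIntegral
    rw [HasFiniteIntegral] at this
    refine ne_top_of_le_ne_top this.ne (lintegral_mono fun x => ?_)
    rw [← Real.enorm_eq_ofReal (by positivity)]
  obtain ⟨D, -, hD'⟩ := exists_exp_neg_mul_pow_le (a := δ / 2) (by positivity) n
  have hD : ∀ t : ℝ, 0 ≤ t → Real.exp (-(δ / 2 * t)) ≤ D * (1 + t) ^ (-(n : ℝ)) := by
    intro t ht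
    rw [Real.rpow_neg (by positivity), Real.rpow_natCast, ← div_eq_mul_inv,
      le_div_iff₀ (by positivity)]
    exact hD' t ht
  refine ne_top_of_le_ne_top ?_ (lintegral_mono (g := fun x =>
    (C * ENNReal.ofReal D) * ENNReal.ofReal ((1 + ‖x‖) ^ (-(n : ℝ)))) fun x => ?_)
  · rw [lintegral_const_mul _ (by fun_prop)]
    exact ENNReal.mul_ne_top (ENNReal.mul_ne_top ENNReal.coe_ne_top ENNReal.ofReal_ne_top) hint
  · calc ENNReal.ofReal (Real.exp (-(δ * ‖x‖))) * ω x
        ≤ ENNReal.ofReal (Real.exp (-(δ * ‖x‖))) *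
            (C * ENNReal.ofReal (Real.exp (δ / 2 * ‖x‖))) := by gcongr; exact hC x
      _ = C * ENNReal.ofReal (Real.exp (-(δ / 2 * ‖x‖))) := by
          rw [mul_left_comm, ← ENNReal.ofReal_mul (by positivity), ← Real.exp_add]
          congr 3
          ring
      _ ≤ C * ENNReal.ofReal (D * (1 + ‖x‖) ^ (-(n : ℝ))) := by
          gcongr
          exact hD _ (norm_nonneg _)
      _ = C * ENNReal.ofReal D * ENNReal.ofReal ((1 + ‖x‖) ^ (-(n : ℝ))) := by
          rw [ENNReal.ofReal_mul' (by positivity), mul_assoc]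

theorem lintegral_expEnvelope_mul_ne_top (hω : SubexpWeight ω) (C : ℝ) :
    ∫⁻ x, expEnvelope C x * ω x ∂μ ≠ ∞ := by
  have h : ∀ x, expEnvelope C x * ω x ≤
      ENNReal.ofReal C * (ENNReal.ofReal (Real.exp (-(1 * ‖x‖))) * ω x) := by
    intro x
    rw [expEnvelope, ENNReal.ofReal_mul' (by positivity), one_mul, mul_assoc]
  refine ne_top_of_le_ne_top ?_ (lintegral_mono h)
  have := hω.measurable
  rw [lintegral_const_mul _ (by fun_prop)]
  exact ENNReal.mul_ne_top ENNReal.ofReal_ne_top (hω.lintegral_exp_mul_ne_top one_pos)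

theorem lintegral_neg_mul (hω : SubexpWeight ω) (K : E → ℝ≥0∞) :
    ∫⁻ x, K (-x) * ω x ∂μ = ∫⁻ x, K x * ω x ∂μ := by
  rw [← lintegral_neg_eq_self (fun x => K x * ω x)]
  simp_rw [hω.neg]

theorem lintegral_nconv_neg_mul_le (hω : SubexpWeight ω) {K L : E → ℝ≥0∞} (hK : Measurable K)
    (hL : Measurable L) :
    ∫⁻ x, nconv μ (fun x => K (-x)) L x * ω x ∂μ ≤
      (∫⁻ x, K x * ω x ∂μ) * ∫⁻ x, L x * ω x ∂μ := by
  rw [← hω.lintegral_neg_mul K]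
  exact lintegral_nconv_mul_le (by fun_prop) hL hω.measurable hω.submul

end SubexpWeight

end Weights

/-! ### Sums over discrete subgroups -/

section LatticeSums

variable {E : Type*} [NormedAddCommGroup E] [NormedSpace ℝ E] [FiniteDimensional ℝ E]
  [MeasurableSpace E] [BorelSpace E] (μ : Measure E) [μ.IsAddHaarMeasure]
  (Λ : Submodule ℤ E) [DiscreteTopology Λ]

/-- Sums over a discrete subgroup are dominated by integrals of a local majorant. -/
theorem exists_tsum_le_lintegral : ∃ c : ℝ≥0, ∀ f F : E → ℝ≥0∞,
    (∀ x y, ‖y‖ ≤ 1 → f x ≤ F (x + y)) → ∑' l : Λ, f l ≤ c * ∫⁻ x, F x ∂μ := by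
  -- the balls of a small radius `ρ ≤ 1` around the lattice points are disjoint
  obtain ⟨r, hr, hΛ⟩ : ∃ r : ℝ, 0 < r ∧ ∀ l : Λ, ‖(l : E)‖ < r → l = 0 := by
    obtain ⟨r, hr, h⟩ := Metric.isOpen_iff.1 (isOpen_discrete ({0} : Set Λ)) 0 rfl
    refine ⟨r, hr, fun l hl => ?_⟩
    have : l ∈ Metric.ball (0 : Λ) r := by
      rw [mem_ball_zero_iff]
      exact hl
    simpa using h this
  set ρ : ℝ := min (r / 2) 1 with hρ
  have hρ0 : 0 < ρ := by positivity
  have hdisj : Pairwise (Function.onFun Disjoint fun l : Λ => Metric.ball (l : E) ρ) := by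
    intro l m hlm
    refine Metric.ball_disjoint_ball ?_
    by_contra hlt
    refine hlm (sub_eq_zero.1 (hΛ (l - m) ?_))
    rw [AddSubgroupClass.coe_sub, ← dist_eq_norm]
    have : ρ ≤ r / 2 := min_le_left _ _
    linarith
  have : Countable Λ := countable_of_Lindelof_of_discrete
  have hvol : μ (Metric.ball (0 : E) ρ) ≠ 0 := (Metric.measure_ball_pos μ 0 hρ0).ne'
  have hvol' : μ (Metric.ball (0 : E) ρ) ≠ ∞ := measure_ball_lt_top.ne
  refine ⟨(μ (Metric.ball (0 : E) ρ))⁻¹.toNNReal, fun f F hfF => ?_⟩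
  rw [ENNReal.coe_toNNReal (ENNReal.inv_ne_top.2 hvol)]
  have h1 : ∀ l : Λ, μ (Metric.ball (0 : E) ρ) * f l ≤ ∫⁻ x in Metric.ball (l : E) ρ, F x ∂μ := by
    intro l
    calc μ (Metric.ball (0 : E) ρ) * f l = ∫⁻ x in Metric.ball (l : E) ρ, f l ∂μ := by
          rw [setLIntegral_const, mul_comm, Measure.addHaar_ball_center μ (l : E)]
      _ ≤ _ := by
          refine setLIntegral_mono' Metric.isOpen_ball.measurableSet fun x hx => ?_
          have := hfF l (x - l) ?_
          · simpa using this
          · rw [← dist_eq_norm]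
            exact (Metric.mem_ball.1 hx).le.trans (min_le_right _ _)
  have h2 : μ (Metric.ball (0 : E) ρ) * ∑' l : Λ, f l ≤ ∫⁻ x, F x ∂μ := by
    rw [← ENNReal.tsum_mul_left]
    refine (ENNReal.tsum_le_tsum h1).trans ?_
    rw [← lintegral_iUnion (fun l => Metric.isOpen_ball.measurableSet) hdisj]
    exact setLIntegral_le_lintegral _ _
  calc ∑' l : Λ, f l = (μ (Metric.ball (0 : E) ρ))⁻¹ *
        (μ (Metric.ball (0 : E) ρ) * ∑' l : Λ, f l) := by
        rw [← mul_assoc, ENNReal.inv_mul_cancel hvol hvol', one_mul]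
    _ ≤ _ := by gcongr

/-- Sums of a moderate function against a weight are dominated by the weighted `L¹` norm. -/
theorem exists_tsum_mul_weight_le {ω : E → ℝ≥0∞} (hω : SubexpWeight ω) : ∃ c : ℝ≥0,
    ∀ K : E → ℝ≥0∞, Measurable K → Moderate K → ∀ x : E,
      ∑' l : Λ, K (l + x) * ω (l + x) ≤ c * ∫⁻ y, K y * ω y ∂μ := by
  obtain ⟨c, hc⟩ := exists_tsum_le_lintegral μ Λ
  obtain ⟨C, hC⟩ := hω.growth 1 one_pos
  refine ⟨c * (Real.exp 1).toNNReal * (C * (Real.exp 1).toNNReal), fun K hKm hK x => ?_⟩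
  have hωm := hω.measurable
  set B : ℝ≥0∞ := ENNReal.ofReal (Real.exp 1) * (C * ENNReal.ofReal (Real.exp 1)) with hB
  have h1 := hc (fun y => K (y + x) * ω (y + x)) (fun y => B * (K (y + x) * ω (y + x))) ?_
  · refine h1.trans (le_of_eq ?_)
    rw [lintegral_const_mul _ (by fun_prop), lintegral_add_right_eq_self (fun y => K y * ω y) x, hB]
    simp only [ENNReal.ofReal, ENNReal.coe_mul]
    ring
  · intro z y hy
    have h2 : K (z + x) ≤ ENNReal.ofReal (Real.exp 1) * K (z + y + x) := by
      have := hK.le_exp_one_mul (x := z + x) hy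
      rwa [add_right_comm]
    have h3 : ω (z + x) ≤ ω (z + y + x) * (C * ENNReal.ofReal (Real.exp 1)) := by
      have h4 := hω.le_mul_sub (z + x) (-y)
      rw [hω.neg, sub_neg_eq_add, add_right_comm] at h4
      refine h4.trans ?_
      gcongr
      refine (hC y).trans ?_
      rw [one_mul]
      gcongr
    calc K (z + x) * ω (z + x) ≤ (ENNReal.ofReal (Real.exp 1) * K (z + y + x)) *
          (ω (z + y + x) * (C * ENNReal.ofReal (Real.exp 1))) := by gcongr
      _ = _ := by rw [hB]; ring

/-- Correlation sums of moderate functions are dominated by convolutions. -/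
theorem exists_tsum_mul_le_nconv : ∃ c : ℝ≥0, ∀ K L : E → ℝ≥0∞, Measurable K → Measurable L →
    Moderate K → Moderate L → ∀ x y : E,
      ∑' l : Λ, K (l + x) * L (l + y) ≤ c * nconv μ (fun x => K (-x)) L (y - x) := by
  obtain ⟨c, hc⟩ := exists_tsum_le_lintegral μ Λ
  refine ⟨c * (Real.exp 1).toNNReal * (Real.exp 1).toNNReal, fun K L hKm hLm hK hL x y => ?_⟩
  set B : ℝ≥0∞ := ENNReal.ofReal (Real.exp 1) * ENNReal.ofReal (Real.exp 1) with hB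
  have h1 := hc (fun z => K (z + x) * L (z + y)) (fun z => B * (K (z + x) * L (z + y))) ?_
  · refine h1.trans (le_of_eq ?_)
    rw [lintegral_const_mul _ (by fun_prop), hB]
    have : ∫⁻ z, K (z + x) * L (z + y) ∂μ = nconv μ (fun x => K (-x)) L (y - x) := by
      unfold nconv
      rw [← lintegral_sub_left_eq_self (fun s => K (-s) * L (y - x - s)) (-x)]
      refine lintegral_congr fun z => ?_
      congr 2 <;> abel
    rw [this]
    simp only [ENNReal.ofReal, ENNReal.coe_mul]
    ring
  · intro z t ht
    have h2 : K (z + x) ≤ ENNReal.ofReal (Real.exp 1) * K (z + t + x) := by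
      have := hK.le_exp_one_mul (x := z + x) ht
      rwa [add_right_comm]
    have h3 : L (z + y) ≤ ENNReal.ofReal (Real.exp 1) * L (z + t + y) := by
      have := hL.le_exp_one_mul (x := z + y) ht
      rwa [add_right_comm]
    calc K (z + x) * L (z + y) ≤ (ENNReal.ofReal (Real.exp 1) * K (z + t + x)) *
          (ENNReal.ofReal (Real.exp 1) * L (z + t + y)) := by gcongr
      _ = _ := by rw [hB]; ring

end LatticeSums

/-! ### Admissible weights -/

namespace AdmissibleWeight

variable {d : ℕ} {v : Phase d → ℝ}

theorem map_neg (hv : AdmissibleWeight v) (z : Phase d) : v (-z) = v z :=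
  hv.even _ _ (fun i => by simp) fun i => by simp

theorem one_le (hv : AdmissibleWeight v) (z : Phase d) : 1 ≤ v z := by
  have h := hv.submul z (-z)
  rw [add_neg_cancel, hv.map_zero, hv.map_neg] at h
  nlinarith [hv.nonneg z]

/-- Subexponential growth along a line: at the multiples of `b` this is the Gelfand-Raikov-Shilov
condition, and in between the weight is bounded by continuity. -/
theorem exists_le_exp_line (hv : AdmissibleWeight v) (b : Phase d) {δ : ℝ} (hδ : 0 < δ) :
    ∃ C : ℝ, 0 ≤ C ∧ ∀ t : ℝ, v (t • b) ≤ C * Real.exp (δ * |t|) := by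
  have h1 : ∀ᶠ n : ℕ in atTop, v (n • b) ^ (1 / (n : ℝ)) < Real.exp δ :=
    (hv.grs b).eventually_lt_const (by simpa using hδ)
  obtain ⟨N, hN⟩ := eventually_atTop.1 (h1.and (eventually_gt_atTop 0))
  have h2 : ∀ n : ℕ, v (n • b) ≤ (1 + ∑ i ∈ Finset.range N, v (i • b)) * Real.exp (δ * n) := by
    intro n
    have hs : 0 ≤ ∑ i ∈ Finset.range N, v (i • b) := Finset.sum_nonneg fun i _ => hv.nonneg _
    have he : 1 ≤ Real.exp (δ * n) := Real.one_le_exp (by positivity)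
    by_cases hn : n < N
    · have : v (n • b) ≤ ∑ i ∈ Finset.range N, v (i • b) :=
        Finset.single_le_sum (f := fun i : ℕ => v (i • b)) (fun i _ => hv.nonneg _)
          (Finset.mem_range.2 hn)
      nlinarith
    · obtain ⟨h3, h4⟩ := hN n (not_lt.1 hn)
      have h5 : v (n • b) ≤ Real.exp (δ * n) := by
        have h6 := Real.rpow_le_rpow (Real.rpow_nonneg (hv.nonneg (n • b)) _) h3.le
          (Nat.cast_nonneg n)
        rw [← Real.rpow_mul (hv.nonneg _), one_div_mul_cancel (by positivity), Real.rpow_one,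
          ← Real.exp_mul] at h6
        exact h6
      nlinarith
  obtain ⟨B, hB⟩ := (isCompact_Icc (a := (0 : ℝ)) (b := 1)).exists_bound_of_continuousOn
    (f := fun t : ℝ => v (t • b)) (by
      have := hv.continuous
      fun_prop)
  have hB0 : 0 ≤ B := (norm_nonneg _).trans (hB 0 (by simp))
  have hs : 0 ≤ ∑ i ∈ Finset.range N, v (i • b) := Finset.sum_nonneg fun i _ => hv.nonneg _
  refine ⟨(1 + ∑ i ∈ Finset.range N, v (i • b)) * B, by positivity, fun t => ?_⟩
  have habs : v (t • b) = v (|t| • b) := by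
    rcases abs_choice t with h | h
    · rw [h]
    · rw [h, neg_smul, hv.map_neg]
  rw [habs]
  have hdec : |t| • b = ⌊|t|⌋₊ • b + (|t| - ⌊|t|⌋₊) • b := by
    rw [← Nat.cast_smul_eq_nsmul ℝ, ← add_smul]
    congr 1
    ring
  rw [hdec]
  refine (hv.submul _ _).trans ?_
  have h7 : v ((|t| - ⌊|t|⌋₊) • b) ≤ B := by
    refine (le_abs_self _).trans (hB (|t| - ⌊|t|⌋₊) ⟨?_, ?_⟩)
    · have := Nat.floor_le (abs_nonneg t)
      linarith
    · have := Nat.lt_floor_add_one |t|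
      linarith
  have h8 : Real.exp (δ * ⌊|t|⌋₊) ≤ Real.exp (δ * |t|) := by
    gcongr
    exact Nat.floor_le (abs_nonneg t)
  calc v (⌊|t|⌋₊ • b) * v ((|t| - ⌊|t|⌋₊) • b)
      ≤ ((1 + ∑ i ∈ Finset.range N, v (i • b)) * Real.exp (δ * ⌊|t|⌋₊)) * B :=
        mul_le_mul (h2 _) h7 (hv.nonneg _) (by positivity)
    _ ≤ ((1 + ∑ i ∈ Finset.range N, v (i • b)) * Real.exp (δ * |t|)) * B := by gcongr
    _ = _ := by ring

theorem map_sum_le (hv : AdmissibleWeight v) {ι : Type*} (s : Finset ι) (f : ι → Phase d) :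
    v (∑ i ∈ s, f i) ≤ ∏ i ∈ s, v (f i) := by
  classical
  induction s using Finset.induction_on with
  | empty => simp [hv.map_zero]
  | insert i s hi ih =>
    rw [Finset.sum_insert hi, Finset.prod_insert hi]
    exact (hv.submul _ _).trans (mul_le_mul_of_nonneg_left ih (hv.nonneg _))

/-- The Gelfand-Raikov-Shilov condition implies subexponential growth. -/
theorem exists_le_exp (hv : AdmissibleWeight v) {δ : ℝ} (hδ : 0 < δ) :
    ∃ C : ℝ, 0 ≤ C ∧ ∀ z, v z ≤ C * Real.exp (δ * ‖z‖) := by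
  set b := Module.finBasis ℝ (Phase d) with hb
  set coord : Fin (Module.finrank ℝ (Phase d)) → (Phase d →L[ℝ] ℝ) := fun i =>
    LinearMap.toContinuousLinearMap (b.coord i) with hcoord
  set S : ℝ := 1 + ∑ i, ‖coord i‖ with hS
  have hS0 : 0 < S := by
    have : 0 ≤ ∑ i, ‖coord i‖ := Finset.sum_nonneg fun i _ => norm_nonneg _
    linarith
  choose C hC0 hC using fun i => hv.exists_le_exp_line (b i) (δ := δ / S) (by positivity)
  refine ⟨∏ i, C i, Finset.prod_nonneg fun i _ => hC0 i, fun z => ?_⟩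
  have hz : z = ∑ i, coord i z • b i := (b.sum_repr z).symm
  calc v z = v (∑ i, coord i z • b i) := by rw [← hz]
    _ ≤ ∏ i, v (coord i z • b i) := hv.map_sum_le _ _
    _ ≤ ∏ i, (C i * Real.exp (δ / S * |coord i z|)) :=
        Finset.prod_le_prod (fun i _ => hv.nonneg _) fun i _ => hC i _
    _ = (∏ i, C i) * Real.exp (∑ i, δ / S * |coord i z|) := by
        rw [Finset.prod_mul_distrib, Real.exp_sum]
    _ ≤ (∏ i, C i) * Real.exp (δ * ‖z‖) := by
        refine mul_le_mul_of_nonneg_left (Real.exp_le_exp.2 ?_)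
          (Finset.prod_nonneg fun i _ => hC0 i)
        rw [← Finset.mul_sum, div_mul_eq_mul_div, div_le_iff₀ hS0, mul_assoc]
        refine mul_le_mul_of_nonneg_left ?_ hδ.le
        calc ∑ i, |coord i z| ≤ ∑ i, ‖coord i‖ * ‖z‖ :=
              Finset.sum_le_sum fun i _ => (coord i).le_opNorm z
          _ = (∑ i, ‖coord i‖) * ‖z‖ := by rw [Finset.sum_mul]
          _ ≤ ‖z‖ * S := by rw [mul_comm, hS]; gcongr; linarith

theorem subexpWeight (hv : AdmissibleWeight v) :
    SubexpWeight fun z : Phase d => ENNReal.ofReal (v z) where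
  measurable := hv.continuous.measurable.ennreal_ofReal
  one_le z := by simpa using hv.one_le z
  submul x y := by
    rw [← ENNReal.ofReal_mul (hv.nonneg _)]
    exact ENNReal.ofReal_le_ofReal (hv.submul x y)
  neg x := by simp only [hv.map_neg]
  growth δ hδ := by
    obtain ⟨C, hC0, hC⟩ := hv.exists_le_exp hδ
    refine ⟨C.toNNReal, fun x => ?_⟩
    refine (ENNReal.ofReal_le_ofReal (hC x)).trans (le_of_eq ?_)
    rw [ENNReal.ofReal_mul hC0]
    rfl

end AdmissibleWeight

/-! ### Interchanging continuous functionals and integrals -/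

/-- A linear functional that is bounded with respect to a seminorm induced by maps into Banach
spaces commutes with integrals in these spaces: by the Hahn-Banach theorem it factors through a
continuous functional. -/
theorem LinearMap.eq_integral_of_norm_le {V α ι : Type*} [AddCommGroup V] [Module ℂ V]
    [Fintype ι] {X : ι → Type*} [∀ i, NormedAddCommGroup (X i)] [∀ i, NormedSpace ℂ (X i)]
    [∀ i, CompleteSpace (X i)] [MeasurableSpace α] {μ : Measure α}
    (T : ∀ i, V →ₗ[ℂ] X i) (l : V →ₗ[ℂ] ℂ) {C : ℝ}
    (hl : ∀ x {r : ℝ}, 0 ≤ r → (∀ i, ‖T i x‖ ≤ r) → ‖l x‖ ≤ C * r) (ψ : α → V)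
    (hint : ∀ i, Integrable (fun a => T i (ψ a)) μ) {x : V}
    (hx : ∀ i, T i x = ∫ a, T i (ψ a) ∂μ) :
    l x = ∫ a, l (ψ a) ∂μ := by
  set S : V →ₗ[ℂ] (∀ i, X i) := LinearMap.pi T with hS
  have hlS : ∀ x, ‖l x‖ ≤ C * ‖S x‖ := fun x =>
    hl x (norm_nonneg _) fun i => norm_le_pi_norm (S x) i
  have hker : LinearMap.ker S ≤ LinearMap.ker l := by
    intro y hy
    have := hlS y
    rw [LinearMap.mem_ker.1 hy, norm_zero, mul_zero] at this
    exact norm_le_zero_iff.1 this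
  set l₀ : LinearMap.range S →ₗ[ℂ] ℂ :=
    ((LinearMap.ker S).liftQ l hker) ∘ₗ (S.quotKerEquivRange.symm : _ →ₗ[ℂ] _) with hl₀
  have hl₀T : ∀ y, l₀ ⟨S y, LinearMap.mem_range_self S y⟩ = l y := by
    intro y
    have : S.quotKerEquivRange ((LinearMap.ker S).mkQ y) = ⟨S y, LinearMap.mem_range_self S y⟩ :=
      rfl
    rw [hl₀, ← this]
    simp
  have hbd : ∀ y : LinearMap.range S, ‖l₀ y‖ ≤ C * ‖y‖ := by
    rintro ⟨_, y, rfl⟩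
    rw [hl₀T]
    exact hlS y
  obtain ⟨L, hL, -⟩ := exists_extension_norm_eq (LinearMap.range S) (l₀.mkContinuous C hbd)
  have hLT : ∀ y, L (S y) = l y := by
    intro y
    rw [← hl₀T y]
    exact hL ⟨S y, LinearMap.mem_range_self S y⟩
  have hSint : Integrable (fun a => S (ψ a)) μ := Integrable.of_eval hint
  have hSx : S x = ∫ a, S (ψ a) ∂μ := by
    funext i
    exact (hx i).trans (eval_integral (f := fun a => S (ψ a)) hint i).symm
  rw [← hLT, hSx, ← L.integral_comp_comm hSint]
  exact integral_congr_ae (Eventually.of_forall fun a => hLT (ψ a))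

/-! ### Integrals of Schwartz functions depending on a parameter -/

namespace SchwartzMap

variable {E : Type*} [NormedAddCommGroup E] [NormedSpace ℝ E]

variable (E) in
/-- Bounded continuous functions with values in the `n`-linear forms, where `n`-th derivatives
live. -/
abbrev DerivBCF (n : ℕ) : Type _ :=
  @BoundedContinuousFunction E (E [×n]→L[ℝ] ℂ) _
    (NormedAddCommGroup.toSeminormedAddCommGroup (E := E [×n]→L[ℝ] ℂ)).toPseudoMetricSpace

/-- The weighted derivative `p ↦ ‖p‖ ^ k • D^n f(p)` as a bounded continuous function. -/
noncomputable def weightedDeriv (k n : ℕ) (f : 𝓢(E, ℂ)) :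
    DerivBCF E n :=
  BoundedContinuousFunction.ofNormedAddCommGroup
    (fun p => (‖p‖ ^ k : ℝ) • iteratedFDeriv ℝ n f p)
    ((continuous_norm.pow k).smul ((f.smooth n).continuous_iteratedFDeriv le_rfl))
    (SchwartzMap.seminorm ℂ k n f) fun p => by
      rw [norm_smul, norm_pow, norm_norm]
      exact f.le_seminorm ℂ k n p

theorem weightedDeriv_apply (k n : ℕ) (f : 𝓢(E, ℂ)) (p : E) :
    weightedDeriv k n f p = (‖p‖ ^ k : ℝ) • iteratedFDeriv ℝ n f p := rfl

theorem norm_weightedDeriv (k n : ℕ) (f : 𝓢(E, ℂ)) :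
    ‖weightedDeriv k n f‖ = SchwartzMap.seminorm ℂ k n f := by
  refine le_antisymm (BoundedContinuousFunction.norm_ofNormedAddCommGroup_le _
    (apply_nonneg _ _) _)
    (f.seminorm_le_bound ℂ k n (norm_nonneg (weightedDeriv k n f)) fun p => ?_)
  have := (weightedDeriv k n f).norm_coe_le_norm p
  rwa [weightedDeriv_apply, norm_smul, norm_pow, norm_norm] at this

theorem weightedDeriv_add (k n : ℕ) (f g : 𝓢(E, ℂ)) :
    weightedDeriv k n (f + g) = weightedDeriv k n f + weightedDeriv k n g := by
  ext1 p
  rw [BoundedContinuousFunction.add_apply]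
  simp only [weightedDeriv_apply]
  have h : iteratedFDeriv ℝ n (f + g : 𝓢(E, ℂ)) p =
      iteratedFDeriv ℝ n f p + iteratedFDeriv ℝ n g p :=
    iteratedFDeriv_add_apply (f.smooth n).contDiffAt (g.smooth n).contDiffAt
  rw [h]
  exact smul_add _ _ _

theorem weightedDeriv_smul (k n : ℕ) (c : ℂ) (f : 𝓢(E, ℂ)) :
    weightedDeriv k n (c • f) = c • weightedDeriv k n f := by
  ext1 p
  rw [BoundedContinuousFunction.smul_apply]
  simp only [weightedDeriv_apply]
  have h : iteratedFDeriv ℝ n (c • f : 𝓢(E, ℂ)) p = c • iteratedFDeriv ℝ n f p :=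
    iteratedFDeriv_const_smul_apply (f.smooth n).contDiffAt
  rw [h]
  exact smul_comm _ _ _

/-- `weightedDeriv` as a continuous linear map. -/
noncomputable def weightedDerivCLM (k n : ℕ) : 𝓢(E, ℂ) →L[ℂ]
    DerivBCF E n :=
  mkCLMtoNormedSpace (𝕜 := ℂ) (σ := RingHom.id ℂ) (D := E) (E := ℂ) (weightedDeriv k n)
    (weightedDeriv_add k n) (weightedDeriv_smul k n)
    ⟨{(k, n)}, 1, zero_le_one, fun f => by
      simp [norm_weightedDeriv, schwartzSeminormFamily_apply]⟩

theorem weightedDerivCLM_apply (k n : ℕ) (f : 𝓢(E, ℂ)) :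
    weightedDerivCLM k n f = weightedDeriv k n f := rfl

theorem continuous_iteratedFDeriv_eval (n : ℕ) (p : E) :
    Continuous fun f : 𝓢(E, ℂ) => iteratedFDeriv ℝ n f p := by
  have h1 : Continuous fun f : 𝓢(E, ℂ) => weightedDerivCLM 0 n f p :=
    (BoundedContinuousFunction.evalCLM ℂ p).continuous.comp (weightedDerivCLM 0 n).continuous
  simpa [weightedDerivCLM_apply, weightedDeriv_apply] using h1

variable {α : Type*} [TopologicalSpace α] [SecondCountableTopology α] [MeasurableSpace α]
  [OpensMeasurableSpace α] {μ : Measure α}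

theorem integrable_iteratedFDeriv_param {ψ : α → 𝓢(E, ℂ)} (hψ : Continuous ψ)
    (hb : ∀ k n, Integrable (fun a => SchwartzMap.seminorm ℂ k n (ψ a)) μ) (n : ℕ) (p : E) :
    Integrable (fun a => iteratedFDeriv ℝ n (ψ a) p) μ :=
  (hb 0 n).mono' ((continuous_iteratedFDeriv_eval n p).comp hψ).aestronglyMeasurable
    (Eventually.of_forall fun a => by
      simpa using (ψ a).le_seminorm ℂ 0 n p)

/-- Derivatives of a parameter integral of Schwartz functions are taken under the integral. -/
theorem hasFDerivAt_integral_param {ψ : α → 𝓢(E, ℂ)} (hψ : Continuous ψ)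
    (hb : ∀ k n, Integrable (fun a => SchwartzMap.seminorm ℂ k n (ψ a)) μ) (n : ℕ) (p : E) :
    HasFDerivAt (fun p => ∫ a, iteratedFDeriv ℝ n (ψ a) p ∂μ)
      (∫ a, iteratedFDeriv ℝ (n + 1) (ψ a) p ∂μ).curryLeft p := by
  have hcurry : (∫ a, iteratedFDeriv ℝ (n + 1) (ψ a) p ∂μ).curryLeft =
      ∫ a, (iteratedFDeriv ℝ (n + 1) (ψ a) p).curryLeft ∂μ := by
    let L : (E [×n + 1]→L[ℝ] ℂ) →L[ℝ] E →L[ℝ] E [×n]→L[ℝ] ℂ :=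
      (continuousMultilinearCurryLeftEquiv ℝ (fun _ : Fin (n + 1) => E)
        ℂ).toContinuousLinearEquiv.toContinuousLinearMap
    exact (ContinuousLinearMap.integral_comp_comm (𝕜 := ℝ) (E := E [×n + 1]→L[ℝ] ℂ)
      (Fₗ := E →L[ℝ] E [×n]→L[ℝ] ℂ) L (integrable_iteratedFDeriv_param hψ hb (n + 1) p)).symm
  rw [hcurry]
  refine hasFDerivAt_integral_of_dominated_of_fderiv_le (s := Set.univ)
    (F' := fun p a => (iteratedFDeriv ℝ (n + 1) (ψ a) p).curryLeft)
    (bound := fun a => SchwartzMap.seminorm ℂ 0 (n + 1) (ψ a)) univ_mem ?_ ?_ ?_ ?_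
    (hb 0 (n + 1)) ?_
  · exact Eventually.of_forall fun q =>
      (integrable_iteratedFDeriv_param hψ hb n q).aestronglyMeasurable
  · exact integrable_iteratedFDeriv_param hψ hb n p
  · exact ((continuousMultilinearCurryLeftEquiv ℝ (fun _ : Fin (n + 1) => E)
      ℂ).continuous.comp ((continuous_iteratedFDeriv_eval (n + 1) p).comp hψ)).aestronglyMeasurable
  · refine Eventually.of_forall fun a q _ => ?_
    have h1 : ‖(iteratedFDeriv ℝ (n + 1) (ψ a) q).curryLeft‖ = ‖iteratedFDeriv ℝ (n + 1) (ψ a) q‖ :=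
      (continuousMultilinearCurryLeftEquiv ℝ (fun _ : Fin (n + 1) => E) ℂ).norm_map _
    rw [h1]
    simpa using (ψ a).le_seminorm ℂ 0 (n + 1) q
  · refine Eventually.of_forall fun a q _ => ?_
    have h1 : DifferentiableAt ℝ (iteratedFDeriv ℝ n (ψ a)) q :=
      ((ψ a).smooth (n + 1)).differentiable_iteratedFDeriv
        (by exact_mod_cast Nat.lt_succ_self n) q
    have h2 : (iteratedFDeriv ℝ (n + 1) (ψ a) q).curryLeft =
        fderiv ℝ (iteratedFDeriv ℝ n (ψ a)) q := by
      rw [iteratedFDeriv_succ_eq_comp_left]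
      exact (continuousMultilinearCurryLeftEquiv ℝ (fun _ : Fin (n + 1) => E) ℂ).apply_symm_apply _
    rw [h2]
    exact h1.hasFDerivAt

/-- The integral of an integrable continuous family of Schwartz functions is a Schwartz function,
and tempered distributions commute with the integral. The Schwartz space is not a normed space, so
the Bochner integral is taken of the weighted derivatives, in spaces of bounded continuous
functions. -/
theorem exists_integral_param {ψ : α → 𝓢(E, ℂ)} (hψ : Continuous ψ)
    (hb : ∀ k n, Integrable (fun a => SchwartzMap.seminorm ℂ k n (ψ a)) μ) :
    ∃ I : 𝓢(E, ℂ), (∀ p, I p = ∫ a, ψ a p ∂μ) ∧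
      ∀ σ : 𝓢'(E, ℂ), σ I = ∫ a, σ (ψ a) ∂μ := by
  have hT : HasFTaylorSeriesUpTo ((⊤ : ℕ∞) : WithTop ℕ∞) (fun p => ∫ a, ψ a p ∂μ)
      (fun p n => ∫ a, iteratedFDeriv ℝ n (ψ a) p ∂μ) := by
    refine ⟨fun p => ?_, fun n _ p => hasFDerivAt_integral_param hψ hb n p, fun n _ => ?_⟩
    · have h := (continuousMultilinearCurryFin0 ℝ E
        ℂ).toContinuousLinearEquiv.toContinuousLinearMap.integral_comp_comm
          (integrable_iteratedFDeriv_param hψ hb 0 p)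
      exact h.symm
    · exact continuous_iff_continuousAt.2 fun p =>
        (hasFDerivAt_integral_param hψ hb n p).continuousAt
  have hD : ∀ n p, iteratedFDeriv ℝ n (fun p => ∫ a, ψ a p ∂μ) p =
      ∫ a, iteratedFDeriv ℝ n (ψ a) p ∂μ := fun n p =>
    (hT.eq_iteratedFDeriv (by exact_mod_cast le_top) p).symm
  set I : 𝓢(E, ℂ) :=
    { toFun := fun p => ∫ a, ψ a p ∂μ
      smooth' := hT.contDiff
      decay' := by
        intro k n
        refine ⟨∫ a, SchwartzMap.seminorm ℂ k n (ψ a) ∂μ, fun p => ?_⟩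
        rw [hD, ← norm_norm p, ← norm_pow, ← norm_smul, ← integral_smul]
        refine norm_integral_le_of_norm_le (hb k n) (Eventually.of_forall fun a => ?_)
        rw [norm_smul, norm_pow, norm_norm]
        exact (ψ a).le_seminorm ℂ k n p } with hI
  have hIp : ∀ p, I p = ∫ a, ψ a p ∂μ := fun p => rfl
  refine ⟨I, hIp, fun σ => ?_⟩
  have hint : ∀ k n, Integrable (fun a => weightedDerivCLM k n (ψ a)) μ := fun k n =>
    (hb k n).mono' ((weightedDerivCLM k n).continuous.comp hψ).aestronglyMeasurable
      (Eventually.of_forall fun a => (norm_weightedDeriv k n (ψ a)).le)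
  -- a tempered distribution is bounded with respect to finitely many of the seminorms
  obtain ⟨s, C, -, hC⟩ := Seminorm.bound_of_continuous (schwartz_withSeminorms ℂ E ℂ)
    ((normSeminorm ℂ ℂ).comp (σ : 𝓢(E, ℂ) →ₗ[ℂ] ℂ)) (continuous_norm.comp (map_continuous σ))
  refine LinearMap.eq_integral_of_norm_le (X := fun i : s => DerivBCF E i.1.2)
    (fun i => (weightedDerivCLM i.1.1 i.1.2).toLinearMap) (σ : 𝓢(E, ℂ) →ₗ[ℂ] ℂ)
    (C := C) ?_ ψ (fun i => ?_) fun i => ?_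
  · intro f r hr hfr
    refine (hC f).trans ?_
    rw [_root_.smul_apply, NNReal.smul_def, smul_eq_mul]
    gcongr
    refine Seminorm.finset_sup_apply_le hr fun i hi => ?_
    refine le_trans (le_of_eq ?_) (hfr ⟨i, hi⟩)
    exact (norm_weightedDeriv i.1 i.2 f).symm
  · exact hint i.1.1 i.1.2
  · ext1 p
    have h2 := (BoundedContinuousFunction.evalCLM ℂ p).integral_comp_comm (hint i.1.1 i.1.2)
    refine Eq.trans ?_ h2
    change weightedDeriv i.1.1 i.1.2 I p = ∫ a, weightedDeriv i.1.1 i.1.2 (ψ a) p ∂μ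
    simp only [weightedDeriv_apply]
    rw [integral_smul]
    congr 1
    exact hD _ p

end SchwartzMap

/-! ### Modulated translates of Schwartz functions -/

namespace SchwartzMap

variable {E : Type*} [NormedAddCommGroup E] [NormedSpace ℝ E]

/-- Functions `e^{-q}` with `q` of temperate growth and at least quadratic are Schwartz
functions. -/
theorem exists_eq_exp_neg {q : E → ℝ} (hq : q.HasTemperateGrowth) {c : ℝ} (hc : 0 < c)
    (hqc : ∀ x, c * ‖x‖ ^ 2 ≤ q x) : ∃ Ψ : 𝓢(E, ℂ), ∀ x, Ψ x = ((Real.exp (-q x) : ℝ) : ℂ) := by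
  have hsm : ContDiff ℝ ((⊤ : ℕ∞) : WithTop ℕ∞) (fun x => -q x) := hq.1.neg
  have hsm' : ContDiff ℝ ((⊤ : ℕ∞) : WithTop ℕ∞) (Real.exp ∘ fun x => -q x) :=
    Real.contDiff_exp.comp hsm
  have hdec : ∀ k n : ℕ, ∃ C : ℝ, ∀ x,
      ‖x‖ ^ k * ‖iteratedFDeriv ℝ n (Real.exp ∘ fun x => -q x) x‖ ≤ C := by
    intro k n
    obtain ⟨m, M, hM0, hM⟩ := hq.neg.norm_iteratedFDeriv_le_uniform n
    obtain ⟨D, hD0, hD⟩ := exists_exp_neg_mul_pow_le (a := 2 * c) (by positivity) (k + m * n)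
    refine ⟨n.factorial * (M + 1) ^ n * (Real.exp c * D), fun x => ?_⟩
    set B : ℝ := (M + 1) * (1 + ‖x‖) ^ m with hB
    have hB1 : 1 ≤ B := by
      have : 1 ≤ (1 + ‖x‖) ^ m := one_le_pow₀ (by linarith [norm_nonneg x])
      nlinarith
    have h1 : ‖iteratedFDeriv ℝ n (Real.exp ∘ fun x => -q x) x‖ ≤
        n.factorial * Real.exp (-q x) * B ^ n := by
      refine norm_iteratedFDeriv_comp_le (Real.contDiff_exp (n := ((⊤ : ℕ∞) : WithTop ℕ∞))) hsm
        (by exact_mod_cast le_top) x (fun i _ => ?_) fun i hi1 hin => ?_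
      · rw [norm_iteratedFDeriv_eq_norm_iteratedDeriv, iteratedDeriv_eq_iterate,
          Real.iter_deriv_exp, Real.norm_of_nonneg (Real.exp_pos _).le]
      · refine (hM i hin x).trans ?_
        refine le_trans ?_ (le_self_pow₀ hB1 (by omega))
        rw [hB]
        gcongr
        linarith
    have h2 : Real.exp (-q x) ≤ Real.exp c * Real.exp (-(2 * c * ‖x‖)) := by
      rw [← Real.exp_add]
      refine Real.exp_le_exp.2 ?_
      nlinarith [hqc x, sq_nonneg (‖x‖ - 1)]
    calc ‖x‖ ^ k * ‖iteratedFDeriv ℝ n (Real.exp ∘ fun x => -q x) x‖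
        ≤ (1 + ‖x‖) ^ k * (n.factorial * (Real.exp c * Real.exp (-(2 * c * ‖x‖))) * B ^ n) := by
          refine mul_le_mul (by gcongr; linarith) (h1.trans (by gcongr)) (norm_nonneg _)
            (by positivity)
      _ = n.factorial * (M + 1) ^ n * (Real.exp c *
            (Real.exp (-(2 * c * ‖x‖)) * (1 + ‖x‖) ^ (k + m * n))) := by
          rw [hB, mul_pow, ← pow_mul, pow_add]
          ring
      _ ≤ _ := by
          gcongr
          exact hD _ (norm_nonneg x)
  let f : 𝓢(E, ℝ) := ⟨Real.exp ∘ fun x => -q x, hsm', hdec⟩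
  refine ⟨⟨fun x => Complex.ofRealLI (f x), ?_, fun k n => ?_⟩, fun x => rfl⟩
  · exact Complex.ofRealLI.toContinuousLinearMap.contDiff.comp (f.smooth ⊤)
  · obtain ⟨C, hC⟩ := hdec k n
    refine ⟨C, fun x => ?_⟩
    have := Complex.ofRealLI.norm_iteratedFDeriv_comp_left (f := f) (x := x)
      (f.smooth n).contDiffAt (i := n) le_rfl
    have h2 : ‖iteratedFDeriv ℝ n (fun x => Complex.ofRealLI (f x)) x‖ = ‖iteratedFDeriv ℝ n f x‖ :=
      this
    rw [h2]
    exact hC x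

theorem norm_iteratedFDeriv_cexp_le (L : E →L[ℝ] ℝ) (n : ℕ) (p : E) :
    ‖iteratedFDeriv ℝ n (fun p => Complex.exp ((L p : ℂ) * Complex.I)) p‖ ≤ ‖L‖ ^ n := by
  have h0 : ∀ n : ℕ, ∀ t : ℝ, iteratedDeriv n (fun t : ℝ => Complex.exp ((t : ℂ) * Complex.I)) t =
      Complex.I ^ n * Complex.exp ((t : ℂ) * Complex.I) := by
    intro n
    induction n with
    | zero => intro t; simp
    | succ n ih =>
      intro t
      have h1 : HasDerivAt (fun t : ℝ => Complex.exp ((t : ℂ) * Complex.I))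
          (Complex.exp ((t : ℂ) * Complex.I) * Complex.I) t := by
        have h2 : HasDerivAt (fun t : ℝ => (t : ℂ) * Complex.I) Complex.I t := by
          simpa using (Complex.ofRealCLM.hasDerivAt (x := t)).mul_const Complex.I
        exact h2.cexp
      rw [iteratedDeriv_succ, funext ih, (h1.const_mul _).deriv]
      ring
  have hcd : ContDiff ℝ n (fun t : ℝ => Complex.exp ((t : ℂ) * Complex.I)) :=
    (Complex.ofRealCLM.contDiff.mul contDiff_const).cexp
  have h : ‖iteratedFDeriv ℝ n (fun p => Complex.exp ((L p : ℂ) * Complex.I)) p‖ ≤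
      ‖iteratedFDeriv ℝ n (fun t : ℝ => Complex.exp ((t : ℂ) * Complex.I)) (L p)‖ * ‖L‖ ^ n := by
    have h2 := L.iteratedFDeriv_comp_right hcd p (i := n) le_rfl
    have h3 : (fun p => Complex.exp ((L p : ℂ) * Complex.I)) =
      (fun t : ℝ => Complex.exp ((t : ℂ) * Complex.I)) ∘ L := rfl
    rw [h3, h2]
    refine (ContinuousMultilinearMap.norm_compContinuousLinearMap_le _ _).trans (le_of_eq ?_)
    rw [Fin.prod_const]
  refine h.trans (mul_le_of_le_one_left (by positivity) ?_)
  rw [norm_iteratedFDeriv_eq_norm_iteratedDeriv, h0, norm_mul, norm_pow, Complex.norm_I, one_pow,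
    Complex.norm_exp_ofReal_mul_I, one_mul]

/-- The seminorms of modulated translates grow polynomially in the shift, by the Leibniz rule. -/
theorem exists_modulate_bound (Ψ : 𝓢(E, ℂ)) (k n : ℕ) : ∃ C : ℝ, 0 ≤ C ∧
    ∀ (z : E) (L : E →L[ℝ] ℝ) (p : E),
      ‖p‖ ^ k * ‖iteratedFDeriv ℝ n
        (fun p => Complex.exp ((L p : ℂ) * Complex.I) * Ψ (p - z)) p‖ ≤
      C * ((1 + ‖z‖) ^ k * (1 + ‖L‖) ^ n) := by
  set S : ℝ := (2 : ℝ) ^ k *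
    ((Finset.Iic (k, n)).sup fun m => SchwartzMap.seminorm ℂ m.1 m.2) Ψ with hS
  have hS0 : 0 ≤ S := by positivity
  have hSb : ∀ j ≤ n, ∀ y, (1 + ‖y‖) ^ k * ‖iteratedFDeriv ℝ j Ψ y‖ ≤ S := fun j hj y =>
    one_add_le_sup_seminorm_apply (𝕜 := ℂ) (m := (k, n)) le_rfl hj Ψ y
  refine ⟨2 ^ n * S, by positivity, fun z L p => ?_⟩
  have hf : ContDiff ℝ n (fun p => Complex.exp ((L p : ℂ) * Complex.I)) :=
    ((Complex.ofRealCLM.contDiff.comp L.contDiff).mul contDiff_const).cexp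
  have hg : ContDiff ℝ n (fun p => Ψ (p - z)) := (Ψ.smooth n).comp (contDiff_id.sub contDiff_const)
  have h1 := norm_iteratedFDeriv_mul_le hf hg p (n := n) le_rfl
  have h2 : ∀ i ∈ Finset.range (n + 1), ‖p‖ ^ k * ((n.choose i : ℝ) *
      ‖iteratedFDeriv ℝ i (fun p => Complex.exp ((L p : ℂ) * Complex.I)) p‖ *
      ‖iteratedFDeriv ℝ (n - i) (fun p => Ψ (p - z)) p‖) ≤
      (n.choose i : ℝ) * (S * ((1 + ‖z‖) ^ k * (1 + ‖L‖) ^ n)) := by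
    intro i hi
    have hi' : i ≤ n := Nat.lt_succ_iff.1 (Finset.mem_range.1 hi)
    have h3 : iteratedFDeriv ℝ (n - i) (fun p => Ψ (p - z)) p =
        iteratedFDeriv ℝ (n - i) Ψ (p - z) := by
      rw [iteratedFDeriv_comp_sub]
    have h4 : ‖p‖ ^ k ≤ (1 + ‖z‖) ^ k * (1 + ‖p - z‖) ^ k := by
      rw [← mul_pow]
      gcongr
      have := norm_le_norm_add_norm_sub' p z
      nlinarith [norm_nonneg z, norm_nonneg (p - z)]
    have h5 : ‖iteratedFDeriv ℝ i (fun p => Complex.exp ((L p : ℂ) * Complex.I)) p‖ ≤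
        (1 + ‖L‖) ^ n := by
      refine (norm_iteratedFDeriv_cexp_le L i p).trans ?_
      calc ‖L‖ ^ i ≤ (1 + ‖L‖) ^ i := by gcongr; linarith
        _ ≤ (1 + ‖L‖) ^ n := pow_le_pow_right₀ (by linarith [norm_nonneg L]) hi'
    rw [h3]
    calc ‖p‖ ^ k * ((n.choose i : ℝ) *
        ‖iteratedFDeriv ℝ i (fun p => Complex.exp ((L p : ℂ) * Complex.I)) p‖ *
        ‖iteratedFDeriv ℝ (n - i) Ψ (p - z)‖)
        ≤ ((1 + ‖z‖) ^ k * (1 + ‖p - z‖) ^ k) * ((n.choose i : ℝ) * (1 + ‖L‖) ^ n *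
          ‖iteratedFDeriv ℝ (n - i) Ψ (p - z)‖) := by gcongr
      _ = (n.choose i : ℝ) * (((1 + ‖p - z‖) ^ k * ‖iteratedFDeriv ℝ (n - i) Ψ (p - z)‖) *
          ((1 + ‖z‖) ^ k * (1 + ‖L‖) ^ n)) := by ring
      _ ≤ _ := by
          gcongr
          exact hSb _ (Nat.sub_le _ _) _
  refine (mul_le_mul_of_nonneg_left h1 (by positivity)).trans ?_
  rw [Finset.mul_sum]
  refine (Finset.sum_le_sum h2).trans (le_of_eq ?_)
  rw [← Finset.sum_mul, ← Nat.cast_sum, Nat.sum_range_choose]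
  push_cast
  ring

/-- The modulated translate `p ↦ e^{i L(p)} Ψ(p - z)`. -/
noncomputable def modulate (Ψ : 𝓢(E, ℂ)) (z : E) (L : E →L[ℝ] ℝ) : 𝓢(E, ℂ) where
  toFun p := Complex.exp ((L p : ℂ) * Complex.I) * Ψ (p - z)
  smooth' := ((Complex.ofRealCLM.contDiff.comp L.contDiff).mul contDiff_const).cexp.mul
    ((Ψ.smooth ⊤).comp (contDiff_id.sub contDiff_const))
  decay' k n := by
    obtain ⟨C, -, hC⟩ := exists_modulate_bound Ψ k n
    exact ⟨_, fun p => hC z L p⟩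

theorem modulate_apply (Ψ : 𝓢(E, ℂ)) (z : E) (L : E →L[ℝ] ℝ) (p : E) :
    modulate Ψ z L p = Complex.exp ((L p : ℂ) * Complex.I) * Ψ (p - z) := rfl

theorem exists_seminorm_modulate_le (Ψ : 𝓢(E, ℂ)) (k n : ℕ) : ∃ C : ℝ, 0 ≤ C ∧
    ∀ (z : E) (L : E →L[ℝ] ℝ), SchwartzMap.seminorm ℂ k n (modulate Ψ z L) ≤
      C * ((1 + ‖z‖) ^ k * (1 + ‖L‖) ^ n) := by
  obtain ⟨C, hC0, hC⟩ := exists_modulate_bound Ψ k n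
  exact ⟨C, hC0, fun z L => seminorm_le_bound ℂ k n _ (by positivity) fun p => hC z L p⟩

/-- A family of Schwartz functions with locally bounded seminorms and jointly continuous
derivatives is continuous. -/
theorem continuous_of_locally_bounded [ProperSpace E] {X : Type*} [TopologicalSpace X]
    {ψ : X → 𝓢(E, ℂ)}
    (hloc : ∀ x k n, ∃ C : ℝ, ∀ᶠ y in 𝓝 x, SchwartzMap.seminorm ℂ k n (ψ y) ≤ C)
    (hcont : ∀ n, Continuous fun y : X × E => iteratedFDeriv ℝ n (ψ y.1) y.2) : Continuous ψ := by
  refine continuous_iff_continuousAt.2 fun x => ?_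
  rw [ContinuousAt, (schwartz_withSeminorms ℂ E ℂ).tendsto_nhds]
  rintro ⟨k, n⟩ ε hε
  obtain ⟨C, hC⟩ := hloc x (k + 1) n
  have hC0 : 0 ≤ C := (apply_nonneg _ _).trans hC.self_of_nhds
  set R : ℝ := 1 + 4 * C / ε with hR
  have hR0 : 0 < R := by positivity
  have hsub : ∀ y p, iteratedFDeriv ℝ n (ψ y - ψ x : 𝓢(E, ℂ)) p =
      iteratedFDeriv ℝ n (ψ y) p - iteratedFDeriv ℝ n (ψ x) p := fun y p =>
    iteratedFDeriv_sub_apply ((ψ y).smooth n).contDiffAt ((ψ x).smooth n).contDiffAt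
  -- uniform convergence on the ball of radius `R`; outside of it the bound on the seminorm with one
  -- more power of `‖p‖` gains a factor `R`
  have hunif : ∀ᶠ y in 𝓝 x, ∀ p ∈ Metric.closedBall (0 : E) R,
      dist (iteratedFDeriv ℝ n (ψ x) p) (iteratedFDeriv ℝ n (ψ y) p) < ε / (2 * R ^ k) := by
    let f : C(X × E, E [×n]→L[ℝ] ℂ) := ⟨fun y : X × E => iteratedFDeriv ℝ n (ψ y.1) y.2, hcont n⟩
    have h1 := ContinuousMap.tendsto_iff_forall_isCompact_tendstoUniformlyOn.1
      (f.curry.continuous.tendsto x) _ (isCompact_closedBall (0 : E) R)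
    exact Metric.tendstoUniformlyOn_iff.1 h1 _ (by positivity)
  filter_upwards [hC, hunif] with y hy hyu
  refine lt_of_le_of_lt (seminorm_le_bound ℂ k n _ (M := ε / 2) (by positivity) fun p => ?_)
    (by linarith)
  rw [hsub]
  by_cases hp : ‖p‖ ≤ R
  · have h2 := hyu p (mem_closedBall_zero_iff.2 hp)
    rw [dist_comm, dist_eq_norm] at h2
    calc ‖p‖ ^ k * ‖iteratedFDeriv ℝ n (ψ y) p - iteratedFDeriv ℝ n (ψ x) p‖
        ≤ R ^ k * (ε / (2 * R ^ k)) := by gcongr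
      _ = ε / 2 := by field_simp
  · rw [not_le] at hp
    have h3 : ∀ w, SchwartzMap.seminorm ℂ (k + 1) n (ψ w) ≤ C →
        ‖p‖ ^ k * ‖iteratedFDeriv ℝ n (ψ w) p‖ ≤ ε / 4 := by
      intro w hw
      have h4 := ((ψ w).le_seminorm ℂ (k + 1) n p).trans hw
      have h5 : R * (‖p‖ ^ k * ‖iteratedFDeriv ℝ n (ψ w) p‖) ≤ C := by
        refine le_trans ?_ h4
        rw [pow_succ', mul_assoc]
        gcongr
      have h6 : C ≤ R * (ε / 4) := by
        rw [hR]
        field_simp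
        nlinarith
      exact le_of_mul_le_mul_left (h5.trans h6) hR0
    calc ‖p‖ ^ k * ‖iteratedFDeriv ℝ n (ψ y) p - iteratedFDeriv ℝ n (ψ x) p‖
        ≤ ‖p‖ ^ k * (‖iteratedFDeriv ℝ n (ψ y) p‖ + ‖iteratedFDeriv ℝ n (ψ x) p‖) := by
          gcongr
          exact norm_sub_le _ _
      _ ≤ ε / 4 + ε / 4 := by
          rw [mul_add]
          exact add_le_add (h3 y hy) (h3 x hC.self_of_nhds)
      _ = ε / 2 := by ring

/-- Partial derivatives of jointly smooth functions are jointly continuous. -/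
theorem continuous_iteratedFDeriv_snd {X : Type*} [NormedAddCommGroup X] [NormedSpace ℝ X]
    {F : X × E → ℂ} {n : ℕ} (hF : ContDiff ℝ n F) :
    Continuous fun y : X × E => iteratedFDeriv ℝ n (fun p => F (y.1, p)) y.2 := by
  have h : ∀ y : X × E, iteratedFDeriv ℝ n (fun p => F (y.1, p)) y.2 =
      (iteratedFDeriv ℝ n F y).compContinuousLinearMap fun _ => ContinuousLinearMap.inr ℝ X E := by
    intro y
    have hc : ContDiff ℝ n fun q : X × E => F ((y.1, 0) + q) :=
      hF.comp (contDiff_const.add contDiff_id)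
    have h1 : (fun p => F (y.1, p)) =
        (fun q : X × E => F ((y.1, 0) + q)) ∘ ContinuousLinearMap.inr ℝ X E := by
      ext p
      simp
    rw [h1, ContinuousLinearMap.iteratedFDeriv_comp_right _ hc _ le_rfl,
      iteratedFDeriv_comp_add_left]
    simp
  simp_rw [h]
  exact (ContinuousMultilinearMap.compContinuousLinearMapL
    (fun _ : Fin n => ContinuousLinearMap.inr ℝ X E)).continuous.comp
    (hF.continuous_iteratedFDeriv le_rfl)

theorem continuous_modulate [ProperSpace E] (Ψ : 𝓢(E, ℂ)) :
    Continuous fun x : E × (E →L[ℝ] ℝ) => modulate Ψ x.1 x.2 := by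
  refine continuous_of_locally_bounded (fun x k n => ?_) fun n => ?_
  · obtain ⟨C, hC0, hC⟩ := exists_seminorm_modulate_le Ψ k n
    refine ⟨C * ((1 + ‖x.1‖) ^ k * (1 + ‖x.2‖) ^ n) + 1, ?_⟩
    have h1 : Continuous fun y : E × (E →L[ℝ] ℝ) => C * ((1 + ‖y.1‖) ^ k * (1 + ‖y.2‖) ^ n) := by
      fun_prop
    filter_upwards [(h1.tendsto x).eventually_lt_const (lt_add_one _)] with y hy
    exact (hC y.1 y.2).trans hy.le
  · refine continuous_iteratedFDeriv_snd (F := fun y : (E × (E →L[ℝ] ℝ)) × E =>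
      Complex.exp ((y.1.2 y.2 : ℂ) * Complex.I) * Ψ (y.2 - y.1.1)) ?_
    have h1 : ContDiff ℝ n fun y : (E × (E →L[ℝ] ℝ)) × E => y.1.2 y.2 :=
      (contDiff_snd.comp contDiff_fst).clm_apply contDiff_snd
    have h2 : ContDiff ℝ n fun y : (E × (E →L[ℝ] ℝ)) × E => Ψ (y.2 - y.1.1) :=
      (Ψ.smooth n).comp (contDiff_snd.sub (contDiff_fst.comp contDiff_fst))
    exact ((Complex.ofRealCLM.contDiff.comp h1).mul contDiff_const).cexp.mul h2

end SchwartzMap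

/-! ### Gaussian integrals -/

section Gaussian

variable {d : ℕ}

/-- The squared `L²` norm of the Gaussian window. -/
noncomputable def gaussConst (d : ℕ) : ℝ := (1 / 2 : ℝ) ^ ((d : ℝ) / 2)

theorem gaussConst_pos (d : ℕ) : 0 < gaussConst d := by unfold gaussConst; positivity

/-- The Fourier transform of a Gaussian. -/
theorem integral_gaussian_mul_cexp {b : ℝ} (hb : 0 < b) (a : Config d) :
    ∫ t : Config d, ((Real.exp (-(b * ‖t‖ ^ 2)) : ℝ) : ℂ) *
        Complex.exp (2 * Real.pi * Complex.I * ((inner ℝ a t : ℝ) : ℂ)) =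
      (((Real.pi / b) ^ ((d : ℝ) / 2) : ℝ) : ℂ) *
        ((Real.exp (-(Real.pi ^ 2 * ‖a‖ ^ 2 / b)) : ℝ) : ℂ) := by
  have h := GaussianFourier.integral_cexp_neg_mul_sq_norm_add (V := Config d) (b := (b : ℂ))
    (by simpa using hb) (2 * Real.pi * Complex.I) a
  have h1 : ∀ t : Config d, ((Real.exp (-(b * ‖t‖ ^ 2)) : ℝ) : ℂ) *
      Complex.exp (2 * Real.pi * Complex.I * ((inner ℝ a t : ℝ) : ℂ)) =
      Complex.exp (-(b : ℂ) * (‖t‖ : ℂ) ^ 2 +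
        2 * Real.pi * Complex.I * ((inner ℝ a t : ℝ) : ℂ)) := by
    intro t
    rw [Complex.exp_add]
    push_cast
    rw [neg_mul]
  simp_rw [h1]
  rw [h, finrank_euclideanSpace, Fintype.card_fin]
  congr 1
  · rw [Complex.ofReal_cpow (by positivity)]
    push_cast
    rfl
  · rw [Complex.ofReal_exp]
    congr 1
    push_cast
    rw [mul_pow, mul_pow, Complex.I_sq]
    have : (b : ℂ) ≠ 0 := by exact_mod_cast hb.ne'
    field_simp
    ring

theorem norm_add_sq_add_norm_sub_sq (s u : Config d) :
    ‖s + u‖ ^ 2 + ‖s - u‖ ^ 2 = 2 * ‖s‖ ^ 2 + 2 * ‖u‖ ^ 2 := by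
  rw [norm_add_sq_real, norm_sub_sq_real]
  ring

theorem conj_cexp_two_pi (x : ℝ) : conj (Complex.exp (2 * Real.pi * Complex.I * (x : ℂ))) =
    Complex.exp (2 * Real.pi * Complex.I * ((-x : ℝ) : ℂ)) := by
  rw [← Complex.exp_conj]
  congr 1
  simp only [map_mul, Complex.conj_ofReal, Complex.conj_I, map_ofNat]
  push_cast
  ring

/-- The short-time Fourier transform of a time-frequency shift of the Gaussian. -/
theorem stft_gaussianWindow_tfShift (w z : Phase d) :
    stft (gaussianWindow d) (tfShift w (gaussianWindow d)) z =
      (gaussConst d : ℂ) *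
        ((Real.exp (-(Real.pi / 2 * (‖z.1 - w.1‖ ^ 2 + ‖z.2 - w.2‖ ^ 2))) : ℝ) : ℂ) *
        Complex.exp (2 * Real.pi * Complex.I *
          ((inner ℝ (w.2 - z.2) ((1 / 2 : ℝ) • (w.1 + z.1)) : ℝ) : ℂ)) := by
  -- centred at the midpoint `m`, the product of the two Gaussians is a Gaussian in `s`, by the
  -- parallelogram law
  set m : Config d := (1 / 2 : ℝ) • (w.1 + z.1) with hm
  set u : Config d := (1 / 2 : ℝ) • (z.1 - w.1) with hu
  unfold stft
  rw [← integral_add_right_eq_self _ m]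
  have h1 : ∀ s : Config d, tfShift w (gaussianWindow d) (s + m) *
      conj (tfShift z (gaussianWindow d) (s + m)) =
      (((Real.exp (-(Real.pi / 2 * ‖z.1 - w.1‖ ^ 2)) : ℝ) : ℂ) *
        Complex.exp (2 * Real.pi * Complex.I * ((inner ℝ (w.2 - z.2) m : ℝ) : ℂ))) *
      (((Real.exp (-((2 * Real.pi) * ‖s‖ ^ 2)) : ℝ) : ℂ) *
        Complex.exp (2 * Real.pi * Complex.I * ((inner ℝ (w.2 - z.2) s : ℝ) : ℂ))) := by
    intro s
    have e1 : s + m - w.1 = s + u := by rw [hm, hu]; module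
    have e2 : s + m - z.1 = s - u := by rw [hm, hu]; module
    have e3 : Real.exp (-Real.pi * ‖s + u‖ ^ 2) * Real.exp (-Real.pi * ‖s - u‖ ^ 2) =
        Real.exp (-(Real.pi / 2 * ‖z.1 - w.1‖ ^ 2)) * Real.exp (-((2 * Real.pi) * ‖s‖ ^ 2)) := by
      rw [← Real.exp_add, ← Real.exp_add]
      congr 1
      have e4 := norm_add_sq_add_norm_sub_sq s u
      have e5 : ‖u‖ ^ 2 = ‖z.1 - w.1‖ ^ 2 / 4 := by
        rw [hu, norm_smul, mul_pow]
        norm_num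
        ring
      rw [e5] at e4
      linear_combination (-Real.pi) * e4
    have e6 : Complex.exp (2 * Real.pi * Complex.I * ((inner ℝ w.2 (s + m) : ℝ) : ℂ)) *
        Complex.exp (2 * Real.pi * Complex.I * ((-inner ℝ z.2 (s + m) : ℝ) : ℂ)) =
        Complex.exp (2 * Real.pi * Complex.I * ((inner ℝ (w.2 - z.2) m : ℝ) : ℂ)) *
        Complex.exp (2 * Real.pi * Complex.I * ((inner ℝ (w.2 - z.2) s : ℝ) : ℂ)) := by
      rw [← Complex.exp_add, ← Complex.exp_add]
      congr 1
      simp only [inner_add_right, inner_sub_left]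
      push_cast
      ring
    have e7 := congrArg (fun x : ℝ => (x : ℂ)) e3
    simp only [Complex.ofReal_mul] at e7
    simp only [tfShift, gaussianWindow, e1, e2, map_mul, Complex.conj_ofReal, conj_cexp_two_pi]
    linear_combination (Complex.exp (2 * Real.pi * Complex.I * ((inner ℝ (w.2 - z.2) m : ℝ) : ℂ)) *
      Complex.exp (2 * Real.pi * Complex.I * ((inner ℝ (w.2 - z.2) s : ℝ) : ℂ))) * e7 +
      (((Real.exp (-Real.pi * ‖s + u‖ ^ 2) : ℝ) : ℂ) *
        ((Real.exp (-Real.pi * ‖s - u‖ ^ 2) : ℝ) : ℂ)) * e6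
  simp_rw [h1]
  rw [integral_const_mul, integral_gaussian_mul_cexp (by positivity)]
  have e8 : Real.pi / (2 * Real.pi) = 1 / 2 := by field_simp
  have e9 : Real.exp (-(Real.pi / 2 * ‖z.1 - w.1‖ ^ 2)) *
      Real.exp (-(Real.pi ^ 2 * ‖w.2 - z.2‖ ^ 2 / (2 * Real.pi))) =
      Real.exp (-(Real.pi / 2 * (‖z.1 - w.1‖ ^ 2 + ‖z.2 - w.2‖ ^ 2))) := by
    rw [← Real.exp_add, norm_sub_rev w.2]
    congr 1
    field_simp
    ring
  rw [← e9, e8, gaussConst]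
  push_cast
  ring

/-- The cross-Wigner distribution of two time-frequency shifts of the Gaussian is a
time-frequency shift of the Gaussian `e^{-2π|p|²}`, up to a phase. -/
theorem wigner_gaussianWindow (z w p : Phase d) :
    wigner (tfShift z (gaussianWindow d)) (tfShift w (gaussianWindow d)) p =
      ((gaussConst d)⁻¹ : ℂ) *
      Complex.exp (2 * Real.pi * Complex.I *
        ((inner ℝ ((1 / 2 : ℝ) • (z.2 + w.2)) (z.1 - w.1) : ℝ) : ℂ)) *
      symbolShift ((1 / 2 : ℝ) • (z + w)) (z.2 - w.2, -(z.1 - w.1))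
        (fun q => ((Real.exp (-(2 * Real.pi) * (‖q.1‖ ^ 2 + ‖q.2‖ ^ 2)) : ℝ) : ℂ)) p := by
  set a : Config d := p.1 - (1 / 2 : ℝ) • (z.1 + w.1) with ha
  set b : Config d := (1 / 2 : ℝ) • (z.2 + w.2) - p.2 with hb
  unfold wigner
  -- after this translation the two Gaussians are symmetric in `s` around `a`
  rw [← integral_add_right_eq_self _ (z.1 - w.1)]
  have h1 : ∀ s : Config d,
      tfShift z (gaussianWindow d) (p.1 + (1 / 2 : ℝ) • (s + (z.1 - w.1))) *
        conj (tfShift w (gaussianWindow d) (p.1 - (1 / 2 : ℝ) • (s + (z.1 - w.1)))) *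
        Complex.exp (-(2 * Real.pi * Complex.I *
          ((inner ℝ p.2 (s + (z.1 - w.1)) : ℝ) : ℂ))) =
      (((Real.exp (-((2 * Real.pi) * ‖a‖ ^ 2)) : ℝ) : ℂ) *
        Complex.exp (2 * Real.pi * Complex.I *
          ((inner ℝ (z.2 - w.2) p.1 + inner ℝ b (z.1 - w.1) : ℝ) : ℂ))) *
      (((Real.exp (-((Real.pi / 2) * ‖s‖ ^ 2)) : ℝ) : ℂ) *
        Complex.exp (2 * Real.pi * Complex.I * ((inner ℝ b s : ℝ) : ℂ))) := by
    intro s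
    have e1 : p.1 + (1 / 2 : ℝ) • (s + (z.1 - w.1)) - z.1 = a + (1 / 2 : ℝ) • s := by
      rw [ha]; module
    have e2 : p.1 - (1 / 2 : ℝ) • (s + (z.1 - w.1)) - w.1 = a - (1 / 2 : ℝ) • s := by
      rw [ha]; module
    have e3 : Real.exp (-Real.pi * ‖a + (1 / 2 : ℝ) • s‖ ^ 2) *
        Real.exp (-Real.pi * ‖a - (1 / 2 : ℝ) • s‖ ^ 2) =
        Real.exp (-((2 * Real.pi) * ‖a‖ ^ 2)) * Real.exp (-((Real.pi / 2) * ‖s‖ ^ 2)) := by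
      rw [← Real.exp_add, ← Real.exp_add]
      congr 1
      have e4 := norm_add_sq_add_norm_sub_sq a ((1 / 2 : ℝ) • s)
      have e5 : ‖(1 / 2 : ℝ) • s‖ ^ 2 = ‖s‖ ^ 2 / 4 := by
        rw [norm_smul, mul_pow]
        norm_num
        ring
      rw [e5] at e4
      linear_combination (-Real.pi) * e4
    have e6 : Complex.exp (2 * Real.pi * Complex.I *
          ((inner ℝ z.2 (p.1 + (1 / 2 : ℝ) • (s + (z.1 - w.1))) : ℝ) : ℂ)) *
        Complex.exp (2 * Real.pi * Complex.I *
          ((-inner ℝ w.2 (p.1 - (1 / 2 : ℝ) • (s + (z.1 - w.1))) : ℝ) : ℂ)) *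
        Complex.exp (-(2 * Real.pi * Complex.I *
          ((inner ℝ p.2 (s + (z.1 - w.1)) : ℝ) : ℂ))) =
        Complex.exp (2 * Real.pi * Complex.I *
          ((inner ℝ (z.2 - w.2) p.1 + inner ℝ b (z.1 - w.1) : ℝ) : ℂ)) *
        Complex.exp (2 * Real.pi * Complex.I * ((inner ℝ b s : ℝ) : ℂ)) := by
      rw [← Complex.exp_add, ← Complex.exp_add, ← Complex.exp_add]
      congr 1
      rw [hb]
      simp only [inner_add_right, inner_sub_right, inner_sub_left, inner_smul_right,
        inner_smul_left, inner_add_left, RCLike.conj_to_real]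
      push_cast
      ring
    have e7 := congrArg (fun x : ℝ => (x : ℂ)) e3
    simp only [Complex.ofReal_mul] at e7
    simp only [tfShift, gaussianWindow, e1, e2, map_mul, Complex.conj_ofReal, conj_cexp_two_pi]
    linear_combination (Complex.exp (2 * Real.pi * Complex.I *
          ((inner ℝ (z.2 - w.2) p.1 + inner ℝ b (z.1 - w.1) : ℝ) : ℂ)) *
        Complex.exp (2 * Real.pi * Complex.I * ((inner ℝ b s : ℝ) : ℂ))) * e7 +
      (((Real.exp (-Real.pi * ‖a + (1 / 2 : ℝ) • s‖ ^ 2) : ℝ) : ℂ) *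
        ((Real.exp (-Real.pi * ‖a - (1 / 2 : ℝ) • s‖ ^ 2) : ℝ) : ℂ)) * e6
  simp_rw [h1]
  rw [integral_const_mul, integral_gaussian_mul_cexp (by positivity)]
  have e8 : (Real.pi / (Real.pi / 2)) ^ ((d : ℝ) / 2) = (gaussConst d)⁻¹ := by
    rw [gaussConst, ← Real.inv_rpow (by norm_num)]
    congr 1
    field_simp
  have e9 : Real.exp (-((2 * Real.pi) * ‖a‖ ^ 2)) *
      Real.exp (-(Real.pi ^ 2 * ‖b‖ ^ 2 / (Real.pi / 2))) =
      Real.exp (-(2 * Real.pi) * (‖(p - (1 / 2 : ℝ) • (z + w)).1‖ ^ 2 +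
        ‖(p - (1 / 2 : ℝ) • (z + w)).2‖ ^ 2)) := by
    have f1 : (p - (1 / 2 : ℝ) • (z + w)).1 = a := rfl
    have f2 : (p - (1 / 2 : ℝ) • (z + w)).2 = -b := by
      rw [hb, neg_sub]
      rfl
    rw [← Real.exp_add, f1, f2, norm_neg]
    congr 1
    field_simp
    ring
  have e10 : Complex.exp (2 * Real.pi * Complex.I *
        ((inner ℝ (z.2 - w.2) p.1 + inner ℝ b (z.1 - w.1) : ℝ) : ℂ)) =
      Complex.exp (2 * Real.pi * Complex.I *
        ((inner ℝ ((1 / 2 : ℝ) • (z.2 + w.2)) (z.1 - w.1) : ℝ) : ℂ)) *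
      Complex.exp (2 * Real.pi * Complex.I *
        ((inner ℝ (z.2 - w.2) p.1 + inner ℝ (-(z.1 - w.1)) p.2 : ℝ) : ℂ)) := by
    rw [← Complex.exp_add]
    congr 1
    rw [hb, inner_sub_left _ _ (z.1 - w.1), inner_neg_left, real_inner_comm p.2 (z.1 - w.1)]
    push_cast
    ring
  have e11 := congrArg (fun x : ℝ => (x : ℂ)) e9
  simp only [Complex.ofReal_mul] at e11
  simp only [symbolShift]
  rw [e8, e10, ← e11]
  push_cast
  ring

end Gaussian

/-! ### Coherent states -/

section Density

variable {E : Type*} [NormedAddCommGroup E] [SecondCountableTopology E] [MeasurableSpace E]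
  [BorelSpace E] {μ : Measure E}
  {H : Type*} [NormedAddCommGroup H] [InnerProductSpace ℂ H]

/-- It suffices to verify the Parseval identity on a dense set: Fatou's lemma gives one inequality
for all vectors, and the triangle inequality then gives the other. -/
theorem IsParsevalFamily.of_dense {e : E → H} (he : Continuous e) {D : Set H} (hD : Dense D)
    (h : ∀ f ∈ D, l2norm μ (fun z => ‖inner ℂ (e z) f‖ₑ) = ‖f‖ₑ) :
    IsParsevalFamily μ e := by
  have hmeas : ∀ f : H, Measurable fun z => ‖inner ℂ (e z) f‖ₑ := fun f =>
    (he.inner continuous_const).enorm.measurable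
  have hle : ∀ f : H, l2norm μ (fun z => ‖inner ℂ (e z) f‖ₑ) ≤ ‖f‖ₑ := by
    intro f
    obtain ⟨x, hx, hxf⟩ := mem_closure_iff_seq_limit.1 (hD f)
    have h1 : ∀ z, Tendsto (fun n => ‖inner ℂ (e z) (x n)‖ₑ) atTop (𝓝 ‖inner ℂ (e z) f‖ₑ) :=
      fun z => ((continuous_const.inner continuous_id).enorm.tendsto f).comp hxf
    have h2 : ∫⁻ z, ‖inner ℂ (e z) f‖ₑ ^ (2 : ℝ) ∂μ ≤
        liminf (fun n => ∫⁻ z, ‖inner ℂ (e z) (x n)‖ₑ ^ (2 : ℝ) ∂μ) atTop := by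
      refine le_trans (le_of_eq ?_) (lintegral_liminf_le fun n => (hmeas (x n)).pow_const _)
      refine lintegral_congr fun z => ?_
      exact (((ENNReal.continuous_rpow_const).tendsto _).comp (h1 z)).liminf_eq.symm
    have h3 : ∀ n, ∫⁻ z, ‖inner ℂ (e z) (x n)‖ₑ ^ (2 : ℝ) ∂μ = ‖x n‖ₑ ^ (2 : ℝ) := by
      intro n
      rw [← h _ (hx n), l2norm, ← ENNReal.rpow_mul]
      norm_num
    simp_rw [h3] at h2
    have h4 : Tendsto (fun n => ‖x n‖ₑ ^ (2 : ℝ)) atTop (𝓝 (‖f‖ₑ ^ (2 : ℝ))) :=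
      ((ENNReal.continuous_rpow_const).tendsto _).comp ((continuous_enorm.tendsto f).comp hxf)
    rw [h4.liminf_eq] at h2
    rw [l2norm]
    calc _ ≤ (‖f‖ₑ ^ (2 : ℝ)) ^ (1 / 2 : ℝ) := ENNReal.rpow_le_rpow h2 (by norm_num)
      _ = ‖f‖ₑ := by rw [← ENNReal.rpow_mul]; norm_num
  refine ⟨he, fun f => le_antisymm (hle f) ?_⟩
  obtain ⟨x, hx, hxf⟩ := mem_closure_iff_seq_limit.1 (hD f)
  have h5 : ∀ n, ‖x n‖ₑ ≤ l2norm μ (fun z => ‖inner ℂ (e z) f‖ₑ) + ‖x n - f‖ₑ := by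
    intro n
    rw [← h _ (hx n)]
    calc _ ≤ l2norm μ (fun z => ‖inner ℂ (e z) f‖ₑ + ‖inner ℂ (e z) (x n - f)‖ₑ) := by
          refine l2norm_mono fun z => ?_
          have : inner ℂ (e z) (x n) = inner ℂ (e z) f + inner ℂ (e z) (x n - f) := by
            rw [← inner_add_right]; simp
          rw [this]
          exact enorm_add_le _ _
      _ ≤ _ := (l2norm_add_le (hmeas _) (hmeas _)).trans (by
          gcongr; exact hle _)
  have h6 : Tendsto (fun n => ‖x n‖ₑ) atTop (𝓝 ‖f‖ₑ) := (continuous_enorm.tendsto f).comp hxf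
  have h7 : Tendsto (fun n => ‖x n - f‖ₑ) atTop (𝓝 0) := by
    have := (continuous_enorm.tendsto (0 : H)).comp (tendsto_sub_nhds_zero_iff.2 hxf)
    simpa [Function.comp_def] using this
  have h8 := tendsto_const_nhds (x := l2norm μ (fun z => ‖inner ℂ (e z) f‖ₑ)).add h7
  rw [add_zero] at h8
  exact le_of_tendsto_of_tendsto' h6 h8 h5

end Density

section Coherent

variable {d : ℕ}

/-- The Hilbert space `L²(ℝ^d)`. -/
abbrev L2Space (d : ℕ) : Type := Lp ℂ 2 (volume : Measure (Config d))

theorem exists_schwartz_gaussianWindow (d : ℕ) :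
    ∃ G : 𝓢(Config d, ℂ), ∀ t, G t = gaussianWindow d t := by
  obtain ⟨G, hG⟩ := SchwartzMap.exists_eq_exp_neg (E := Config d)
    (q := fun t => Real.pi * ‖t‖ ^ 2) (c := Real.pi) (by fun_prop) Real.pi_pos (fun x => le_rfl)
  exact ⟨G, fun t => by simp [hG, gaussianWindow]⟩

/-- The Gaussian window as a Schwartz function. -/
noncomputable def gaussianSchwartz (d : ℕ) : 𝓢(Config d, ℂ) :=
  (exists_schwartz_gaussianWindow d).choose

theorem coe_gaussianSchwartz (d : ℕ) : ⇑(gaussianSchwartz d) = gaussianWindow d :=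
  funext (exists_schwartz_gaussianWindow d).choose_spec

/-- The time-frequency shift of a Schwartz function. -/
noncomputable def schwartzShift (z : Phase d) (f : 𝓢(Config d, ℂ)) : 𝓢(Config d, ℂ) :=
  SchwartzMap.modulate f z.1 (innerSL ℝ ((2 * Real.pi) • z.2))

theorem coe_schwartzShift (z : Phase d) (f : 𝓢(Config d, ℂ)) :
    ⇑(schwartzShift z f) = tfShift z f := by
  ext t
  rw [schwartzShift, SchwartzMap.modulate_apply, tfShift]
  congr 2
  simp
  ring

theorem continuous_schwartzShift (f : 𝓢(Config d, ℂ)) : Continuous fun z => schwartzShift z f := by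
  have h : Continuous fun z : Phase d =>
      ((z.1, innerSL ℝ ((2 * Real.pi) • z.2)) : Config d × (Config d →L[ℝ] ℝ)) :=
    continuous_fst.prodMk ((innerSL ℝ).continuous.comp (continuous_snd.const_smul (2 * Real.pi)))
  have h2 := (SchwartzMap.continuous_modulate (E := Config d) f).comp h
  unfold schwartzShift
  exact h2

theorem norm_tfShift (z : Phase d) (f : Config d → ℂ) (t : Config d) :
    ‖tfShift z f t‖ = ‖f (t - z.1)‖ := by
  rw [tfShift, norm_mul]
  have : (2 * Real.pi * Complex.I * ((inner ℝ z.2 t : ℝ) : ℂ)) =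
      ((2 * Real.pi * inner ℝ z.2 t : ℝ) : ℂ) * Complex.I := by push_cast; ring
  rw [this, Complex.norm_exp_ofReal_mul_I, one_mul]

theorem memLp_tfShift {f : Config d → ℂ} (hf : MemLp f 2 (volume : Measure (Config d)))
    (z : Phase d) : MemLp (tfShift z f) 2 (volume : Measure (Config d)) := by
  have h1 : MemLp (fun t => f (t - z.1)) 2 (volume : Measure (Config d)) :=
    hf.comp_measurePreserving (measurePreserving_sub_right _ z.1)
  refine h1.of_le ?_ (Eventually.of_forall fun t => (norm_tfShift z f t).le)
  unfold tfShift
  exact (by fun_prop : Continuous fun t : Config d => Complex.exp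
    (2 * Real.pi * Complex.I * ((inner ℝ z.2 t : ℝ) : ℂ))).aestronglyMeasurable.mul h1.1

theorem inner_toLp_tfShift {g f : Config d → ℂ} {z : Phase d}
    (hg : MemLp (tfShift z g) 2 (volume : Measure (Config d)))
    (hf : MemLp f 2 (volume : Measure (Config d))) :
    inner ℂ (hg.toLp _) (hf.toLp f) = stft g f z := by
  rw [L2.inner_def]
  refine integral_congr_ae ?_
  filter_upwards [hg.coeFn_toLp, hf.coeFn_toLp] with t h1 h2
  rw [h1, h2, RCLike.inner_apply]

theorem memLp_gaussianWindow (d : ℕ) :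
    MemLp (gaussianWindow d) 2 (volume : Measure (Config d)) := by
  rw [← coe_gaussianSchwartz]
  exact (gaussianSchwartz d).memLp 2 volume

/-- The normalising factor `‖φ‖⁻¹` of the Gaussian window. -/
noncomputable def gaussNorm (d : ℕ) : ℝ := (√(gaussConst d))⁻¹

theorem gaussNorm_pos (d : ℕ) : 0 < gaussNorm d := by
  have := gaussConst_pos d
  unfold gaussNorm
  positivity

theorem gaussNorm_sq (d : ℕ) : gaussNorm d ^ 2 = (gaussConst d)⁻¹ := by
  rw [gaussNorm, inv_pow, Real.sq_sqrt (gaussConst_pos d).le]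

/-- The coherent state at `z`, the time-frequency shift of the normalised Gaussian. -/
noncomputable def coherent (z : Phase d) : L2Space d :=
  (gaussNorm d : ℂ) • (schwartzShift z (gaussianSchwartz d)).toLp 2 volume

theorem coherent_eq (z : Phase d) : coherent z =
    (gaussNorm d : ℂ) • (memLp_tfShift (memLp_gaussianWindow d) z).toLp _ := by
  rw [coherent]
  congr 1
  refine MemLp.toLp_congr _ _ (Eventually.of_forall fun t => ?_)
  rw [coe_schwartzShift, coe_gaussianSchwartz]

theorem continuous_coherent : Continuous (coherent : Phase d → L2Space d) := by
  have h : Continuous fun z : Phase d =>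
      ((schwartzShift z (gaussianSchwartz d)).toLp 2 : L2Space d) :=
    SchwartzMap.continuous_toLp.comp (continuous_schwartzShift (gaussianSchwartz d))
  exact h.const_smul (gaussNorm d : ℂ)

theorem inner_coherent_toLp (z : Phase d) {f : Config d → ℂ}
    (hf : MemLp f 2 (volume : Measure (Config d))) :
    inner ℂ (coherent z) (hf.toLp f) = (gaussNorm d : ℂ) * stft (gaussianWindow d) f z := by
  rw [coherent_eq, inner_smul_left, inner_toLp_tfShift, Complex.conj_ofReal]

theorem inner_coherent_coherent (w z : Phase d) : inner ℂ (coherent z) (coherent w) =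
    ((Real.exp (-(Real.pi / 2 * (‖z.1 - w.1‖ ^ 2 + ‖z.2 - w.2‖ ^ 2))) : ℝ) : ℂ) *
        Complex.exp (2 * Real.pi * Complex.I *
          ((inner ℝ (w.2 - z.2) ((1 / 2 : ℝ) • (w.1 + z.1)) : ℝ) : ℂ)) := by
  rw [coherent_eq w, inner_smul_right, inner_coherent_toLp, stft_gaussianWindow_tfShift]
  have h : (gaussNorm d : ℂ) * (gaussNorm d : ℂ) * (gaussConst d : ℂ) = 1 := by
    rw [← sq]
    have h2 := gaussNorm_sq d
    have h3 := (gaussConst_pos d).ne'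
    exact_mod_cast (by rw [h2]; field_simp : gaussNorm d ^ 2 * gaussConst d = 1)
  linear_combination (((Real.exp (-(Real.pi / 2 *
    (‖z.1 - w.1‖ ^ 2 + ‖z.2 - w.2‖ ^ 2))) : ℝ) : ℂ) *
        Complex.exp (2 * Real.pi * Complex.I *
          ((inner ℝ (w.2 - z.2) ((1 / 2 : ℝ) • (w.1 + z.1)) : ℝ) : ℂ))) * h

theorem norm_cexp_two_pi (x : ℝ) : ‖Complex.exp (2 * Real.pi * Complex.I * (x : ℂ))‖ = 1 := by
  have : (2 * Real.pi * Complex.I * (x : ℂ)) = ((2 * Real.pi * x : ℝ) : ℂ) * Complex.I := by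
    push_cast; ring
  rw [this, Complex.norm_exp_ofReal_mul_I]

theorem norm_inner_coherent_coherent (w z : Phase d) : ‖inner ℂ (coherent z) (coherent w)‖ =
    Real.exp (-(Real.pi / 2 * (‖z.1 - w.1‖ ^ 2 + ‖z.2 - w.2‖ ^ 2))) := by
  rw [inner_coherent_coherent, norm_mul, norm_cexp_two_pi, mul_one, Complex.norm_real,
    Real.norm_of_nonneg (Real.exp_pos _).le]

/-- Gaussian decay of the Gram matrix of the coherent states, weakened to exponential decay. -/
theorem enorm_inner_coherent_coherent_le (z w : Phase d) :
    ‖inner ℂ (coherent w) (coherent z)‖ₑ ≤ expEnvelope (Real.exp 1) (z - w) := by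
  rw [← ofReal_norm, norm_inner_coherent_coherent, expEnvelope]
  refine ENNReal.ofReal_le_ofReal ?_
  rw [← Real.exp_add]
  refine Real.exp_le_exp.2 ?_
  have h1 : ‖z - w‖ ^ 2 ≤ ‖w.1 - z.1‖ ^ 2 + ‖w.2 - z.2‖ ^ 2 := by
    rw [norm_sub_rev, Prod.norm_def]
    rcases max_choice ‖(w - z).1‖ ‖(w - z).2‖ with h | h <;> rw [h]
    · simp
    · simp
  have h2 := Real.pi_gt_three
  nlinarith [sq_nonneg (‖z - w‖ - 1), norm_nonneg (z - w)]

/-- For fixed `x`, the short-time Fourier transform is the Fourier transform of a localised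
piece of the function. -/
theorem exists_stft_eq_fourier (f : 𝓢(Config d, ℂ)) (x : Config d) :
    ∃ F : 𝓢(Config d, ℂ), (∀ t, F t = gaussianWindow d (t - x) * f t) ∧
      ∀ ω, stft (gaussianWindow d) f (x, ω) = FourierTransform.fourier F ω := by
  have hG : Function.HasTemperateGrowth
      (schwartzShift (x, 0) (gaussianSchwartz d)) := SchwartzMap.hasTemperateGrowth _
  have hF : ∀ t, SchwartzMap.smulLeftCLM ℂ (schwartzShift (x, 0) (gaussianSchwartz d)) f t =
      gaussianWindow d (t - x) * f t := by
    intro t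
    rw [SchwartzMap.smulLeftCLM_apply_apply hG, coe_schwartzShift, coe_gaussianSchwartz]
    simp [tfShift]
  refine ⟨_, hF, fun ω => ?_⟩
  rw [SchwartzMap.fourier_coe, Real.fourier_eq', stft]
  refine integral_congr_ae (Eventually.of_forall fun t => ?_)
  have h1 : Complex.exp (((-2 * Real.pi * inner ℝ t ω : ℝ) : ℂ) * Complex.I) =
      conj (Complex.exp (2 * Real.pi * Complex.I * ((inner ℝ ω t : ℝ) : ℂ))) := by
    rw [conj_cexp_two_pi, real_inner_comm]
    congr 1
    push_cast
    ring
  simp only [hF, h1, tfShift, map_mul, smul_eq_mul, gaussianWindow, Complex.conj_ofReal]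
  ring

theorem lintegral_gaussianWindow_sq (d : ℕ) :
    ∫⁻ t : Config d, ‖gaussianWindow d t‖ₑ ^ 2 = ENNReal.ofReal (gaussConst d) := by
  have h := integral_gaussian_mul_cexp (d := d) (b := 2 * Real.pi) (by positivity) 0
  have h1 : ∀ t : Config d, ‖gaussianWindow d t‖ₑ ^ 2 =
      ENNReal.ofReal (Real.exp (-(2 * Real.pi * ‖t‖ ^ 2))) := by
    intro t
    rw [← ofReal_norm, gaussianWindow, Complex.norm_real,
      Real.norm_of_nonneg (Real.exp_pos _).le, ← ENNReal.ofReal_pow (Real.exp_pos _).le,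
      ← Real.exp_nat_mul]
    congr 2
    push_cast
    ring
  simp_rw [h1]
  have h2 : ∫ t : Config d, Real.exp (-(2 * Real.pi * ‖t‖ ^ 2)) = gaussConst d := by
    have h3 : (∫ t : Config d, ((Real.exp (-(2 * Real.pi * ‖t‖ ^ 2)) : ℝ) : ℂ)) =
        ((gaussConst d : ℝ) : ℂ) := by
      have h4 : Real.pi / (2 * Real.pi) = 1 / 2 := by field_simp
      simpa [h4, gaussConst] using h
    rw [integral_complex_ofReal] at h3
    exact_mod_cast h3
  rw [← ofReal_integral_eq_lintegral_ofReal _ (Eventually.of_forall fun t => (Real.exp_pos _).le),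
    h2]
  -- integrability follows from the value, as a function without integral has integral zero
  by_contra h5
  rw [integral_undef h5] at h2
  exact (gaussConst_pos d).ne h2

/-- Plancherel's theorem for Schwartz functions, with lower integrals. -/
theorem lintegral_sq_fourier (F : 𝓢(Config d, ℂ)) :
    ∫⁻ ω : Config d, ‖FourierTransform.fourier F ω‖ₑ ^ 2 = ∫⁻ t : Config d, ‖F t‖ₑ ^ 2 := by
  have key : ∀ G : 𝓢(Config d, ℂ), ∫⁻ t : Config d, ‖G t‖ₑ ^ 2 =
      ENNReal.ofReal (∫ t : Config d, ‖G t‖ ^ 2) := by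
    intro G
    rw [ofReal_integral_eq_lintegral_ofReal ((G.memLp 2 volume).integrable_norm_pow (by norm_num))
      (Eventually.of_forall fun t => by positivity)]
    refine lintegral_congr fun t => ?_
    rw [← ofReal_norm, ENNReal.ofReal_pow (norm_nonneg _)]
  rw [key, key, SchwartzMap.integral_norm_sq_fourier]

theorem lintegral_phase {F : Phase d → ℝ≥0∞} (hF : Measurable F) :
    ∫⁻ z, F z = ∫⁻ x : Config d, ∫⁻ ω : Config d, F (x, ω) := by
  rw [Measure.volume_eq_prod, lintegral_prod _ hF.aemeasurable]

/-- The coherent states form a continuous Parseval frame of `L²(ℝ^d)`. For Schwartz functions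
this is Plancherel's theorem in the frequency variable. -/
theorem isParsevalFamily_coherent (d : ℕ) :
    IsParsevalFamily (volume : Measure (Phase d)) (coherent (d := d)) := by
  refine IsParsevalFamily.of_dense continuous_coherent
    (D := Set.range (SchwartzMap.toLpCLM ℂ ℂ (E := Config d) 2 volume))
    (SchwartzMap.denseRange_toLpCLM (by norm_num)) ?_
  · rintro _ ⟨f, rfl⟩
    rw [SchwartzMap.toLpCLM_apply]
    have hm : Measurable fun z => ‖inner ℂ (coherent z) (f.toLp 2 volume)‖ₑ ^ 2 :=
      ((continuous_coherent.inner continuous_const).enorm.measurable).pow_const 2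
    have h0 : ∀ x ω : Config d, ‖inner ℂ (coherent (x, ω)) (f.toLp 2 volume)‖ₑ ^ 2 =
        ENNReal.ofReal (gaussConst d)⁻¹ * ‖stft (gaussianWindow d) f (x, ω)‖ₑ ^ 2 := by
      intro x ω
      have := inner_coherent_toLp (x, ω) (f.memLp 2 volume)
      rw [SchwartzMap.toLp, this, enorm_mul, mul_pow, ← gaussNorm_sq,
        ENNReal.ofReal_pow (gaussNorm_pos d).le, ← ofReal_norm, Complex.norm_real,
        Real.norm_of_nonneg (gaussNorm_pos d).le]
    have h1 : ∫⁻ z : Phase d, ‖inner ℂ (coherent z) (f.toLp 2 volume)‖ₑ ^ 2 =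
        ∫⁻ t : Config d, ‖f t‖ₑ ^ 2 := by
      rw [lintegral_phase hm]
      have h2 : ∀ x : Config d,
          ∫⁻ ω : Config d, ‖inner ℂ (coherent (x, ω)) (f.toLp 2 volume)‖ₑ ^ 2 =
          ENNReal.ofReal (gaussConst d)⁻¹ *
            ∫⁻ t : Config d, ‖gaussianWindow d (t - x)‖ₑ ^ 2 * ‖f t‖ₑ ^ 2 := by
        intro x
        obtain ⟨F, hF, hF2⟩ := exists_stft_eq_fourier f x
        simp_rw [h0, hF2]
        rw [lintegral_const_mul' _ _ ENNReal.ofReal_ne_top, lintegral_sq_fourier]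
        simp_rw [hF, enorm_mul, mul_pow]
      have hc : Continuous (gaussianWindow d) := by
        rw [← coe_gaussianSchwartz]; exact (gaussianSchwartz d).continuous
      simp_rw [h2]
      rw [lintegral_const_mul' _ _ ENNReal.ofReal_ne_top, lintegral_lintegral_swap]
      · have h3 : ∀ t : Config d, ∫⁻ x : Config d, ‖gaussianWindow d (t - x)‖ₑ ^ 2 * ‖f t‖ₑ ^ 2 =
            ENNReal.ofReal (gaussConst d) * ‖f t‖ₑ ^ 2 := by
          intro t
          rw [lintegral_mul_const' _ _ (by finiteness),
            lintegral_sub_left_eq_self (fun x => ‖gaussianWindow d x‖ₑ ^ 2),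
            lintegral_gaussianWindow_sq]
        simp_rw [h3]
        rw [lintegral_const_mul' _ _ ENNReal.ofReal_ne_top, ← mul_assoc,
          ← ENNReal.ofReal_mul (inv_pos.2 (gaussConst_pos d)).le,
          inv_mul_cancel₀ (gaussConst_pos d).ne', ENNReal.ofReal_one, one_mul]
      · refine Measurable.aemeasurable ?_
        exact (by fun_prop : Continuous fun p : Config d × Config d =>
          ‖gaussianWindow d (p.2 - p.1)‖ₑ ^ 2).measurable.mul
          (by fun_prop : Continuous fun p : Config d × Config d => ‖f p.2‖ₑ ^ 2).measurable
    have h4 : ‖f.toLp 2 (volume : Measure (Config d))‖ₑ =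
        l2norm volume fun t => ‖f t‖ₑ := by
      rw [← IsParsevalFamily.eLpNorm_two_eq_l2norm, SchwartzMap.toLp, Lp.enorm_def]
      exact eLpNorm_congr_ae (f.memLp 2 volume).coeFn_toLp
    have h5 : ∀ a : ℝ≥0∞, a ^ (2 : ℝ) = a ^ 2 := fun a => ENNReal.rpow_ofNat a 2
    rw [h4, l2norm, l2norm]
    simp_rw [h5]
    rw [h1]

end Coherent

/-! ### Frame operators and dual coefficients -/

section Frame

variable {H : Type*} [NormedAddCommGroup H] [InnerProductSpace ℂ H] [CompleteSpace H]

/-- The frame operator `S y = ∑ ⟨a_i, y⟩ a_i` of a frame, in weak form. It is invertible by the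
lower frame bound. -/
theorem exists_frame_operator {ι : Type*} {a : ι → H} {A B : ℝ≥0} (hA : 0 < A)
    (hlow : ∀ f, (A : ℝ≥0∞) * ‖f‖ₑ ^ 2 ≤ ∑' i, ‖inner ℂ (a i) f‖ₑ ^ 2)
    (hup : ∀ f, ∑' i, ‖inner ℂ (a i) f‖ₑ ^ 2 ≤ (B : ℝ≥0∞) * ‖f‖ₑ ^ 2) :
    ∃ S : H →L[ℂ] H, (∀ x y, HasSum (fun i => inner ℂ x (a i) * inner ℂ (a i) y)
        (inner ℂ x (S y))) ∧ (∀ x y, inner ℂ (S x) y = inner ℂ x (S y)) ∧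
      (∀ x, (A : ℝ) * ‖x‖ ≤ ‖S x‖) ∧ ∃ R : H →L[ℂ] H, ∀ x, S (R x) = x := by
  have hsum : ∀ f, Summable fun i => ‖inner ℂ (a i) f‖ ^ 2 := by
    intro f
    have h1 : ∑' i, ((‖inner ℂ (a i) f‖₊ ^ 2 : ℝ≥0) : ℝ≥0∞) ≠ ∞ := by
      refine ne_top_of_le_ne_top (by finiteness : (B : ℝ≥0∞) * ‖f‖ₑ ^ 2 ≠ ∞) ?_
      refine le_trans (le_of_eq (tsum_congr fun i => ?_)) (hup f)
      rw [ENNReal.coe_pow]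
      rfl
    have h2 := ENNReal.tsum_coe_ne_top_iff_summable.1 h1
    simpa using NNReal.summable_coe.2 h2
  have htsum : ∀ f, ∑' i, ‖inner ℂ (a i) f‖ₑ ^ 2 =
      ENNReal.ofReal (∑' i, ‖inner ℂ (a i) f‖ ^ 2) := by
    intro f
    rw [ENNReal.ofReal_tsum_of_nonneg (fun i => by positivity) (hsum f)]
    refine tsum_congr fun i => ?_
    rw [ENNReal.ofReal_pow (norm_nonneg _), ofReal_norm]
  have henorm : ∀ (c : ℝ≥0) (f : H), (c : ℝ≥0∞) * ‖f‖ₑ ^ 2 = ENNReal.ofReal (c * ‖f‖ ^ 2) := by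
    intro c f
    rw [ENNReal.ofReal_mul (by positivity), ENNReal.ofReal_pow (norm_nonneg _), ofReal_norm]
    simp
  have hmem : ∀ f, Memℓp (fun i => inner ℂ (a i) f) 2 := by
    intro f
    refine memℓp_gen ?_
    simpa using hsum f
  let L : H →ₗ[ℂ] lp (fun _ : ι => ℂ) 2 :=
    { toFun := fun f => ⟨fun i => inner ℂ (a i) f, hmem f⟩
      map_add' := fun f g => by
        ext i
        exact inner_add_right _ _ _
      map_smul' := fun c f => by
        ext i
        exact inner_smul_right _ _ _ }
  have hL : ∀ f i, (L f : ι → ℂ) i = inner ℂ (a i) f := fun f i => rfl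
  have hLn : ∀ f, ‖L f‖ ^ 2 = ∑' i, ‖inner ℂ (a i) f‖ ^ 2 := by
    intro f
    have := lp.norm_rpow_eq_tsum (p := 2) (by norm_num) (L f)
    simpa [hL] using this
  have hLb : ∀ f, ‖L f‖ ≤ √B * ‖f‖ := by
    intro f
    have h1 := hup f
    rw [htsum, henorm, ENNReal.ofReal_le_ofReal_iff (by positivity), ← hLn] at h1
    refine le_of_sq_le_sq ?_ (by positivity)
    rw [mul_pow, Real.sq_sqrt (by positivity)]
    exact h1
  let C : H →L[ℂ] lp (fun _ : ι => ℂ) 2 := L.mkContinuous _ hLb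
  have hC : ∀ f i, (C f : ι → ℂ) i = inner ℂ (a i) f := fun f i => rfl
  let S : H →L[ℂ] H := C.adjoint ∘L C
  have hS : ∀ x y, inner ℂ x (S y) = inner ℂ (C x) (C y) := fun x y =>
    C.adjoint_inner_right x (C y)
  have hS' : ∀ x y, inner ℂ (S x) y = inner ℂ (C x) (C y) := fun x y =>
    C.adjoint_inner_left y (C x)
  have hcoer : ∀ x, (A : ℝ) * ‖x‖ ^ 2 ≤ ‖inner ℂ (S x) x‖ := by
    intro x
    rw [hS', inner_self_eq_norm_sq_to_K]
    have h1 := hlow x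
    rw [htsum, henorm, ENNReal.ofReal_le_ofReal_iff (tsum_nonneg fun i => by positivity),
      ← hLn] at h1
    simpa [C] using h1
  have hlowS : ∀ x, (A : ℝ) * ‖x‖ ≤ ‖S x‖ := by
    intro x
    rcases eq_or_ne x 0 with rfl | hx
    · simp
    · have h1 := (hcoer x).trans (norm_inner_le_norm _ _)
      have h2 : 0 < ‖x‖ := norm_pos_iff.2 hx
      nlinarith
  refine ⟨S, fun x y => ?_, fun x y => by rw [hS, hS'], hlowS, ?_⟩
  · rw [hS]
    have h1 := lp.hasSum_inner (𝕜 := ℂ) (C x) (C y)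
    refine h1.congr_fun fun i => ?_
    rw [hC, hC, RCLike.inner_apply, inner_conj_symm, mul_comm]
  · obtain ⟨u, hu⟩ := ContinuousLinearMap.isUnit_of_forall_le_norm_inner_map S (c := A) hA
      (fun x => by rw [mul_comm]; exact hcoer x)
    refine ⟨(u⁻¹ : (H →L[ℂ] H)ˣ), fun x => ?_⟩
    have h1 := congrArg (fun T : H →L[ℂ] H => T x) u.mul_inv
    rw [← hu]
    exact h1

variable {E : Type*} [NormedAddCommGroup E] [NormedSpace ℝ E] [FiniteDimensional ℝ E]
  [MeasurableSpace E] [BorelSpace E] {μ : Measure E} [μ.IsAddHaarMeasure]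
  {Λ : Submodule ℤ E} [DiscreteTopology Λ] {e : E → H}

/-- If the frame elements `a_l` are localised near the points `l` of a lattice, then the vectors
`e_w` have expansions `e_w = ∑ d(l, w) a_l` whose coefficients `d(l, w) = ⟨a_l, S⁻¹ e_w⟩` are
localised near `l = w`, by the Wiener lemma. The coefficients do not depend on the weight. -/
theorem IsParsevalFamily.exists_dual_coeff (he : IsParsevalFamily μ e) {C : ℝ} (hC : 0 ≤ C)
    (hΓ : ∀ z w, ‖inner ℂ (e w) (e z)‖ₑ ≤ expEnvelope C (z - w))
    {a : Λ → H} {A B : ℝ≥0} (hA : 0 < A)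
    (hlow : ∀ f, (A : ℝ≥0∞) * ‖f‖ₑ ^ 2 ≤ ∑' i, ‖inner ℂ (a i) f‖ₑ ^ 2)
    (hup : ∀ f, ∑' i, ‖inner ℂ (a i) f‖ₑ ^ 2 ≤ (B : ℝ≥0∞) * ‖f‖ₑ ^ 2) :
    ∃ c : Λ → E → ℂ, (∀ x w, HasSum (fun l => inner ℂ x (a l) * c l w) (inner ℂ x (e w))) ∧
      ∀ (K ω : E → ℝ≥0∞), SubexpWeight ω → Measurable K → Moderate K →
        (∀ z (l : Λ), ‖inner ℂ (e z) (a l)‖ₑ ≤ K (z - l)) → ∫⁻ x, K x * ω x ∂μ ≠ ∞ →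
        ∃ D : E → ℝ≥0∞, Measurable D ∧ Moderate D ∧ ∫⁻ x, D x * ω x ∂μ ≠ ∞ ∧
          ∀ (l : Λ) w, ‖c l w‖ₑ ≤ D (l - w) := by
  obtain ⟨S, hS, hSsymm, hSlow, R, hR⟩ := exists_frame_operator hA hlow hup
  refine ⟨fun l w => inner ℂ (a l) (R (e w)), fun x w => ?_, ?_⟩
  · have h1 := hS x (R (e w))
    rwa [hR] at h1
  intro K ω hω hKm hK hKa hKω
  have hKn : Measurable fun x => K (-x) := by fun_prop
  have hωm := hω.measurable
  obtain ⟨b, hb⟩ := exists_tsum_mul_le_nconv μ Λ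
  have hSk : ∀ z w, ‖inner ℂ (e w) (S (e z))‖ₑ ≤ b * nconv μ K (fun x => K (-x)) (z - w) := by
    intro z w
    have h1 : ‖inner ℂ (e w) (S (e z))‖ₑ ≤
        ∑' l : Λ, ‖inner ℂ (e w) (a l) * inner ℂ (a l) (e z)‖ₑ := by
      rw [← (hS (e w) (e z)).tsum_eq]
      exact enorm_tsum_le_tsum_enorm
    have h3 := hb (fun x => K (-x)) (fun x => K (-x)) hKn hKn hK.neg hK.neg (-z) (-w)
    simp only [neg_neg] at h3
    rw [show -w - -z = z - w by abel] at h3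
    refine h1.trans (le_trans (ENNReal.tsum_le_tsum fun l => ?_) h3)
    rw [enorm_mul, mul_comm, ← inner_conj_symm (a l), RCLike.enorm_conj]
    refine mul_le_mul' ((hKa z l).trans (le_of_eq ?_)) ((hKa w l).trans (le_of_eq ?_))
    · congr 1; abel
    · congr 1; abel
  -- the matrix of the frame operator is dominated by an autocorrelation of `K`
  obtain ⟨𝒜, h𝒜m, h𝒜ω, h𝒜⟩ := he.exists_inverse_kernel_bound hSsymm (A := A)
    (by exact_mod_cast hA) hSlow hC (κ := fun s => b * nconv μ K (fun x => K (-x)) s)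
    ((measurable_nconv hKm hKn).const_mul _) hΓ hSk hωm hω.one_le hω.submul
    (fun δ hδ => hω.lintegral_exp_mul_ne_top hδ) (by
      simp_rw [mul_assoc]
      rw [lintegral_const_mul' _ _ ENNReal.coe_ne_top]
      refine ENNReal.mul_ne_top ENNReal.coe_ne_top (ne_top_of_le_ne_top ?_
        (lintegral_nconv_mul_le hKm hKn hωm hω.submul))
      rw [hω.lintegral_neg_mul]
      exact ENNReal.mul_ne_top hKω hKω)
  refine ⟨nconv μ 𝒜 fun x => K (-x), measurable_nconv h𝒜m hKn, Moderate.nconv h𝒜m hKn hK.neg,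
    ne_top_of_le_ne_top ?_ (lintegral_nconv_mul_le h𝒜m hKn hωm hω.submul), fun l w => ?_⟩
  · rw [hω.lintegral_neg_mul]
    exact ENNReal.mul_ne_top h𝒜ω hKω
  · dsimp only
    -- insert the Parseval identity between `a l` and `S⁻¹ (e w)`
    rw [he.inner_eq_integral (a l) (R (e w))]
    refine (enorm_integral_le_lintegral_enorm _).trans ?_
    rw [nconv, ← lintegral_sub_right_eq_self (fun s => 𝒜 s * K (-((l : E) - w - s))) w]
    refine lintegral_mono fun y => ?_
    rw [enorm_mul, mul_comm, RCLike.enorm_conj]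
    refine mul_le_mul' (h𝒜 w _ (hR (e w)) y) ((hKa y l).trans (le_of_eq ?_))
    congr 1
    abel

end Frame

/-! ### Decay of the short-time Fourier transform -/

section Decay

variable {d : ℕ}

theorem SchwartzMap.exists_one_add_norm_pow_mul_le {E : Type*} [NormedAddCommGroup E]
    [NormedSpace ℝ E] (f : 𝓢(E, ℂ)) (N : ℕ) :
    ∃ C : ℝ, 0 ≤ C ∧ ∀ x, (1 + ‖x‖) ^ N * ‖f x‖ ≤ C := by
  refine ⟨2 ^ N * (Finset.Iic (N, 0)).sup (fun m => SchwartzMap.seminorm ℂ m.1 m.2) f,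
    by positivity, fun x => ?_⟩
  have h := SchwartzMap.one_add_le_sup_seminorm_apply (𝕜 := ℂ) (m := (N, 0)) (k := N) (n := 0)
    le_rfl le_rfl f x
  rwa [norm_iteratedFDeriv_zero] at h

/-- The correlation of two Schwartz functions decays rapidly. -/
theorem SchwartzMap.exists_convolution_decay (f g : 𝓢(Config d, ℂ)) (N : ℕ) :
    ∃ C : ℝ, ∀ x : Config d, (1 + ‖x‖) ^ N * ∫ t : Config d, ‖f t‖ * ‖g (t - x)‖ ≤ C := by
  obtain ⟨D, hD0, hD⟩ := g.exists_one_add_norm_pow_mul_le N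
  have hi : Integrable fun t : Config d => (1 + ‖t‖) ^ N * ‖f t‖ := by
    have h1 := ((f.integrable_pow_mul (volume : Measure (Config d)) N).add
      (f.integrable_pow_mul (volume : Measure (Config d)) 0)).const_mul (2 ^ N)
    refine h1.mono' (by fun_prop) (Eventually.of_forall fun t => ?_)
    rw [Real.norm_of_nonneg (by positivity)]
    have h2 : (1 + ‖t‖) ^ N ≤ 2 ^ N * (‖t‖ ^ N + 1) := by
      rcases le_total ‖t‖ 1 with h | h
      · calc (1 + ‖t‖) ^ N ≤ 2 ^ N := by gcongr; linarith
          _ ≤ _ := le_mul_of_one_le_right (by positivity) (by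
              have : 0 ≤ ‖t‖ ^ N := by positivity
              linarith)
      · calc (1 + ‖t‖) ^ N ≤ (2 * ‖t‖) ^ N := by gcongr; linarith
          _ = 2 ^ N * ‖t‖ ^ N := mul_pow _ _ _
          _ ≤ _ := by gcongr; linarith
    calc (1 + ‖t‖) ^ N * ‖f t‖ ≤ 2 ^ N * (‖t‖ ^ N + 1) * ‖f t‖ := by gcongr
      _ = _ := by simp only [Pi.add_apply]; ring
  refine ⟨∫ t : Config d, D * ((1 + ‖t‖) ^ N * ‖f t‖), fun x => ?_⟩
  rw [← integral_const_mul]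
  refine integral_mono_of_nonneg (Eventually.of_forall fun t => by positivity) (hi.const_mul D)
    (Eventually.of_forall fun t => ?_)
  have h3 : (1 + ‖x‖) ≤ (1 + ‖t‖) * (1 + ‖t - x‖) := by
    have : ‖x‖ ≤ ‖t‖ + ‖t - x‖ := by
      have := norm_sub_le t (t - x)
      rwa [sub_sub_cancel] at this
    nlinarith [norm_nonneg t, norm_nonneg (t - x)]
  calc (1 + ‖x‖) ^ N * (‖f t‖ * ‖g (t - x)‖)
      ≤ ((1 + ‖t‖) * (1 + ‖t - x‖)) ^ N * (‖f t‖ * ‖g (t - x)‖) := by gcongr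
    _ = ((1 + ‖t - x‖) ^ N * ‖g (t - x)‖) * ((1 + ‖t‖) ^ N * ‖f t‖) := by rw [mul_pow]; ring
    _ ≤ _ := mul_le_mul_of_nonneg_right (hD _) (by positivity)

/-- The Fourier transform of a time-frequency shifted Gaussian is one too; only its modulus is
needed. -/
theorem norm_fourier_schwartzShift (z : Phase d) (ξ : Config d) :
    ‖FourierTransform.fourier (schwartzShift z (gaussianSchwartz d)) ξ‖ =
      ‖gaussianSchwartz d (ξ - z.2)‖ := by
  rw [SchwartzMap.fourier_coe, Real.fourier_eq', ← integral_add_right_eq_self _ z.1]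
  have h1 : ∀ s : Config d, Complex.exp (((-2 * Real.pi * inner ℝ (s + z.1) ξ : ℝ) : ℂ) *
      Complex.I) • schwartzShift z (gaussianSchwartz d) (s + z.1) =
      Complex.exp (2 * Real.pi * Complex.I * ((inner ℝ (z.2 - ξ) z.1 : ℝ) : ℂ)) *
      (((Real.exp (-(Real.pi * ‖s‖ ^ 2)) : ℝ) : ℂ) *
        Complex.exp (2 * Real.pi * Complex.I * ((inner ℝ (z.2 - ξ) s : ℝ) : ℂ))) := by
    intro s
    have h2 : Complex.exp (((-2 * Real.pi * inner ℝ (s + z.1) ξ : ℝ) : ℂ) * Complex.I) *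
        Complex.exp (2 * Real.pi * Complex.I * ((inner ℝ z.2 (s + z.1) : ℝ) : ℂ)) =
        Complex.exp (2 * Real.pi * Complex.I * ((inner ℝ (z.2 - ξ) z.1 : ℝ) : ℂ)) *
        Complex.exp (2 * Real.pi * Complex.I * ((inner ℝ (z.2 - ξ) s : ℝ) : ℂ)) := by
      rw [← Complex.exp_add, ← Complex.exp_add]
      congr 1
      rw [real_inner_comm]
      simp only [inner_add_right, inner_sub_left]
      push_cast
      ring
    rw [coe_schwartzShift, coe_gaussianSchwartz]
    simp only [tfShift, gaussianWindow, add_sub_cancel_right, smul_eq_mul, neg_mul] at h2 ⊢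
    linear_combination ((Real.exp (-(Real.pi * ‖s‖ ^ 2)) : ℝ) : ℂ) * h2
  simp_rw [h1]
  rw [integral_const_mul, integral_gaussian_mul_cexp Real.pi_pos, norm_mul, norm_cexp_two_pi,
    coe_gaussianSchwartz, gaussianWindow, div_self Real.pi_ne_zero, Real.one_rpow, norm_sub_rev ξ]
  simp only [Complex.ofReal_one, one_mul]
  congr 3
  field_simp

theorem norm_stft_le (f : 𝓢(Config d, ℂ)) (z : Phase d) :
    ‖stft (gaussianWindow d) f z‖ ≤ ∫ t : Config d, ‖f t‖ * ‖gaussianSchwartz d (t - z.1)‖ := by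
  refine (norm_integral_le_integral_norm _).trans (le_of_eq ?_)
  refine integral_congr_ae (Eventually.of_forall fun t => ?_)
  simp only [norm_mul, RCLike.norm_conj, norm_tfShift, coe_gaussianSchwartz]

/-- By Plancherel's theorem the short-time Fourier transform can be computed from the Fourier
transforms. -/
theorem norm_stft_le_fourier (f : 𝓢(Config d, ℂ)) (z : Phase d) :
    ‖stft (gaussianWindow d) f z‖ ≤
      ∫ ξ : Config d, ‖FourierTransform.fourier f ξ‖ * ‖gaussianSchwartz d (ξ - z.2)‖ := by
  have h := SchwartzMap.integral_inner_fourier_fourier (schwartzShift z (gaussianSchwartz d)) f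
  have h2 : stft (gaussianWindow d) f z =
      ∫ t : Config d, inner ℂ (schwartzShift z (gaussianSchwartz d) t) (f t) := by
    refine integral_congr_ae (Eventually.of_forall fun t => ?_)
    simp only [RCLike.inner_apply, coe_schwartzShift, coe_gaussianSchwartz]
  rw [h2, ← h]
  refine (norm_integral_le_integral_norm _).trans (le_of_eq ?_)
  refine integral_congr_ae (Eventually.of_forall fun ξ => ?_)
  simp only [RCLike.inner_apply, norm_mul, RCLike.norm_conj, norm_fourier_schwartzShift]

/-- The short-time Fourier transform of a Schwartz function decays rapidly: in position because the
function does, and in frequency because its Fourier transform does. -/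
theorem exists_stft_decay (f : 𝓢(Config d, ℂ)) (N : ℕ) :
    ∃ C : ℝ, ∀ z, (1 + ‖z‖) ^ N * ‖stft (gaussianWindow d) f z‖ ≤ C := by
  obtain ⟨C₁, h₁⟩ := f.exists_convolution_decay (gaussianSchwartz d) N
  obtain ⟨C₂, h₂⟩ := (FourierTransform.fourier f).exists_convolution_decay (gaussianSchwartz d) N
  refine ⟨max C₁ C₂, fun z => ?_⟩
  rw [Prod.norm_def]
  rcases max_choice ‖z.1‖ ‖z.2‖ with h | h <;> rw [h]
  · exact le_trans (by gcongr; exact norm_stft_le f z) ((h₁ z.1).trans (le_max_left _ _))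
  · exact le_trans (by gcongr; exact norm_stft_le_fourier f z) ((h₂ z.2).trans (le_max_right _ _))

/-- Polynomial weights are admissible. -/
theorem admissibleWeight_one_add_norm_pow (N : ℕ) :
    AdmissibleWeight fun z : Phase d => (1 + ‖z‖) ^ N where
  nonneg z := by positivity
  continuous := by fun_prop
  map_zero := by simp
  even z w h1 h2 := by
    have key : ∀ a b : Config d, (∀ i, |a i| = |b i|) → ‖a‖ = ‖b‖ := by
      intro a b hab
      rw [EuclideanSpace.norm_eq, EuclideanSpace.norm_eq]
      simp only [Real.norm_eq_abs, hab]
    simp only [Prod.norm_def, key _ _ h1, key _ _ h2]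
  submul w z := by
    rw [← mul_pow]
    gcongr
    nlinarith [norm_add_le w z, norm_nonneg w, norm_nonneg z]
  grs z := by
    have h1 : Tendsto (fun n : ℕ => ((n : ℝ) ^ (1 / (n : ℝ))) ^ N) atTop (𝓝 (1 ^ N)) :=
      (tendsto_rpow_div.comp tendsto_natCast_atTop_atTop).pow N
    have h2 : Tendsto (fun n : ℕ => ((1 + ‖z‖) ^ (1 / (n : ℝ))) ^ N) atTop (𝓝 (1 ^ N)) := by
      have h3 : Tendsto (fun n : ℕ => 1 / (n : ℝ)) atTop (𝓝 0) :=
        tendsto_one_div_atTop_nhds_zero_nat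
      have h4 := (Real.continuousAt_const_rpow (a := 1 + ‖z‖) (b := 0)
        (by positivity)).tendsto.comp h3
      rw [Real.rpow_zero] at h4
      exact h4.pow N
    have h5 := h1.mul h2
    simp only [one_pow, one_mul] at h5
    refine tendsto_of_tendsto_of_tendsto_of_le_of_le' tendsto_const_nhds h5
      (Eventually.of_forall fun n => ?_) ?_
    · refine Real.one_le_rpow (one_le_pow₀ ?_) (by positivity)
      linarith [norm_nonneg (n • z)]
    · filter_upwards [eventually_ge_atTop 1] with n hn
      have hn' : (1 : ℝ) ≤ n := by exact_mod_cast hn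
      have h6 : 1 + ‖n • z‖ ≤ n * (1 + ‖z‖) := by
        have : ‖n • z‖ ≤ n * ‖z‖ := norm_nsmul_le
        nlinarith
      rw [← mul_pow, ← Real.mul_rpow (by positivity) (by positivity), ← Real.rpow_natCast,
        ← Real.rpow_natCast, ← Real.rpow_mul (by positivity), ← Real.rpow_mul (by positivity),
        mul_comm (1 / (n : ℝ))]
      rw [Real.rpow_mul (by positivity), Real.rpow_mul (by positivity)]
      gcongr

end Decay

/-! ### The Wigner distribution in coherent state coordinates -/

section Wigner

variable {d : ℕ}

/-- The reflection of a function at the point `p` of the time-frequency plane. -/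
noncomputable def reflect (p : Phase d) (f : Config d → ℂ) : Config d → ℂ := fun s =>
  Complex.exp (2 * Real.pi * Complex.I * ((2 * inner ℝ p.2 (s - p.1) : ℝ) : ℂ)) *
    f ((2 : ℝ) • p.1 - s)

theorem memLp_reflect (p : Phase d) {f : Config d → ℂ}
    (hf : MemLp f 2 (volume : Measure (Config d))) :
    MemLp (reflect p f) 2 (volume : Measure (Config d)) := by
  have h1 : MemLp (fun t => f ((2 : ℝ) • p.1 - t)) 2 (volume : Measure (Config d)) :=
    hf.comp_measurePreserving (Measure.measurePreserving_sub_left _ ((2 : ℝ) • p.1))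
  refine h1.of_le ?_ (Eventually.of_forall fun t => ?_)
  · exact (by fun_prop : Continuous fun s : Config d => Complex.exp
      (2 * Real.pi * Complex.I * ((2 * inner ℝ p.2 (s - p.1) : ℝ) : ℂ))).aestronglyMeasurable.mul
        h1.1
  · rw [reflect, norm_mul, norm_cexp_two_pi, one_mul]

/-- The Wigner distribution at `p` is a scalar product with a reflected function. -/
theorem wigner_eq_integral_reflect (h f : Config d → ℂ) (p : Phase d) :
    wigner h f p = (2 : ℂ) ^ d * ∫ s, h s * conj (reflect p f s) := by
  set G : Config d → ℂ := fun s => h (p.1 + s) * conj (f (p.1 - s)) *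
    Complex.exp (-(2 * Real.pi * Complex.I * ((inner ℝ p.2 ((2 : ℝ) • s) : ℝ) : ℂ))) with hG
  have h1 : wigner h f p = ∫ t : Config d, G ((1 / 2 : ℝ) • t) := by
    refine integral_congr_ae (Eventually.of_forall fun t => ?_)
    simp only [hG, smul_smul]
    norm_num
  rw [h1, Measure.integral_comp_smul, ← integral_sub_right_eq_self G p.1, finrank_euclideanSpace,
    Fintype.card_fin, Complex.real_smul]
  congr 1
  · rw [one_div, inv_pow, inv_inv, abs_of_pos (by positivity)]
    push_cast
    rfl
  · refine integral_congr_ae (Eventually.of_forall fun s => ?_)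
    have h2 : Complex.exp (-(2 * Real.pi * Complex.I *
        ((inner ℝ p.2 ((2 : ℝ) • (s - p.1)) : ℝ) : ℂ))) = conj (Complex.exp
          (2 * Real.pi * Complex.I * ((2 * inner ℝ p.2 (s - p.1) : ℝ) : ℂ))) := by
      rw [conj_cexp_two_pi, inner_smul_right]
      congr 1
      push_cast
      ring
    have e1 : p.1 + (s - p.1) = s := by abel
    have e2 : p.1 - (s - p.1) = (2 : ℝ) • p.1 - s := by module
    simp only [hG, reflect, h2, e1, e2, map_mul]
    ring

theorem conj_wigner (h f : Config d → ℂ) (p : Phase d) :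
    conj (wigner h f p) = wigner f h p := by
  rw [wigner, ← integral_conj, wigner, ← integral_neg_eq_self]
  refine integral_congr_ae (Eventually.of_forall fun t => ?_)
  have h1 : conj (Complex.exp (-(2 * Real.pi * Complex.I * ((inner ℝ p.2 (-t) : ℝ) : ℂ)))) =
      Complex.exp (-(2 * Real.pi * Complex.I * ((inner ℝ p.2 t : ℝ) : ℂ))) := by
    rw [← Complex.exp_conj]
    congr 1
    simp only [map_neg, map_mul, Complex.conj_ofReal, Complex.conj_I, map_ofNat, inner_neg_right]
    push_cast
    ring
  simp only [map_mul, Complex.conj_conj, h1, smul_neg, sub_neg_eq_add, ← sub_eq_add_neg]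
  ring

/-- The coherent state at `z` as a function. -/
noncomputable def coherentFn (z : Phase d) : Config d → ℂ :=
  (gaussNorm d : ℂ) • tfShift z (gaussianWindow d)

/-- The coherent state at `z` as a Schwartz function. -/
noncomputable def coherentSchwartz (z : Phase d) : 𝓢(Config d, ℂ) :=
  (gaussNorm d : ℂ) • schwartzShift z (gaussianSchwartz d)

theorem coe_coherentSchwartz (z : Phase d) : ⇑(coherentSchwartz z) = coherentFn z := by
  ext t
  rw [coherentSchwartz, _root_.smul_apply, coe_schwartzShift, coe_gaussianSchwartz]
  rfl

theorem continuous_coherentSchwartz :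
    Continuous (coherentSchwartz : Phase d → 𝓢(Config d, ℂ)) :=
  (continuous_schwartzShift (gaussianSchwartz d)).const_smul (gaussNorm d : ℂ)

theorem memLp_coherentFn (z : Phase d) :
    MemLp (coherentFn z) 2 (volume : Measure (Config d)) :=
  (memLp_tfShift (memLp_gaussianWindow d) z).const_smul _

theorem toLp_coherentFn (z : Phase d) : (memLp_coherentFn z).toLp _ = coherent z := by
  rw [coherent_eq, ← MemLp.toLp_const_smul]
  rfl

/-- The coefficient of a function with respect to the coherent state at `z`. -/
noncomputable def coeff (f : Config d → ℂ) (z : Phase d) : ℂ :=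
  (gaussNorm d : ℂ) * stft (gaussianWindow d) f z

theorem coeff_eq_inner {f : Config d → ℂ} (hf : MemLp f 2 (volume : Measure (Config d)))
    (z : Phase d) : coeff f z = inner ℂ (coherent z) (hf.toLp f) :=
  (inner_coherent_toLp z hf).symm

theorem continuous_coeff {f : Config d → ℂ} (hf : MemLp f 2 (volume : Measure (Config d))) :
    Continuous (coeff f) := by
  have h : coeff f = fun z => inner ℂ (coherent z) (hf.toLp f) := funext (coeff_eq_inner hf)
  rw [h]
  exact continuous_coherent.inner continuous_const

theorem coeff_add {f g : Config d → ℂ} (hf : MemLp f 2 (volume : Measure (Config d)))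
    (hg : MemLp g 2 (volume : Measure (Config d))) (z : Phase d) :
    coeff (f + g) z = coeff f z + coeff g z := by
  rw [coeff_eq_inner hf, coeff_eq_inner hg, coeff_eq_inner (hf.add hg), MemLp.toLp_add,
    inner_add_right]

theorem coeff_smul {f : Config d → ℂ} (hf : MemLp f 2 (volume : Measure (Config d))) (c : ℂ)
    (z : Phase d) : coeff (c • f) z = c * coeff f z := by
  rw [coeff_eq_inner hf, coeff_eq_inner (hf.const_smul c), MemLp.toLp_const_smul,
    inner_smul_right]

theorem coeff_coherentFn (w z : Phase d) :
    coeff (coherentFn w) z = inner ℂ (coherent z) (coherent w) := by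
  rw [coeff_eq_inner (memLp_coherentFn w), toLp_coherentFn]

theorem wigner_eq_inner {h f : Config d → ℂ} (hh : MemLp h 2 (volume : Measure (Config d)))
    (hf : MemLp f 2 (volume : Measure (Config d))) (p : Phase d) :
    wigner h f p = (2 : ℂ) ^ d * inner ℂ ((memLp_reflect p hf).toLp _) (hh.toLp h) := by
  rw [wigner_eq_integral_reflect, L2.inner_def]
  congr 1
  refine integral_congr_ae ?_
  filter_upwards [hh.coeFn_toLp, (memLp_reflect p hf).coeFn_toLp] with t h1 h2
  rw [h1, h2, RCLike.inner_apply]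

theorem wigner_eq_integral_left {h f : Config d → ℂ}
    (hh : MemLp h 2 (volume : Measure (Config d)))
    (hf : MemLp f 2 (volume : Measure (Config d))) (p : Phase d) :
    wigner h f p = ∫ z, coeff h z * wigner (coherentFn z) f p := by
  rw [wigner_eq_inner hh hf, (isParsevalFamily_coherent d).inner_eq_integral,
    ← integral_const_mul]
  refine integral_congr_ae (Eventually.of_forall fun z => ?_)
  simp only
  rw [wigner_eq_inner (memLp_coherentFn z) hf, toLp_coherentFn, inner_conj_symm,
    coeff_eq_inner hh]
  ring

/-- Two applications of the Parseval identity express a Wigner distribution as a superposition of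
Wigner distributions of coherent states. -/
theorem wigner_eq_integral_integral {h f : Config d → ℂ}
    (hh : MemLp h 2 (volume : Measure (Config d)))
    (hf : MemLp f 2 (volume : Measure (Config d))) (p : Phase d) :
    wigner h f p = ∫ w, ∫ z, coeff h w * conj (coeff f z) *
      wigner (coherentFn w) (coherentFn z) p := by
  rw [wigner_eq_integral_left hh hf]
  refine integral_congr_ae (Eventually.of_forall fun w => ?_)
  simp only
  rw [← conj_wigner f, wigner_eq_integral_left hf (memLp_coherentFn w), ← integral_conj,
    ← integral_const_mul]
  refine integral_congr_ae (Eventually.of_forall fun z => ?_)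
  simp only [map_mul, conj_wigner]
  ring

theorem exists_schwartz_phaseGaussian (d : ℕ) {b : ℝ} (hb : 0 < b) :
    ∃ G : 𝓢(Phase d, ℂ), ∀ p, G p =
      ((Real.exp (-b * (‖p.1‖ ^ 2 + ‖p.2‖ ^ 2)) : ℝ) : ℂ) := by
  have h1 : Function.HasTemperateGrowth fun p : Phase d => ‖p.1‖ ^ 2 :=
    (Function.hasTemperateGrowth_norm_sq (H := Config d)).comp
      (ContinuousLinearMap.fst ℝ (Config d) (Config d)).hasTemperateGrowth
  have h2 : Function.HasTemperateGrowth fun p : Phase d => ‖p.2‖ ^ 2 :=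
    (Function.hasTemperateGrowth_norm_sq (H := Config d)).comp
      (ContinuousLinearMap.snd ℝ (Config d) (Config d)).hasTemperateGrowth
  obtain ⟨G, hG⟩ := SchwartzMap.exists_eq_exp_neg (E := Phase d)
    (q := fun p => b * (‖p.1‖ ^ 2 + ‖p.2‖ ^ 2)) (c := b) (by fun_prop) hb (fun p => by
      gcongr
      rw [Prod.norm_def]
      rcases max_choice ‖p.1‖ ‖p.2‖ with h | h <;> rw [h] <;> simp)
  exact ⟨G, fun p => by rw [hG, neg_mul]⟩

/-- The Gaussian `e^{-b|p|²}` on the time-frequency plane as a Schwartz function. -/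
noncomputable def phaseGaussian (d : ℕ) {b : ℝ} (hb : 0 < b) : 𝓢(Phase d, ℂ) :=
  (exists_schwartz_phaseGaussian d hb).choose

theorem phaseGaussian_apply {b : ℝ} (hb : 0 < b) (p : Phase d) :
    phaseGaussian d hb p = ((Real.exp (-b * (‖p.1‖ ^ 2 + ‖p.2‖ ^ 2)) : ℝ) : ℂ) :=
  (exists_schwartz_phaseGaussian d hb).choose_spec p

/-- The functional `p ↦ 2π ζ·p`. -/
noncomputable def phaseFunctional (ζ : Phase d) : Phase d →L[ℝ] ℝ :=
  (innerSL ℝ ((2 * Real.pi) • ζ.1)).comp (ContinuousLinearMap.fst ℝ (Config d) (Config d)) +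
    (innerSL ℝ ((2 * Real.pi) • ζ.2)).comp (ContinuousLinearMap.snd ℝ (Config d) (Config d))

theorem phaseFunctional_apply (ζ p : Phase d) :
    phaseFunctional ζ p = 2 * Real.pi * (inner ℝ ζ.1 p.1 + inner ℝ ζ.2 p.2) := by
  simp [phaseFunctional]
  ring

theorem continuous_phaseFunctional : Continuous (phaseFunctional (d := d)) := by
  have h1 : Continuous fun ζ : Phase d => innerSL ℝ ((2 * Real.pi) • ζ.1) :=
    (innerSL ℝ).continuous.comp (continuous_fst.const_smul (2 * Real.pi))
  have h2 : Continuous fun ζ : Phase d => innerSL ℝ ((2 * Real.pi) • ζ.2) :=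
    (innerSL ℝ).continuous.comp (continuous_snd.const_smul (2 * Real.pi))
  exact (h1.clm_comp continuous_const).add (h2.clm_comp continuous_const)

theorem one_add_norm_phaseFunctional_le (ζ : Phase d) :
    1 + ‖phaseFunctional ζ‖ ≤ 4 * Real.pi * (1 + ‖ζ‖) := by
  have h : ‖phaseFunctional ζ‖ ≤ 4 * Real.pi * ‖ζ‖ := by
    refine ContinuousLinearMap.opNorm_le_bound _ (by positivity) fun p => ?_
    rw [phaseFunctional_apply, norm_mul, Real.norm_of_nonneg (by positivity)]
    have h1 := (norm_inner_le_norm (𝕜 := ℝ) ζ.1 p.1).trans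
      (mul_le_mul (norm_fst_le ζ) (norm_fst_le p) (norm_nonneg _) (norm_nonneg _))
    have h2 := (norm_inner_le_norm (𝕜 := ℝ) ζ.2 p.2).trans
      (mul_le_mul (norm_snd_le ζ) (norm_snd_le p) (norm_nonneg _) (norm_nonneg _))
    have h3 := (norm_add_le (inner ℝ ζ.1 p.1) (inner ℝ ζ.2 p.2)).trans (add_le_add h1 h2)
    calc _ ≤ 2 * Real.pi * (‖ζ‖ * ‖p‖ + ‖ζ‖ * ‖p‖) := by gcongr
      _ = _ := by ring
  have := Real.pi_gt_three
  linarith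

/-- The time-frequency shift of a Schwartz function on the time-frequency plane. -/
noncomputable def symbolShiftSchwartz (z ζ : Phase d) (F : 𝓢(Phase d, ℂ)) : 𝓢(Phase d, ℂ) :=
  SchwartzMap.modulate F z (phaseFunctional ζ)

theorem coe_symbolShiftSchwartz (z ζ : Phase d) (F : 𝓢(Phase d, ℂ)) :
    ⇑(symbolShiftSchwartz z ζ F) = symbolShift z ζ F := by
  ext p
  rw [symbolShiftSchwartz, SchwartzMap.modulate_apply, symbolShift, phaseFunctional_apply]
  congr 2
  push_cast
  ring

theorem continuous_symbolShiftSchwartz (F : 𝓢(Phase d, ℂ)) :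
    Continuous fun x : Phase d × Phase d => symbolShiftSchwartz x.1 x.2 F := by
  have h : Continuous fun x : Phase d × Phase d =>
      ((x.1, phaseFunctional x.2) : Phase d × (Phase d →L[ℝ] ℝ)) :=
    continuous_fst.prodMk (continuous_phaseFunctional.comp continuous_snd)
  have h2 := (SchwartzMap.continuous_modulate (E := Phase d) F).comp h
  unfold symbolShiftSchwartz
  exact h2

theorem exists_seminorm_symbolShiftSchwartz_le (F : 𝓢(Phase d, ℂ)) (k n : ℕ) :
    ∃ C : ℝ, 0 ≤ C ∧ ∀ z ζ : Phase d,
      SchwartzMap.seminorm ℂ k n (symbolShiftSchwartz z ζ F) ≤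
        C * ((1 + ‖z‖) ^ k * (1 + ‖ζ‖) ^ n) := by
  obtain ⟨C, hC0, hC⟩ := SchwartzMap.exists_seminorm_modulate_le F k n
  refine ⟨C * (4 * Real.pi) ^ n, by positivity, fun z ζ => (hC z _).trans ?_⟩
  calc C * ((1 + ‖z‖) ^ k * (1 + ‖phaseFunctional ζ‖) ^ n)
      ≤ C * ((1 + ‖z‖) ^ k * (4 * Real.pi * (1 + ‖ζ‖)) ^ n) := by
        gcongr
        exact one_add_norm_phaseFunctional_le ζ
    _ = _ := by rw [mul_pow]; ring

/-- The frequency `j(w - z)`, at which the Wigner distribution of the coherent states at `w` and `z`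
is concentrated. -/
noncomputable def wignerFreq (w z : Phase d) : Phase d := (w.2 - z.2, -(w.1 - z.1))

/-- The Wigner distribution of two coherent states as a Schwartz function. -/
noncomputable def coherentWigner (w z : Phase d) : 𝓢(Phase d, ℂ) :=
  ((gaussNorm d : ℂ) ^ 2 * ((gaussConst d)⁻¹ : ℂ) *
    Complex.exp (2 * Real.pi * Complex.I *
      ((inner ℝ ((1 / 2 : ℝ) • (w.2 + z.2)) (w.1 - z.1) : ℝ) : ℂ))) •
    symbolShiftSchwartz ((1 / 2 : ℝ) • (w + z)) (wignerFreq w z)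
      (phaseGaussian d Real.two_pi_pos)

theorem wigner_smul_smul (c c' : ℂ) (h f : Config d → ℂ) (p : Phase d) :
    wigner (c • h) (c' • f) p = c * conj c' * wigner h f p := by
  rw [wigner, wigner, ← integral_const_mul]
  refine integral_congr_ae (Eventually.of_forall fun t => ?_)
  simp only [Pi.smul_apply, smul_eq_mul, map_mul]
  ring

theorem coe_coherentWigner (w z : Phase d) :
    ⇑(coherentWigner w z) = wigner (coherentFn w) (coherentFn z) := by
  ext p
  rw [coherentWigner, _root_.smul_apply, coe_symbolShiftSchwartz, coherentFn, coherentFn,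
    wigner_smul_smul, wigner_gaussianWindow, Complex.conj_ofReal]
  have h : (phaseGaussian d Real.two_pi_pos : Phase d → ℂ) =
      fun q => ((Real.exp (-(2 * Real.pi) * (‖q.1‖ ^ 2 + ‖q.2‖ ^ 2)) : ℝ) : ℂ) :=
    funext (phaseGaussian_apply _)
  rw [h, wignerFreq, smul_eq_mul]
  ring

theorem continuous_coherentWigner :
    Continuous fun x : Phase d × Phase d => coherentWigner x.1 x.2 := by
  have h : Continuous fun x : Phase d × Phase d =>
      (((1 / 2 : ℝ) • (x.1 + x.2), wignerFreq x.1 x.2) : Phase d × Phase d) := by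
    unfold wignerFreq
    fun_prop
  have h2 := (continuous_symbolShiftSchwartz (phaseGaussian d Real.two_pi_pos)).comp h
  have h3 : Continuous fun x : Phase d × Phase d =>
      (gaussNorm d : ℂ) ^ 2 * ((gaussConst d)⁻¹ : ℂ) *
        Complex.exp (2 * Real.pi * Complex.I *
          ((inner ℝ ((1 / 2 : ℝ) • (x.1.2 + x.2.2)) (x.1.1 - x.2.1) : ℝ) : ℂ)) := by
    fun_prop
  unfold coherentWigner
  exact h3.smul h2

theorem exists_seminorm_coherentWigner_le (d k n : ℕ) :
    ∃ C : ℝ, 0 ≤ C ∧ ∀ w z : Phase d, SchwartzMap.seminorm ℂ k n (coherentWigner w z) ≤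
      C * ((1 + ‖w‖) ^ (k + n) * (1 + ‖z‖) ^ (k + n)) := by
  obtain ⟨C, hC0, hC⟩ := exists_seminorm_symbolShiftSchwartz_le
    (phaseGaussian d Real.two_pi_pos) k n
  have hg := gaussConst_pos d
  refine ⟨(gaussNorm d) ^ 2 * (gaussConst d)⁻¹ * C, by positivity, fun w z => ?_⟩
  rw [coherentWigner, map_smul_eq_mul, norm_mul, norm_cexp_two_pi, mul_one]
  have h0 : ‖(gaussNorm d : ℂ) ^ 2 * ((gaussConst d)⁻¹ : ℂ)‖ =
      gaussNorm d ^ 2 * (gaussConst d)⁻¹ := by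
    rw [← Complex.ofReal_inv, ← Complex.ofReal_pow, ← Complex.ofReal_mul, Complex.norm_real,
      Real.norm_of_nonneg (by positivity)]
  rw [h0, mul_assoc _ C]
  refine mul_le_mul_of_nonneg_left ((hC _ _).trans ?_) (by positivity)
  have h1 : 1 + ‖(1 / 2 : ℝ) • (w + z)‖ ≤ (1 + ‖w‖) * (1 + ‖z‖) := by
    rw [norm_smul]
    have := norm_add_le w z
    norm_num
    nlinarith [norm_nonneg w, norm_nonneg z]
  have h2 : 1 + ‖wignerFreq w z‖ ≤ (1 + ‖w‖) * (1 + ‖z‖) := by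
    have h3 : ‖wignerFreq w z‖ ≤ ‖w - z‖ := by
      rw [wignerFreq, Prod.norm_def, norm_neg]
      exact max_le (norm_snd_le (w - z)) (norm_fst_le (w - z))
    have := norm_sub_le w z
    nlinarith [norm_nonneg w, norm_nonneg z]
  calc C * ((1 + ‖(1 / 2 : ℝ) • (w + z)‖) ^ k * (1 + ‖wignerFreq w z‖) ^ n)
      ≤ C * (((1 + ‖w‖) * (1 + ‖z‖)) ^ k * ((1 + ‖w‖) * (1 + ‖z‖)) ^ n) := by gcongr
    _ = _ := by rw [← pow_add, mul_pow]

end Wigner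

/-! ### The Weyl form in coherent state coordinates -/

section WeylForm

variable {d : ℕ}

instance isAddHaarMeasure_volume_phase : (volume : Measure (Phase d)).IsAddHaarMeasure := by
  rw [Measure.volume_eq_prod]
  infer_instance

theorem isNegInvariant_of_isAddHaarMeasure {E : Type*} [NormedAddCommGroup E] [NormedSpace ℝ E]
    [FiniteDimensional ℝ E] [MeasurableSpace E] [BorelSpace E] (μ : Measure E)
    [μ.IsAddHaarMeasure] : μ.IsNegInvariant := inferInstance

instance isNegInvariant_volume_phase : (volume : Measure (Phase d)).IsNegInvariant :=
  isNegInvariant_of_isAddHaarMeasure _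

/-- The matrix of a Weyl operator with respect to the coherent states (see
`weylForm_coherentSchwartz`). -/
noncomputable def weylKernel (σ : 𝓢'(Phase d, ℂ)) (w z : Phase d) : ℂ := σ (coherentWigner w z)

theorem continuous_weylKernel (σ : 𝓢'(Phase d, ℂ)) :
    Continuous fun x : Phase d × Phase d => weylKernel σ x.1 x.2 :=
  (map_continuous σ).comp continuous_coherentWigner

theorem weylForm_coherentSchwartz (σ : 𝓢'(Phase d, ℂ)) (w z : Phase d) :
    weylForm σ (coherentSchwartz w) (coherentSchwartz z) = weylKernel σ w z := by
  refine distPairing_eq σ _ _ fun p => ?_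
  rw [conj_wigner, coe_coherentWigner, coe_coherentSchwartz, coe_coherentSchwartz]

/-- The kernel of any tempered Weyl operator grows at most polynomially. -/
theorem exists_weylKernel_le (σ : 𝓢'(Phase d, ℂ)) : ∃ (N : ℕ) (C : ℝ), 0 ≤ C ∧
    ∀ w z, ‖weylKernel σ w z‖ ≤ C * ((1 + ‖w‖) ^ N * (1 + ‖z‖) ^ N) := by
  obtain ⟨s, C, -, hC⟩ := Seminorm.bound_of_continuous (schwartz_withSeminorms ℂ (Phase d) ℂ)
    ((normSeminorm ℂ ℂ).comp (σ : 𝓢(Phase d, ℂ) →ₗ[ℂ] ℂ)) (continuous_norm.comp (map_continuous σ))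
  choose D hD0 hD using fun i : ℕ × ℕ => exists_seminorm_coherentWigner_le d i.1 i.2
  refine ⟨∑ i ∈ s, (i.1 + i.2), C * ∑ i ∈ s, D i,
    mul_nonneg C.2 (Finset.sum_nonneg fun i _ => hD0 i), fun w z => ?_⟩
  refine (hC _).trans ?_
  rw [_root_.smul_apply, NNReal.smul_def, smul_eq_mul, mul_assoc]
  refine mul_le_mul_of_nonneg_left ?_ C.2
  refine Seminorm.finset_sup_apply_le
    (mul_nonneg (Finset.sum_nonneg fun i _ => hD0 i) (by positivity)) fun i hi => ?_
  refine (hD i w z).trans ?_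
  have h1 : i.1 + i.2 ≤ ∑ i ∈ s, (i.1 + i.2) :=
    Finset.single_le_sum (f := fun i : ℕ × ℕ => i.1 + i.2) (fun _ _ => Nat.zero_le _) hi
  have h2 : ∀ x : Phase d, 1 ≤ 1 + ‖x‖ := fun x => by linarith [norm_nonneg x]
  refine mul_le_mul (Finset.single_le_sum (fun i _ => hD0 i) hi) ?_ (by positivity)
    (Finset.sum_nonneg fun i _ => hD0 i)
  gcongr
  · exact h2 w
  · exact h2 z

theorem enorm_coeff (f : Config d → ℂ) (z : Phase d) :
    ‖coeff f z‖ₑ = ENNReal.ofReal (gaussNorm d) * ‖stft (gaussianWindow d) f z‖ₑ := by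
  rw [coeff, enorm_mul]
  congr 1
  rw [← ofReal_norm, Complex.norm_real, Real.norm_of_nonneg (gaussNorm_pos d).le]

theorem lintegral_enorm_coeff_mul (u : Phase d → ℝ) (f : Config d → ℂ) :
    ∫⁻ z, ‖coeff f z‖ₑ * ENNReal.ofReal (u z) = ENNReal.ofReal (gaussNorm d) * m1Norm u f := by
  simp_rw [enorm_coeff, mul_assoc]
  rw [lintegral_const_mul' _ _ ENNReal.ofReal_ne_top]
  rfl

theorem lintegral_enorm_coeff_mul_ne_top {u : Phase d → ℝ} {f : Config d → ℂ} (hf : MemM1 u f) :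
    ∫⁻ z, ‖coeff f z‖ₑ * ENNReal.ofReal (u z) ≠ ∞ := by
  rw [lintegral_enorm_coeff_mul]
  exact ENNReal.mul_ne_top ENNReal.ofReal_ne_top hf.2.ne

/-- The coherent states are normalised while the window of `m1Norm` is not, which accounts for the
factor `gaussNorm d`. -/
theorem m1Norm_eq (u : Phase d → ℝ) (f : Config d → ℂ) :
    m1Norm u f = ENNReal.ofReal (gaussNorm d)⁻¹ * ∫⁻ z, ‖coeff f z‖ₑ * ENNReal.ofReal (u z) := by
  rw [lintegral_enorm_coeff_mul, ← mul_assoc,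
    ← ENNReal.ofReal_mul (inv_pos.2 (gaussNorm_pos d)).le, inv_mul_cancel₀ (gaussNorm_pos d).ne',
    ENNReal.ofReal_one, one_mul]

theorem memM1_of_lintegral_ne_top {u : Phase d → ℝ} {f : Config d → ℂ}
    (hf : MemLp f 2 (volume : Measure (Config d)))
    (h : ∫⁻ z, ‖coeff f z‖ₑ * ENNReal.ofReal (u z) ≠ ∞) : MemM1 u f := by
  refine ⟨hf, ?_⟩
  rw [m1Norm_eq]
  exact ENNReal.mul_lt_top ENNReal.ofReal_lt_top h.lt_top

theorem integrable_mul_norm_coeff {u : Phase d → ℝ} (hu : AdmissibleWeight u) {f : Config d → ℂ}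
    (hf : MemM1 u f) : Integrable fun z => u z * ‖coeff f z‖ := by
  refine ⟨(hu.continuous.mul (continuous_coeff hf.1).norm).aestronglyMeasurable, ?_⟩
  rw [HasFiniteIntegral]
  refine lt_of_le_of_lt (lintegral_mono fun z => ?_) (lintegral_enorm_coeff_mul_ne_top hf).lt_top
  rw [enorm_mul, enorm_norm, mul_comm, Real.enorm_eq_ofReal (hu.nonneg z)]

theorem integrable_pow_mul_norm_coeff (f : 𝓢(Config d, ℂ)) (N : ℕ) :
    Integrable fun z : Phase d => (1 + ‖z‖) ^ N * ‖coeff f z‖ := by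
  set M : ℕ := Module.finrank ℝ (Phase d) + 1 with hM
  obtain ⟨C, hC⟩ := exists_stft_decay f (N + M)
  have h1 : Integrable fun z : Phase d => (1 + ‖z‖) ^ (-(M : ℝ)) :=
    integrable_one_add_norm (by rw [hM]; push_cast; linarith)
  have hc : Continuous (coeff f) := continuous_coeff (f.memLp 2 volume)
  refine (h1.const_mul (gaussNorm d * C)).mono' (by fun_prop) (Eventually.of_forall fun z => ?_)
  have h2 := hC z
  have h3 := gaussNorm_pos d
  rw [Real.norm_of_nonneg (by positivity), coeff, norm_mul, Complex.norm_real,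
    Real.norm_of_nonneg h3.le, Real.rpow_neg (by positivity), Real.rpow_natCast,
    ← div_eq_mul_inv, le_div_iff₀ (by positivity)]
  calc (1 + ‖z‖) ^ N * (gaussNorm d * ‖stft (gaussianWindow d) f z‖) * (1 + ‖z‖) ^ M
      = gaussNorm d * ((1 + ‖z‖) ^ (N + M) * ‖stft (gaussianWindow d) f z‖) := by
        rw [pow_add]; ring
    _ ≤ _ := by gcongr

theorem memM1_schwartz (f : 𝓢(Config d, ℂ)) (N : ℕ) :
    MemM1 (fun z : Phase d => (1 + ‖z‖) ^ N) f := by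
  refine memM1_of_lintegral_ne_top (f.memLp 2 volume) ?_
  have h := (integrable_pow_mul_norm_coeff f N).hasFiniteIntegral
  rw [HasFiniteIntegral] at h
  refine ne_top_of_le_ne_top h.ne (lintegral_mono fun z => ?_)
  rw [enorm_mul, enorm_norm, mul_comm, Real.enorm_eq_ofReal (by positivity)]

/-- The Weyl form of Schwartz functions in coherent state coordinates. -/
theorem weylForm_eq_integral (σ : 𝓢'(Phase d, ℂ)) (f h : 𝓢(Config d, ℂ)) :
    weylForm σ f h = ∫ x : Phase d × Phase d,
      coeff f x.1 * conj (coeff h x.2) * weylKernel σ x.1 x.2 ∂(volume.prod volume) := by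
  have hf : Continuous (coeff f) := continuous_coeff (f.memLp 2 volume)
  have hh : Continuous (coeff h) := continuous_coeff (h.memLp 2 volume)
  set ψ : Phase d × Phase d → 𝓢(Phase d, ℂ) := fun x =>
    (coeff f x.1 * conj (coeff h x.2)) • coherentWigner x.1 x.2 with hψ
  have hψc : Continuous ψ := by
    have h1 : Continuous fun x : Phase d × Phase d => coeff f x.1 * conj (coeff h x.2) :=
      (hf.comp continuous_fst).mul (Complex.continuous_conj.comp (hh.comp continuous_snd))
    exact h1.smul continuous_coherentWigner
  have hb : ∀ k n, Integrable (fun x => SchwartzMap.seminorm ℂ k n (ψ x))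
      ((volume : Measure (Phase d)).prod volume) := by
    intro k n
    obtain ⟨C, hC0, hC⟩ := exists_seminorm_coherentWigner_le d k n
    have h1 := ((integrable_pow_mul_norm_coeff f (k + n)).mul_prod
      (integrable_pow_mul_norm_coeff h (k + n))).const_mul C
    have h2 : Continuous fun x => SchwartzMap.seminorm ℂ k n (ψ x) :=
      ((schwartz_withSeminorms ℂ (Phase d) ℂ).continuous_seminorm (k, n)).comp hψc
    refine h1.mono' h2.aestronglyMeasurable (Eventually.of_forall fun x => ?_)
    rw [Real.norm_of_nonneg (apply_nonneg _ _), hψ]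
    simp only [map_smul_eq_mul, norm_mul, RCLike.norm_conj]
    calc ‖coeff f x.1‖ * ‖coeff h x.2‖ * SchwartzMap.seminorm ℂ k n (coherentWigner x.1 x.2)
        ≤ ‖coeff f x.1‖ * ‖coeff h x.2‖ *
            (C * ((1 + ‖x.1‖) ^ (k + n) * (1 + ‖x.2‖) ^ (k + n))) := by
          gcongr
          exact hC _ _
      _ = _ := by ring
  -- the superposition of the distributions `coherentWigner` is again a Wigner distribution
  obtain ⟨I, hI, hσ⟩ := SchwartzMap.exists_integral_param hψc hb
  have h3 : ∀ p, I p = conj (wigner h f p) := by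
    intro p
    have h4 : Integrable (fun x => ψ x p) ((volume : Measure (Phase d)).prod volume) := by
      refine (hb 0 0).mono' ?_ (Eventually.of_forall fun x =>
        SchwartzMap.norm_le_seminorm ℂ (ψ x) p)
      have h5 : Continuous fun F : 𝓢(Phase d, ℂ) => F p :=
        (BoundedContinuousFunction.evalCLM ℂ p).continuous.comp
          (SchwartzMap.toBoundedContinuousFunctionCLM ℂ (Phase d) ℂ).continuous
      exact (h5.comp hψc).aestronglyMeasurable
    rw [hI, conj_wigner, wigner_eq_integral_integral (f.memLp 2 volume) (h.memLp 2 volume),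
      integral_prod _ h4]
    simp only [hψ, _root_.smul_apply, smul_eq_mul, coe_coherentWigner]
  rw [weylForm, distPairing_eq σ _ I h3, hσ]
  refine integral_congr_ae (Eventually.of_forall fun x => ?_)
  simp only [hψ, map_smul, smul_eq_mul, weylKernel]

theorem integrable_weylKernel {u : Phase d → ℝ} (hu : AdmissibleWeight u) {σ : 𝓢'(Phase d, ℂ)}
    {C : ℝ} (hC : ∀ w z, ‖weylKernel σ w z‖ ≤ C * (u w * u z)) {f h : Config d → ℂ}
    (hf : MemM1 u f) (hh : MemM1 u h) :
    Integrable (fun x : Phase d × Phase d =>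
      coeff f x.1 * conj (coeff h x.2) * weylKernel σ x.1 x.2) (volume.prod volume) := by
  have h1 := ((integrable_mul_norm_coeff hu hf).mul_prod
    (integrable_mul_norm_coeff hu hh)).const_mul C
  have hfc := continuous_coeff hf.1
  have hhc := continuous_coeff hh.1
  have h2 : Continuous fun x : Phase d × Phase d =>
      coeff f x.1 * conj (coeff h x.2) * weylKernel σ x.1 x.2 :=
    ((hfc.comp continuous_fst).mul (Complex.continuous_conj.comp (hhc.comp continuous_snd))).mul
      (continuous_weylKernel σ)
  refine h1.mono' h2.aestronglyMeasurable (Eventually.of_forall fun x => ?_)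
  rw [norm_mul, norm_mul, RCLike.norm_conj]
  calc ‖coeff f x.1‖ * ‖coeff h x.2‖ * ‖weylKernel σ x.1 x.2‖
      ≤ ‖coeff f x.1‖ * ‖coeff h x.2‖ * (C * (u x.1 * u x.2)) := by
        gcongr
        exact hC _ _
    _ = _ := by ring

/-- If the kernel of a Weyl operator is controlled by a weight, then the integral representation
extends its form to the corresponding modulation space. -/
theorem isWeylExtension_integral {u : Phase d → ℝ} (hu : AdmissibleWeight u) {σ : 𝓢'(Phase d, ℂ)}
    {C : ℝ} (hC0 : 0 ≤ C) (hC : ∀ w z, ‖weylKernel σ w z‖ ≤ C * (u w * u z)) :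
    IsWeylExtension u σ fun f h => ∫ x : Phase d × Phase d,
      coeff f x.1 * conj (coeff h x.2) * weylKernel σ x.1 x.2 ∂(volume.prod volume) where
  add_left f₁ f₂ h hf₁ hf₂ hh := by
    rw [← integral_add (integrable_weylKernel hu hC hf₁ hh) (integrable_weylKernel hu hC hf₂ hh)]
    refine integral_congr_ae (Eventually.of_forall fun x => ?_)
    simp only [coeff_add hf₁.1 hf₂.1]
    ring
  smul_left c f h hf hh := by
    rw [← integral_const_mul]
    refine integral_congr_ae (Eventually.of_forall fun x => ?_)
    simp only [coeff_smul hf.1]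
    ring
  add_right f h₁ h₂ hf hh₁ hh₂ := by
    rw [← integral_add (integrable_weylKernel hu hC hf hh₁) (integrable_weylKernel hu hC hf hh₂)]
    refine integral_congr_ae (Eventually.of_forall fun x => ?_)
    simp only [coeff_add hh₁.1 hh₂.1, map_add]
    ring
  smul_right c f h hf hh := by
    rw [← integral_const_mul]
    refine integral_congr_ae (Eventually.of_forall fun x => ?_)
    simp only [coeff_smul hh.1, map_mul]
    ring
  bounded := by
    refine ⟨(C * gaussNorm d * gaussNorm d).toNNReal, fun f h hf hh => ?_⟩
    have hum : Measurable fun z : Phase d => ENNReal.ofReal (u z) :=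
      hu.continuous.measurable.ennreal_ofReal
    have hfm : Measurable fun z => ‖coeff f z‖ₑ := (continuous_coeff hf.1).enorm.measurable
    have hhm : Measurable fun z => ‖coeff h z‖ₑ := (continuous_coeff hh.1).enorm.measurable
    calc _ ≤ ∫⁻ x : Phase d × Phase d, ENNReal.ofReal C *
            ((‖coeff f x.1‖ₑ * ENNReal.ofReal (u x.1)) *
              (‖coeff h x.2‖ₑ * ENNReal.ofReal (u x.2))) ∂(volume.prod volume) := by
          refine (enorm_integral_le_lintegral_enorm _).trans (lintegral_mono fun x => ?_)
          rw [enorm_mul, enorm_mul, RCLike.enorm_conj]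
          calc ‖coeff f x.1‖ₑ * ‖coeff h x.2‖ₑ * ‖weylKernel σ x.1 x.2‖ₑ
              ≤ ‖coeff f x.1‖ₑ * ‖coeff h x.2‖ₑ *
                  (ENNReal.ofReal C * (ENNReal.ofReal (u x.1) * ENNReal.ofReal (u x.2))) := by
                gcongr
                rw [← ofReal_norm, ← ENNReal.ofReal_mul (hu.nonneg _), ← ENNReal.ofReal_mul hC0]
                exact ENNReal.ofReal_le_ofReal (hC _ _)
            _ = _ := by ring
      _ = ENNReal.ofReal C * ((∫⁻ z, ‖coeff f z‖ₑ * ENNReal.ofReal (u z)) *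
            ∫⁻ z, ‖coeff h z‖ₑ * ENNReal.ofReal (u z)) := by
          rw [lintegral_const_mul' _ _ ENNReal.ofReal_ne_top, lintegral_prod_mul
            (hfm.fun_mul hum).aemeasurable (hhm.fun_mul hum).aemeasurable]
      _ = _ := by
          rw [lintegral_enorm_coeff_mul, lintegral_enorm_coeff_mul]
          have hg := (gaussNorm_pos d).le
          have : (((C * gaussNorm d * gaussNorm d).toNNReal : ℝ≥0) : ℝ≥0∞) =
              ENNReal.ofReal C * ENNReal.ofReal (gaussNorm d) * ENNReal.ofReal (gaussNorm d) := by
            rw [← ENNReal.ofReal_mul hC0, ← ENNReal.ofReal_mul (by positivity)]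
            rfl
          rw [this]
          ring
  extends_schwartz f h _ _ := (weylForm_eq_integral σ f h).symm

end WeylForm

/-! ### Approximation by Schwartz functions -/

section Approximation

variable {d : ℕ}

/-- Schwartz functions are dense in `M¹_u`: truncate the coherent state expansion
`f = ∫ ⟨e_w, f⟩ e_w dw` to a ball. The coefficients of the approximations have a common majorant
that does not depend on `u`. -/
theorem exists_schwartz_approx {u : Phase d → ℝ} (hu : AdmissibleWeight u) {f : Config d → ℂ}
    (hf : MemM1 u f) : ∃ F : ℕ → 𝓢(Config d, ℂ), (∀ n, MemM1 u (F n)) ∧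
      Tendsto (fun n => m1Norm u (f - ⇑(F n))) atTop (𝓝 0) ∧
      ∀ n z, ‖coeff (F n) z‖ₑ ≤
        nconv volume (fun w => ‖coeff f w‖ₑ) (expEnvelope (Real.exp 1)) z := by
  have hfc := continuous_coeff hf.1
  have hfm : Measurable fun z => ‖coeff f z‖ₑ := hfc.enorm.measurable
  have hω := hu.subexpWeight
  have hωm := hω.measurable
  have hΓω := hω.lintegral_expEnvelope_mul_ne_top (μ := volume) (Real.exp 1)
  have hΓm := measurable_expEnvelope (E := Phase d) (Real.exp 1)
  have hfω := lintegral_enorm_coeff_mul_ne_top hf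
  have hyoung : ∀ m : Phase d → ℝ≥0∞, Measurable m →
      ∫⁻ z, nconv volume m (expEnvelope (Real.exp 1)) z * ENNReal.ofReal (u z) ≤
        (∫⁻ z, m z * ENNReal.ofReal (u z)) *
          ∫⁻ z, expEnvelope (Real.exp 1) z * ENNReal.ofReal (u z) :=
    fun m hm => lintegral_nconv_mul_le hm hΓm hωm hω.submul
  have hΓ : ∀ w z : Phase d, ‖coeff (coherentFn w) z‖ₑ ≤ expEnvelope (Real.exp 1) (z - w) := by
    intro w z
    rw [coeff_coherentFn, ← inner_conj_symm, RCLike.enorm_conj]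
    exact enorm_inner_coherent_coherent_le z w
  set ψ : Phase d → 𝓢(Config d, ℂ) := fun w => coeff f w • coherentSchwartz w with hψ
  have hψc : Continuous ψ := hfc.smul continuous_coherentSchwartz
  have hex : ∀ n : ℕ, ∃ F : 𝓢(Config d, ℂ), ∀ z, coeff F z =
      ∫ w in Metric.closedBall 0 (n : ℝ), coeff f w * coeff (coherentFn w) z := by
    intro n
    obtain ⟨F, -, hF⟩ := SchwartzMap.exists_integral_param
      (μ := volume.restrict (Metric.closedBall (0 : Phase d) n)) hψc (fun k m => by
        have h2 : Continuous fun x => SchwartzMap.seminorm ℂ k m (ψ x) :=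
          ((schwartz_withSeminorms ℂ (Config d) ℂ).continuous_seminorm (k, m)).comp hψc
        exact h2.continuousOn.integrableOn_compact (isCompact_closedBall _ _))
    refine ⟨F, fun z => ?_⟩
    -- the coefficient at `z` is a tempered distribution, so it commutes with the integral
    have h3 := hF (ContinuousLinearMap.toPointwiseConvergenceCLM ℂ (RingHom.id ℂ)
      𝓢(Config d, ℂ) ℂ ((innerSL ℂ (coherent z)).comp
        (SchwartzMap.toLpCLM ℂ ℂ (E := Config d) 2 volume)))
    have h4 : ∀ G : 𝓢(Config d, ℂ), (ContinuousLinearMap.toPointwiseConvergenceCLM ℂ (RingHom.id ℂ)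
      𝓢(Config d, ℂ) ℂ ((innerSL ℂ (coherent z)).comp
        (SchwartzMap.toLpCLM ℂ ℂ (E := Config d) 2 volume))) G = coeff G z := fun G =>
      (coeff_eq_inner (G.memLp 2 volume) z).symm
    rw [h4] at h3
    rw [h3]
    refine integral_congr_ae (Eventually.of_forall fun w => ?_)
    simp only [h4]
    rw [← coe_coherentSchwartz, ← coeff_smul ((coherentSchwartz w).memLp 2 volume)]
    rfl
  choose F hF using hex
  have hbound : ∀ n z, ‖coeff (F n) z‖ₑ ≤
      nconv volume (fun w => ‖coeff f w‖ₑ) (expEnvelope (Real.exp 1)) z := by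
    intro n z
    rw [hF]
    refine (enorm_integral_le_lintegral_enorm _).trans ((setLIntegral_le_lintegral _ _).trans ?_)
    refine lintegral_mono fun w => ?_
    rw [enorm_mul]
    gcongr
    exact hΓ w z
  have hdiff : ∀ n z, ‖coeff (f - ⇑(F n)) z‖ₑ ≤ nconv volume
      ((Metric.closedBall 0 (n : ℝ))ᶜ.indicator fun w => ‖coeff f w‖ₑ)
        (expEnvelope (Real.exp 1)) z := by
    intro n z
    have hFn := (F n).memLp 2 (volume : Measure (Config d))
    have h1 : coeff (f - ⇑(F n)) z = coeff f z - coeff (F n) z := by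
      rw [coeff_eq_inner hf.1, coeff_eq_inner hFn, coeff_eq_inner (hf.1.sub hFn), MemLp.toLp_sub,
        inner_sub_right]
    have hint : Integrable fun w => coeff f w * coeff (coherentFn w) z := by
      have := (isParsevalFamily_coherent d).integrable_coeff_mul (coherent z)
        ((isParsevalFamily_coherent d).memLp_coeff (hf.1.toLp f))
      refine this.congr (Eventually.of_forall fun w => ?_)
      simp only
      rw [coeff_coherentFn, coeff_eq_inner hf.1, inner_conj_symm, mul_comm]
    have h2 : coeff f z = ∫ w, coeff f w * coeff (coherentFn w) z := by
      rw [coeff_eq_inner hf.1, (isParsevalFamily_coherent d).inner_eq_integral]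
      refine integral_congr_ae (Eventually.of_forall fun w => ?_)
      simp only
      rw [coeff_coherentFn, coeff_eq_inner hf.1, inner_conj_symm, mul_comm]
    have h3 : coeff (f - ⇑(F n)) z =
        ∫ w in (Metric.closedBall 0 (n : ℝ))ᶜ, coeff f w * coeff (coherentFn w) z := by
      rw [h1, h2, hF, ← integral_add_compl Metric.isClosed_closedBall.measurableSet hint]
      ring
    rw [h3]
    refine (enorm_integral_le_lintegral_enorm _).trans ?_
    rw [← lintegral_indicator Metric.isClosed_closedBall.measurableSet.compl]
    refine lintegral_mono fun w => ?_
    by_cases hw : w ∈ (Metric.closedBall (0 : Phase d) (n : ℝ))ᶜ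
    · rw [Set.indicator_of_mem hw, Set.indicator_of_mem hw, enorm_mul]
      gcongr
      exact hΓ w z
    · rw [Set.indicator_of_notMem hw, Set.indicator_of_notMem hw, zero_mul]
  refine ⟨F, fun n => memM1_of_lintegral_ne_top ((F n).memLp 2 volume) ?_, ?_, hbound⟩
  · refine ne_top_of_le_ne_top (ENNReal.mul_ne_top hfω hΓω)
      (le_trans (lintegral_mono fun z => ?_) (hyoung _ hfm))
    gcongr
    exact hbound n z
  · have htail : Tendsto (fun n : ℕ => ∫⁻ w, (Metric.closedBall (0 : Phase d) (n : ℝ))ᶜ.indicator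
        (fun w => ‖coeff f w‖ₑ) w * ENNReal.ofReal (u w)) atTop (𝓝 0) := by
      have h1 := tendsto_lintegral_of_dominated_convergence (μ := (volume : Measure (Phase d)))
        (F := fun n w => (Metric.closedBall (0 : Phase d) (n : ℝ))ᶜ.indicator
          (fun w => ‖coeff f w‖ₑ) w * ENNReal.ofReal (u w)) (f := fun _ => 0)
        (fun w => ‖coeff f w‖ₑ * ENNReal.ofReal (u w))
        (fun n => (hfm.indicator Metric.isClosed_closedBall.measurableSet.compl).mul hωm)
        (fun n => Eventually.of_forall fun w => mul_le_mul_left (Set.indicator_le_self _ _ _) _)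
        hfω (Eventually.of_forall fun w => ?_)
      · simpa using h1
      · refine tendsto_const_nhds.congr' ?_
        obtain ⟨N, hN⟩ := exists_nat_ge ‖w‖
        filter_upwards [eventually_ge_atTop N] with n hn
        rw [Set.indicator_of_notMem, zero_mul]
        have : (N : ℝ) ≤ n := by exact_mod_cast hn
        simpa using hN.trans this
    have h2 : Tendsto (fun n : ℕ => ENNReal.ofReal (gaussNorm d)⁻¹ *
        ((∫⁻ w, (Metric.closedBall (0 : Phase d) (n : ℝ))ᶜ.indicator
          (fun w => ‖coeff f w‖ₑ) w * ENNReal.ofReal (u w)) *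
          ∫⁻ z, expEnvelope (Real.exp 1) z * ENNReal.ofReal (u z))) atTop (𝓝 0) := by
      have h3 := ENNReal.Tendsto.const_mul (a := ENNReal.ofReal (gaussNorm d)⁻¹)
        (ENNReal.Tendsto.mul_const htail (Or.inr hΓω)) (Or.inr ENNReal.ofReal_ne_top)
      simpa using h3
    refine tendsto_of_tendsto_of_tendsto_of_le_of_le tendsto_const_nhds h2
      (fun n => zero_le) fun n => ?_
    simp only
    rw [m1Norm_eq]
    gcongr
    refine le_trans (lintegral_mono fun z => ?_)
      (hyoung _ (hfm.indicator Metric.isClosed_closedBall.measurableSet.compl))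
    gcongr
    exact hdiff n z

end Approximation

/-! ### Gabor matrices and coherent state matrices -/

section ModulationSpace

variable {d : ℕ}

theorem SubexpWeight.lintegral_translate_le {E : Type*} [NormedAddCommGroup E] [MeasurableSpace E]
    [BorelSpace E] {μ : Measure E} [μ.IsAddRightInvariant] {ω : E → ℝ≥0∞} (hω : SubexpWeight ω)
    (K : E → ℝ≥0∞) (a : E) : ∫⁻ x, K (x - a) * ω x ∂μ ≤ ω a * ∫⁻ x, K x * ω x ∂μ := by
  rw [← lintegral_const_mul' _ _ (hω.ne_top a),
    ← lintegral_sub_right_eq_self (fun x => ω a * (K x * ω x)) a]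
  refine lintegral_mono fun x => ?_
  calc K (x - a) * ω x ≤ K (x - a) * (ω (x - a) * ω a) := by gcongr; exact hω.le_mul_sub x a
    _ = _ := by ring

theorem memM1_add {u : Phase d → ℝ} {f g : Config d → ℂ} (hf : MemM1 u f) (hg : MemM1 u g)
    (hu : AdmissibleWeight u) : MemM1 u (f + g) := by
  have hm : Measurable fun z => ENNReal.ofReal (u z) := hu.continuous.measurable.ennreal_ofReal
  have hfm : Measurable fun z => ‖coeff f z‖ₑ := (continuous_coeff hf.1).enorm.measurable
  refine memM1_of_lintegral_ne_top (hf.1.add hg.1) (ne_top_of_le_ne_top (ENNReal.add_ne_top.2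
    ⟨lintegral_enorm_coeff_mul_ne_top hf, lintegral_enorm_coeff_mul_ne_top hg⟩) ?_)
  rw [← lintegral_add_left (hfm.fun_mul hm)]
  refine lintegral_mono fun z => ?_
  rw [← add_mul, coeff_add hf.1 hg.1]
  gcongr
  exact enorm_add_le _ _

theorem memM1_smul {u : Phase d → ℝ} {f : Config d → ℂ} (hf : MemM1 u f) (c : ℂ) :
    MemM1 u (c • f) := by
  refine memM1_of_lintegral_ne_top (hf.1.const_smul c) ?_
  simp_rw [coeff_smul hf.1, enorm_mul, mul_assoc]
  rw [lintegral_const_mul' _ _ enorm_ne_top]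
  exact ENNReal.mul_ne_top enorm_ne_top (lintegral_enorm_coeff_mul_ne_top hf)

theorem memM1_sub {u : Phase d → ℝ} {f g : Config d → ℂ} (hf : MemM1 u f) (hg : MemM1 u g)
    (hu : AdmissibleWeight u) : MemM1 u (f - g) := by
  have := memM1_add hf (memM1_smul hg (-1)) hu
  rwa [neg_one_smul, ← sub_eq_add_neg] at this

theorem memM1_zero (u : Phase d → ℝ) : MemM1 u (0 : Config d → ℂ) := by
  refine memM1_of_lintegral_ne_top MemLp.zero' ?_
  have h : ∀ z : Phase d, coeff (0 : Config d → ℂ) z = 0 := fun z => by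
    simp [coeff, stft]
  simp [h]

theorem memM1_sum {u : Phase d → ℝ} (hu : AdmissibleWeight u) {ι : Type*} (s : Finset ι)
    {f : ι → Config d → ℂ} (hf : ∀ i, MemM1 u (f i)) : MemM1 u (∑ i ∈ s, f i) := by
  classical
  induction s using Finset.induction_on with
  | empty => simpa using memM1_zero u
  | insert a s ha ih =>
    rw [Finset.sum_insert ha]
    exact memM1_add (hf a) ih hu

theorem coeff_sum_smul {ι : Type*} (s : Finset ι) {f : ι → Config d → ℂ}
    (hf : ∀ i, MemLp (f i) 2 (volume : Measure (Config d))) (c : ι → ℂ) (z : Phase d) :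
    coeff (∑ i ∈ s, c i • f i) z = ∑ i ∈ s, c i * coeff (f i) z := by
  classical
  induction s using Finset.induction_on with
  | empty => simp [coeff, stft]
  | insert a s ha ih =>
    rw [Finset.sum_insert ha, Finset.sum_insert ha, coeff_add ((hf a).const_smul _)
      (memLp_finsetSum' s fun i _ => (hf i).const_smul _), coeff_smul (hf a), ih]

namespace IsWeylExtension

variable {u : Phase d → ℝ} {σ : 𝓢'(Phase d, ℂ)} {B : (Config d → ℂ) → (Config d → ℂ) → ℂ}

theorem sub_left (hB : IsWeylExtension u σ B) {f g h : Config d → ℂ} (hf : MemM1 u f)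
    (hg : MemM1 u g) (hh : MemM1 u h) : B (f - g) h = B f h - B g h := by
  rw [sub_eq_add_neg, ← neg_one_smul ℂ g, hB.add_left _ _ _ hf (memM1_smul hg _) hh,
    hB.smul_left _ _ _ hg hh]
  ring

theorem sub_right (hB : IsWeylExtension u σ B) {f g h : Config d → ℂ} (hf : MemM1 u f)
    (hg : MemM1 u g) (hh : MemM1 u h) : B f (g - h) = B f g - B f h := by
  rw [sub_eq_add_neg, ← neg_one_smul ℂ h, hB.add_right _ _ _ hf hg (memM1_smul hh _),
    hB.smul_right _ _ _ hf hh]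
  simp
  ring

theorem sum_left (hB : IsWeylExtension u σ B) (hu : AdmissibleWeight u) {ι : Type*} (s : Finset ι)
    {f : ι → Config d → ℂ} (hf : ∀ i, MemM1 u (f i)) (c : ι → ℂ) {h : Config d → ℂ}
    (hh : MemM1 u h) : B (∑ i ∈ s, c i • f i) h = ∑ i ∈ s, c i * B (f i) h := by
  classical
  induction s using Finset.induction_on with
  | empty => simpa using hB.smul_left 0 0 h (memM1_zero u) hh
  | insert a s ha ih =>
    rw [Finset.sum_insert ha, Finset.sum_insert ha, hB.add_left _ _ _ (memM1_smul (hf a) _)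
      (memM1_sum hu s fun i => memM1_smul (hf i) _) hh, hB.smul_left _ _ _ (hf a) hh, ih]

theorem sum_right (hB : IsWeylExtension u σ B) (hu : AdmissibleWeight u) {ι : Type*} (s : Finset ι)
    {h : ι → Config d → ℂ} (hh : ∀ i, MemM1 u (h i)) (c : ι → ℂ) {f : Config d → ℂ}
    (hf : MemM1 u f) : B f (∑ i ∈ s, c i • h i) = ∑ i ∈ s, conj (c i) * B f (h i) := by
  classical
  induction s using Finset.induction_on with
  | empty => simpa using hB.smul_right 0 f 0 hf (memM1_zero u)
  | insert a s ha ih =>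
    rw [Finset.sum_insert ha, Finset.sum_insert ha, hB.add_right _ _ _ hf (memM1_smul (hh a) _)
      (memM1_sum hu s fun i => memM1_smul (hh i) _), hB.smul_right _ _ _ hf (hh a), ih]

/-- A bounded extension of the Weyl form is jointly continuous on `M¹_u`. -/
theorem tendsto (hB : IsWeylExtension u σ B) (hu : AdmissibleWeight u) {ι : Type*} {l : Filter ι}
    {F G : ι → Config d → ℂ} {f h : Config d → ℂ} (hF : ∀ i, MemM1 u (F i))
    (hG : ∀ i, MemM1 u (G i)) (hf : MemM1 u f) (hh : MemM1 u h)
    (hFf : Tendsto (fun i => m1Norm u (f - F i)) l (𝓝 0))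
    (hGh : Tendsto (fun i => m1Norm u (h - G i)) l (𝓝 0)) :
    Tendsto (fun i => B (F i) (G i)) l (𝓝 (B f h)) := by
  obtain ⟨C, hC⟩ := hB.bounded
  have key : ∀ i, ‖B (F i) (G i) - B f h‖ₑ ≤ C * m1Norm u (f - F i) * m1Norm u h +
      (C * m1Norm u f * m1Norm u (h - G i) +
        C * m1Norm u (f - F i) * m1Norm u (h - G i)) := by
    intro i
    have hfi := memM1_sub hf (hF i) hu
    have hhi := memM1_sub hh (hG i) hu
    have h1 : B (F i) (G i) - B f h = -B (f - F i) h + (-B f (h - G i) +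
        B (f - F i) (h - G i)) := by
      rw [hB.sub_left hf (hF i) hh, hB.sub_left hf (hF i) hhi, hB.sub_right hf hh (hG i),
        hB.sub_right (hF i) hh (hG i)]
      ring
    rw [h1]
    refine (enorm_add_le _ _).trans (add_le_add ?_ ((enorm_add_le _ _).trans (add_le_add ?_ ?_)))
    · rw [enorm_neg]; exact hC _ _ hfi hh
    · rw [enorm_neg]; exact hC _ _ hf hhi
    · exact hC _ _ hfi hhi
  rw [tendsto_iff_edist_tendsto_0]
  simp_rw [edist_eq_enorm_sub]
  have hCt : (C : ℝ≥0∞) ≠ ∞ := ENNReal.coe_ne_top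
  have t1 : Tendsto (fun i => C * m1Norm u (f - F i)) l (𝓝 0) := by
    simpa using ENNReal.Tendsto.const_mul (a := (C : ℝ≥0∞)) hFf (Or.inr hCt)
  have t2 : Tendsto (fun i => C * m1Norm u (f - F i) * m1Norm u h) l (𝓝 0) := by
    simpa using ENNReal.Tendsto.mul_const (b := m1Norm u h) t1 (Or.inr hh.2.ne)
  have t3 : Tendsto (fun i => C * m1Norm u f * m1Norm u (h - G i)) l (𝓝 0) := by
    simpa using ENNReal.Tendsto.const_mul (a := C * m1Norm u f) hGh
      (Or.inr (ENNReal.mul_ne_top hCt hf.2.ne))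
  have t4 : Tendsto (fun i => C * m1Norm u (f - F i) * m1Norm u (h - G i)) l (𝓝 0) := by
    simpa using ENNReal.Tendsto.mul t1 (Or.inr ENNReal.zero_ne_top) hGh
      (Or.inr ENNReal.zero_ne_top)
  have t5 := t2.add (t3.add t4)
  simp only [add_zero] at t5
  exact tendsto_of_tendsto_of_tendsto_of_le_of_le tendsto_const_nhds t5 (fun i => zero_le) key

end IsWeylExtension

/-- The modulus of the coefficients is covariant under time-frequency shifts. -/
theorem enorm_coeff_tfShift (f : Config d → ℂ) (l z : Phase d) :
    ‖coeff (tfShift l f) z‖ₑ = ‖coeff f (z - l)‖ₑ := by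
  rw [enorm_coeff, enorm_coeff]
  congr 1
  have h1 : stft (gaussianWindow d) (tfShift l f) z =
      Complex.exp (2 * Real.pi * Complex.I * ((inner ℝ (l.2 - z.2) l.1 : ℝ) : ℂ)) *
        stft (gaussianWindow d) f (z - l) := by
    rw [stft, stft, ← integral_add_right_eq_self _ l.1, ← integral_const_mul]
    refine integral_congr_ae (Eventually.of_forall fun s => ?_)
    have h2 : Complex.exp (2 * Real.pi * Complex.I * ((inner ℝ l.2 (s + l.1) : ℝ) : ℂ)) *
        Complex.exp (2 * Real.pi * Complex.I * ((-inner ℝ z.2 (s + l.1) : ℝ) : ℂ)) =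
        Complex.exp (2 * Real.pi * Complex.I * ((inner ℝ (l.2 - z.2) l.1 : ℝ) : ℂ)) *
        Complex.exp (2 * Real.pi * Complex.I * ((-inner ℝ (z.2 - l.2) s : ℝ) : ℂ)) := by
      rw [← Complex.exp_add, ← Complex.exp_add]
      congr 1
      simp only [inner_add_right, inner_sub_left]
      push_cast
      ring
    have e1 : s + l.1 - z.1 = s - (z - l).1 := by rw [Prod.fst_sub]; abel
    simp only [tfShift, add_sub_cancel_right, map_mul, conj_cexp_two_pi, e1, Prod.snd_sub]
    linear_combination (f s * conj (gaussianWindow d (s - (z - l).1))) * h2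
  rw [h1, enorm_mul, ← ofReal_norm (Complex.exp _), norm_cexp_two_pi, ENNReal.ofReal_one, one_mul]

theorem enorm_coeff_coherentFn_le (w z : Phase d) :
    ‖coeff (coherentFn w) z‖ₑ ≤ expEnvelope (Real.exp 1) (z - w) := by
  rw [coeff_coherentFn, ← inner_conj_symm, RCLike.enorm_conj]
  exact enorm_inner_coherent_coherent_le z w

theorem memM1_coherentFn {u : Phase d → ℝ} (hu : AdmissibleWeight u) (w : Phase d) :
    MemM1 u (coherentFn w) := by
  have hω := hu.subexpWeight
  refine memM1_of_lintegral_ne_top (memLp_coherentFn w) (ne_top_of_le_ne_top (ENNReal.mul_ne_top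
    (hω.ne_top w) (hω.lintegral_expEnvelope_mul_ne_top (μ := volume) (Real.exp 1)))
    (le_trans (lintegral_mono fun z => ?_) (hω.lintegral_translate_le _ w)))
  gcongr
  exact enorm_coeff_coherentFn_le w z

theorem memM1_tfShift {u : Phase d → ℝ} (hu : AdmissibleWeight u) {f : Config d → ℂ}
    (hf : MemM1 u f) (l : Phase d) : MemM1 u (tfShift l f) := by
  have hω := hu.subexpWeight
  refine memM1_of_lintegral_ne_top (memLp_tfShift hf.1 l) (ne_top_of_le_ne_top
    (ENNReal.mul_ne_top (hω.ne_top l) (lintegral_enorm_coeff_mul_ne_top hf))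
    (le_trans (lintegral_mono fun z => ?_)
      (hω.lintegral_translate_le (fun z => ‖coeff f z‖ₑ) l)))
  rw [enorm_coeff_tfShift]

/-- A moderate majorant of the coefficients of `f` (see `enorm_coeff_le_coeffEnvelope`): the
convolution of their modulus with the envelope of the Gram matrix of the coherent states. -/
noncomputable def coeffEnvelope (f : Config d → ℂ) : Phase d → ℝ≥0∞ :=
  nconv volume (fun w => ‖coeff f w‖ₑ) (expEnvelope (Real.exp 1))

theorem measurable_coeffEnvelope {f : Config d → ℂ}
    (hf : MemLp f 2 (volume : Measure (Config d))) : Measurable (coeffEnvelope f) :=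
  measurable_nconv (continuous_coeff hf).enorm.measurable (measurable_expEnvelope _)

theorem moderate_coeffEnvelope {f : Config d → ℂ}
    (hf : MemLp f 2 (volume : Measure (Config d))) : Moderate (coeffEnvelope f) :=
  Moderate.nconv (continuous_coeff hf).enorm.measurable (measurable_expEnvelope _)
    (moderate_expEnvelope (Real.exp_pos _).le)

/-- The reproducing property of the coherent states. -/
theorem enorm_coeff_le_coeffEnvelope {f : Config d → ℂ}
    (hf : MemLp f 2 (volume : Measure (Config d))) (z : Phase d) :
    ‖coeff f z‖ₑ ≤ coeffEnvelope f z := by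
  rw [coeff_eq_inner hf, (isParsevalFamily_coherent d).inner_eq_integral]
  refine (enorm_integral_le_lintegral_enorm _).trans (lintegral_mono fun w => ?_)
  simp only [coeff_eq_inner hf]
  rw [enorm_mul, RCLike.enorm_conj, mul_comm]
  gcongr
  exact enorm_inner_coherent_coherent_le z w

theorem lintegral_coeffEnvelope_ne_top {u : Phase d → ℝ} (hu : AdmissibleWeight u)
    {f : Config d → ℂ} (hf : MemM1 u f) :
    ∫⁻ z, coeffEnvelope f z * ENNReal.ofReal (u z) ≠ ∞ := by
  have hω := hu.subexpWeight
  exact ne_top_of_le_ne_top (ENNReal.mul_ne_top (lintegral_enorm_coeff_mul_ne_top hf)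
    (hω.lintegral_expEnvelope_mul_ne_top (Real.exp 1)))
    (lintegral_nconv_mul_le (continuous_coeff hf.1).enorm.measurable (measurable_expEnvelope _)
      hω.measurable hω.submul)

theorem coeffEnvelope_tfShift (f : Config d → ℂ) (l z : Phase d) :
    coeffEnvelope (tfShift l f) z = coeffEnvelope f (z - l) := by
  unfold coeffEnvelope nconv
  rw [← lintegral_sub_right_eq_self
    (fun s => ‖coeff f s‖ₑ * expEnvelope (Real.exp 1) (z - l - s)) l]
  refine lintegral_congr fun s => ?_
  simp only [enorm_coeff_tfShift]
  congr 2
  abel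

end ModulationSpace

section GaborMatrix

variable {d : ℕ}

/-- Every Gabor matrix is given by an extension of the Weyl form to some modulation space: if the
window is a Schwartz function, a polynomial weight will do. -/
theorem IsGaborMatrix.exists_extension {g : Config d → ℂ} {Λ : Submodule ℤ (Phase d)}
    {σ : 𝓢'(Phase d, ℂ)} {M : Λ → Λ → ℂ} (hM : IsGaborMatrix g Λ σ M) :
    ∃ (u : Phase d → ℝ) (B : (Config d → ℂ) → (Config d → ℂ) → ℂ),
      AdmissibleWeight u ∧ MemM1 u g ∧ IsWeylExtension u σ B ∧
      ∀ l m : Λ, M l m = B (tfShift (m : Phase d) g) (tfShift (l : Phase d) g) := by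
  rcases hM with ⟨⟨G, hG⟩, hM⟩ | h
  · obtain ⟨N, C, hC0, hC⟩ := exists_weylKernel_le σ
    have hGg : ⇑G = g := funext hG
    have hu := admissibleWeight_one_add_norm_pow (d := d) N
    have hgu : MemM1 (fun z : Phase d => (1 + ‖z‖) ^ N) g := hGg ▸ memM1_schwartz G N
    have hB := isWeylExtension_integral hu hC0 hC
    refine ⟨_, _, hu, hgu, hB, fun l m => ?_⟩
    have hS : ∀ l : Phase d, ⇑(schwartzShift l G) = tfShift l g := fun l => by
      rw [coe_schwartzShift, hGg]
    have h1 := hB.extends_schwartz (schwartzShift m G) (schwartzShift l G)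
      (memM1_schwartz _ N) (memM1_schwartz _ N)
    rw [hS, hS] at h1
    rw [h1, hM]
  · exact h

theorem IsWeylExtension.apply_coherentFn {u : Phase d → ℝ} (hu : AdmissibleWeight u)
    {σ : 𝓢'(Phase d, ℂ)} {B : (Config d → ℂ) → (Config d → ℂ) → ℂ} (hB : IsWeylExtension u σ B)
    (w z : Phase d) : B (coherentFn w) (coherentFn z) = weylKernel σ w z := by
  have hw := memM1_coherentFn hu w
  have hz := memM1_coherentFn hu z
  rw [← coe_coherentSchwartz] at hw hz
  rw [← weylForm_coherentSchwartz, ← hB.extends_schwartz _ _ hw hz, coe_coherentSchwartz,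
    coe_coherentSchwartz]

/-- The coherent states have expansions in the Gabor frame with well localised coefficients. -/
theorem exists_gabor_coeff {Λ : Submodule ℤ (Phase d)} [DiscreteTopology Λ] {g : Config d → ℂ}
    (hframe : IsGaborFrame g Λ) : ∃ c : Λ → Phase d → ℂ,
      (∀ w y, HasSum (fun l : Λ => c l w * coeff (tfShift l g) y) (coeff (coherentFn w) y)) ∧
      ∀ u : Phase d → ℝ, AdmissibleWeight u → MemM1 u g →
        ∃ D : Phase d → ℝ≥0∞, Measurable D ∧ Moderate D ∧
          ∫⁻ x, D x * ENNReal.ofReal (u x) ≠ ∞ ∧ ∀ (l : Λ) w, ‖c l w‖ₑ ≤ D (l - w) := by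
  obtain ⟨hg, A, B, hA, hAB⟩ := hframe
  set a : Λ → L2Space d := fun l => (memLp_tfShift hg (l : Phase d)).toLp _ with ha
  have hinner : ∀ (f : L2Space d) (l : Λ), inner ℂ (a l) f = stft g f (l : Phase d) := by
    intro f l
    have h := inner_toLp_tfShift (memLp_tfShift hg (l : Phase d)) (Lp.memLp f)
    rwa [Lp.toLp_coeFn] at h
  have hnorm : ∀ f : L2Space d, ∫⁻ t, ‖f t‖ₑ ^ 2 = ‖f‖ₑ ^ 2 := by
    intro f
    rw [Lp.enorm_def, IsParsevalFamily.eLpNorm_two_eq_l2norm, l2norm, ← ENNReal.rpow_ofNat,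
      ← ENNReal.rpow_mul]
    norm_num
  obtain ⟨c, hc, hD⟩ := (isParsevalFamily_coherent d).exists_dual_coeff (Real.exp_pos 1).le
    (fun z w => enorm_inner_coherent_coherent_le z w) (a := a) (A := A) (B := B) hA
    (fun f => by simpa only [hinner, hnorm] using (hAB f (Lp.memLp f)).1)
    (fun f => by simpa only [hinner, hnorm] using (hAB f (Lp.memLp f)).2)
  refine ⟨c, fun w y => ?_, fun u hu hgu => ?_⟩
  · rw [coeff_coherentFn]
    refine (hc (coherent y) w).congr_fun fun l => ?_
    rw [coeff_eq_inner (memLp_tfShift hg (l : Phase d)), mul_comm]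
  · refine hD (coeffEnvelope g) _ hu.subexpWeight (measurable_coeffEnvelope hg)
      (moderate_coeffEnvelope hg) (fun z l => ?_) (lintegral_coeffEnvelope_ne_top hu hgu)
    rw [← coeffEnvelope_tfShift, ← coeff_eq_inner (memLp_tfShift hg (l : Phase d))]
    exact enorm_coeff_le_coeffEnvelope (memLp_tfShift hg (l : Phase d)) z

/-- Partial sums of the Gabor expansion of a coherent state converge in `M¹_u`. -/
theorem tendsto_m1Norm_gabor_sum {Λ : Submodule ℤ (Phase d)} [DiscreteTopology Λ]
    {g : Config d → ℂ} {u : Phase d → ℝ} (hu : AdmissibleWeight u) (hgu : MemM1 u g)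
    {c : Λ → Phase d → ℂ} (hc : ∀ w y, HasSum (fun l : Λ => c l w * coeff (tfShift l g) y)
      (coeff (coherentFn w) y)) {D : Phase d → ℝ≥0∞} (hDm : Measurable D) (hD : Moderate D)
    (hDu : ∫⁻ x, D x * ENNReal.ofReal (u x) ≠ ∞) (hcD : ∀ (l : Λ) w, ‖c l w‖ₑ ≤ D (l - w))
    (w : Phase d) : Tendsto (fun s : Finset Λ =>
      m1Norm u (coherentFn w - ∑ l ∈ s, c l w • tfShift (l : Phase d) g)) atTop (𝓝 0) := by
  have hω := hu.subexpWeight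
  have hωm := hω.measurable
  have hgm : ∀ l : Phase d, MemLp (tfShift l g) 2 (volume : Measure (Config d)) :=
    memLp_tfShift hgu.1
  have : Countable Λ := countable_of_Lindelof_of_discrete
  set I : ℝ≥0∞ := ∫⁻ z, ‖coeff g z‖ₑ * ENNReal.ofReal (u z) with hI
  have hIt : I ≠ ∞ := lintegral_enorm_coeff_mul_ne_top hgu
  set b : Λ → ℝ≥0∞ := fun l => D (l - w) * (ENNReal.ofReal (u l) * I) with hb
  have hbt : ∑' l, b l ≠ ∞ := by
    obtain ⟨C, hC⟩ := exists_tsum_mul_weight_le volume Λ hω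
    have h1 := hC D hDm hD (-w)
    refine ne_top_of_le_ne_top (ENNReal.mul_ne_top (ENNReal.mul_ne_top ENNReal.coe_ne_top hDu)
      (ENNReal.mul_ne_top (hω.ne_top w) hIt)) (le_trans ?_ (mul_le_mul_left h1 _))
    rw [← ENNReal.tsum_mul_right]
    refine ENNReal.tsum_le_tsum fun l => ?_
    rw [hb, ← sub_eq_add_neg]
    calc D (l - w) * (ENNReal.ofReal (u l) * I)
        ≤ D (l - w) * ((ENNReal.ofReal (u (l - w)) * ENNReal.ofReal (u w)) * I) := by
          gcongr
          exact hω.le_mul_sub _ _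
      _ = _ := by ring
  have htail := ENNReal.tendsto_tsum_compl_atTop_zero hbt
  have h2 := ENNReal.Tendsto.const_mul (a := ENNReal.ofReal (gaussNorm d)⁻¹) htail
    (Or.inr ENNReal.ofReal_ne_top)
  rw [mul_zero] at h2
  refine tendsto_of_tendsto_of_tendsto_of_le_of_le tendsto_const_nhds h2 (fun s => zero_le)
    fun s => ?_
  simp only
  rw [m1Norm_eq]
  gcongr
  have h3 : ∀ y, ‖coeff (coherentFn w - ∑ l ∈ s, c l w • tfShift (l : Phase d) g) y‖ₑ ≤
      ∑' l : {l : Λ // l ∉ s}, D ((l : Λ) - w) * ‖coeff g (y - (l : Λ))‖ₑ := by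
    intro y
    have h4 : coeff (coherentFn w - ∑ l ∈ s, c l w • tfShift (l : Phase d) g) y =
        ∑' l : {l : Λ // l ∉ s}, c l w * coeff (tfShift (l : Λ) g) y := by
      have hs := memLp_finsetSum' s fun (l : Λ) _ => (hgm l).const_smul (c l w)
      rw [sub_eq_add_neg, ← neg_one_smul ℂ (∑ l ∈ s, _), coeff_add (memLp_coherentFn w)
        (hs.const_smul _), coeff_smul hs,
        coeff_sum_smul s (f := fun l : Λ => tfShift (l : Phase d) g) (fun l => hgm l),
        ← (hc w y).tsum_eq, ← (hc w y).summable.sum_add_tsum_subtype_compl s]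
      ring
    rw [h4]
    refine enorm_tsum_le_tsum_enorm.trans (ENNReal.tsum_le_tsum fun l => ?_)
    rw [enorm_mul, enorm_coeff_tfShift]
    gcongr
    exact hcD _ _
  calc ∫⁻ y, ‖coeff (coherentFn w - ∑ l ∈ s, c l w • tfShift (l : Phase d) g) y‖ₑ *
        ENNReal.ofReal (u y)
      ≤ ∫⁻ y, ∑' l : {l : Λ // l ∉ s},
          D ((l : Λ) - w) * (‖coeff g (y - (l : Λ))‖ₑ * ENNReal.ofReal (u y)) := by
        refine lintegral_mono fun y => ?_
        refine (mul_le_mul_left (h3 y) _).trans (le_of_eq ?_)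
        rw [← ENNReal.tsum_mul_right]
        simp_rw [mul_assoc]
    _ = ∑' l : {l : Λ // l ∉ s}, D ((l : Λ) - w) *
          ∫⁻ y, ‖coeff g (y - (l : Λ))‖ₑ * ENNReal.ofReal (u y) := by
        have hgc := continuous_coeff hgu.1
        have hm : ∀ l : Phase d,
            Measurable fun y => ‖coeff g (y - l)‖ₑ * ENNReal.ofReal (u y) := fun l =>
          (hgc.comp (continuous_id.sub continuous_const)).enorm.measurable.mul hωm
        rw [lintegral_tsum fun l => ((hm _).const_mul _).aemeasurable]
        refine tsum_congr fun l => ?_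
        rw [lintegral_const_mul _ (hm _)]
    _ ≤ _ := by
        refine ENNReal.tsum_le_tsum fun l => ?_
        simp only [hb]
        gcongr
        exact hω.lintegral_translate_le (fun z => ‖coeff g z‖ₑ) _

/-- If the Gabor matrix of a Weyl operator is dominated by a convolution matrix, then so is its
kernel with respect to the coherent states. -/
theorem exists_kernel_bound_of_gaborMatrix {v : Phase d → ℝ} (hv : AdmissibleWeight v)
    {Λ : Submodule ℤ (Phase d)} [DiscreteTopology Λ] {g : Config d → ℂ} (hg : MemM1 v g)
    (hframe : IsGaborFrame g Λ) : ∃ C : ℝ≥0, ∀ (σ : 𝓢'(Phase d, ℂ)) (M : Λ → Λ → ℂ),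
      IsGaborMatrix g Λ σ M → ∀ h : Λ → ℝ≥0∞, (∀ l m, ‖M l m‖ₑ ≤ h (l - m)) →
      ∃ H : Phase d → ℝ≥0∞, Measurable H ∧
        ∫⁻ x, H x * ENNReal.ofReal (v x) ≤ C * ∑' l : Λ, h l * ENNReal.ofReal (v l) ∧
        ∀ w z, ‖weylKernel σ w z‖ₑ ≤ H (z - w) := by
  have : Countable Λ := countable_of_Lindelof_of_discrete
  obtain ⟨c, hc, hcD⟩ := exists_gabor_coeff hframe
  obtain ⟨D, hDm, hD, hDv, hD'⟩ := hcD v hv hg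
  obtain ⟨b, hb⟩ := exists_tsum_mul_le_nconv (volume : Measure (Phase d)) Λ
  have hω := hv.subexpWeight
  have hωm := hω.measurable
  set I : ℝ≥0∞ := ∫⁻ x, D x * ENNReal.ofReal (v x) with hI
  set Q : Phase d → ℝ≥0∞ := nconv volume (fun x => D (-x)) D with hQ
  have hQm : Measurable Q := measurable_nconv (by fun_prop) hDm
  refine ⟨b * (I * I).toNNReal, fun σ M hM h hMh =>
    ⟨fun s => ∑' n : Λ, h n * (b * Q (n - s)), Measurable.tsum fun n => by fun_prop, ?_, ?_⟩⟩
  · have h1 : ((b * (I * I).toNNReal : ℝ≥0) : ℝ≥0∞) = b * (I * I) := by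
      rw [ENNReal.coe_mul, ENNReal.coe_toNNReal (ENNReal.mul_ne_top hDv hDv)]
    rw [h1]
    simp_rw [← ENNReal.tsum_mul_right]
    rw [lintegral_tsum fun n => by fun_prop, ← ENNReal.tsum_mul_left]
    refine ENNReal.tsum_le_tsum fun n => ?_
    have h2 : ∫⁻ x, Q (n - x) * ENNReal.ofReal (v x) ≤ ENNReal.ofReal (v n) * (I * I) := by
      calc ∫⁻ x, Q (n - x) * ENNReal.ofReal (v x)
          = ∫⁻ x, Q x * ENNReal.ofReal (v (n - x)) := by
            rw [← lintegral_sub_left_eq_self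
              (fun x => Q x * ENNReal.ofReal (v ((n : Phase d) - x))) (n : Phase d)]
            simp only [sub_sub_cancel]
        _ ≤ ∫⁻ x, ENNReal.ofReal (v n) * (Q x * ENNReal.ofReal (v x)) := by
            refine lintegral_mono fun x => ?_
            calc Q x * ENNReal.ofReal (v (n - x))
                ≤ Q x * (ENNReal.ofReal (v n) * ENNReal.ofReal (v (-x))) := by
                  gcongr
                  rw [sub_eq_add_neg]
                  exact hω.submul _ _
              _ = _ := by rw [hω.neg x]; ring
        _ = ENNReal.ofReal (v n) * ∫⁻ x, Q x * ENNReal.ofReal (v x) :=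
            lintegral_const_mul _ (hQm.mul hωm)
        _ ≤ _ := by
            gcongr
            exact hω.lintegral_nconv_neg_mul_le hDm hDm
    calc ∫⁻ x, h n * (b * Q (n - x)) * ENNReal.ofReal (v x)
        = h n * (b * ∫⁻ x, Q (n - x) * ENNReal.ofReal (v x)) := by
          simp_rw [mul_assoc]
          rw [lintegral_const_mul _ (by fun_prop), lintegral_const_mul _ (by fun_prop)]
      _ ≤ h n * (b * (ENNReal.ofReal (v n) * (I * I))) := by gcongr
      _ = _ := by ring
  · intro w z
    -- the Gabor matrix may be defined by an extension to a space `M¹_u` different from `M¹_v`; the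
    -- expansion converges there as well, while the bounds on the coefficients are those for `v`
    obtain ⟨u, B, hu, hgu, hB, hMB⟩ := hM.exists_extension
    obtain ⟨D', hDm', hDmod', hDu', hcD'⟩ := hcD u hu hgu
    have hgl : ∀ l : Λ, MemM1 u (tfShift (l : Phase d) g) := fun l => memM1_tfShift hu hgu l
    have hsum : ∀ (x : Phase d) (s : Finset Λ),
        MemM1 u (∑ l ∈ s, c l x • tfShift (l : Phase d) g) := fun x s =>
      memM1_sum hu s fun l => memM1_smul (hgl l) _
    have ht := hB.tendsto hu (hsum w) (hsum z) (memM1_coherentFn hu w) (memM1_coherentFn hu z)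
      (tendsto_m1Norm_gabor_sum hu hgu hc hDm' hDmod' hDu' hcD' w)
      (tendsto_m1Norm_gabor_sum hu hgu hc hDm' hDmod' hDu' hcD' z)
    rw [← hB.apply_coherentFn hu]
    refine le_of_tendsto ((continuous_enorm.tendsto _).comp ht) (Eventually.of_forall fun s => ?_)
    simp only [Function.comp_apply]
    rw [hB.sum_left hu s hgl _ (hsum z s)]
    simp_rw [hB.sum_right hu s hgl _ (hgl _), ← hMB]
    calc ‖∑ m ∈ s, c m w * ∑ l ∈ s, conj (c l z) * M l m‖ₑ
        ≤ ∑ m ∈ s, D (m - w) * ∑ l ∈ s, D (l - z) * h (l - m) := by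
          refine (enorm_sum_le _ _).trans (Finset.sum_le_sum fun m _ => ?_)
          rw [enorm_mul]
          refine mul_le_mul' (hD' m w) ((enorm_sum_le _ _).trans (Finset.sum_le_sum fun l _ => ?_))
          rw [enorm_mul, RCLike.enorm_conj]
          exact mul_le_mul' (hD' l z) (hMh l m)
      _ ≤ ∑' m : Λ, D (m - w) * ∑' l : Λ, D (l - z) * h (l - m) := by
          refine le_trans (Finset.sum_le_sum fun m _ => ?_) (ENNReal.sum_le_tsum s)
          gcongr
          exact ENNReal.sum_le_tsum s
      _ = ∑' m : Λ, ∑' n : Λ, h n * (D (m + -w) * D (m + (n - z))) := by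
          refine tsum_congr fun m => ?_
          rw [← ENNReal.tsum_mul_left, ← (Equiv.addRight m).tsum_eq]
          refine tsum_congr fun n => ?_
          rw [Equiv.coe_addRight, add_sub_cancel_right, ← sub_eq_add_neg,
            show ((n + m : Λ) : Phase d) - z = m + (n - z) by push_cast; abel]
          ring
      _ = ∑' n : Λ, h n * ∑' m : Λ, D (m + -w) * D (m + (n - z)) := by
          rw [ENNReal.tsum_comm]
          simp_rw [ENNReal.tsum_mul_left]
      _ ≤ _ := by
          refine ENNReal.tsum_le_tsum fun n => ?_
          gcongr
          refine (hb D D hDm hDm hD hD (-w) (n - z)).trans (le_of_eq ?_)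
          rw [hQ]
          congr 2
          abel

/-- If the kernel of a Weyl operator with respect to the coherent states is dominated by a
convolution kernel, then its Gabor matrix is dominated by a convolution matrix. -/
theorem exists_gaborMatrix_bound_of_kernel {v : Phase d → ℝ} (hv : AdmissibleWeight v)
    {Λ : Submodule ℤ (Phase d)} [DiscreteTopology Λ] {g : Config d → ℂ} (hg : MemM1 v g) :
    ∃ C : ℝ≥0, ∀ (σ : 𝓢'(Phase d, ℂ)) (M : Λ → Λ → ℂ), IsGaborMatrix g Λ σ M →
      ∀ H : Phase d → ℝ≥0∞, Measurable H → (∀ w z, ‖weylKernel σ w z‖ₑ ≤ H (z - w)) →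
      ∃ P : Λ → ℝ≥0∞, (∀ l m, ‖M l m‖ₑ ≤ P (l - m)) ∧
        ∑' l : Λ, P l * ENNReal.ofReal (v l) ≤ C * ∫⁻ x, H x * ENNReal.ofReal (v x) := by
  have hω := hv.subexpWeight
  have hωm := hω.measurable
  set K : Phase d → ℝ≥0∞ := coeffEnvelope g with hK
  have hKm : Measurable K := measurable_coeffEnvelope hg.1
  have hKmod : Moderate K := moderate_coeffEnvelope hg.1
  have hKv := lintegral_coeffEnvelope_ne_top hv hg
  have hKnm : Measurable fun x => K (-x) := by fun_prop
  set I : ℝ≥0∞ := ∫⁻ x, K x * ENNReal.ofReal (v x) with hI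
  obtain ⟨b, hb⟩ := exists_tsum_mul_weight_le (volume : Measure (Phase d)) Λ hω
  refine ⟨b * (I * I).toNNReal, fun σ M hM H hHm hH => ?_⟩
  set R : Phase d → ℝ≥0∞ := nconv volume (fun x => K (-x)) H with hR
  have hRm : Measurable R := measurable_nconv hKnm hHm
  have hRmod : Moderate R := by
    have h1 : R = nconv volume H fun x => K (-x) := funext fun y => nconv_comm _ _ _
    rw [h1]
    exact Moderate.nconv hHm hKnm hKmod.neg
  refine ⟨fun l => nconv volume K R l, fun l m => ?_, ?_⟩
  · -- approximation in the space `M¹_u` on which the entries are defined, with a majorant for the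
    -- coefficients that lies in the space belonging to `v`
    obtain ⟨u, B, hu, hgu, hB, hMB⟩ := hM.exists_extension
    obtain ⟨F, hF1, hF2, hF3⟩ := exists_schwartz_approx hu (memM1_tfShift hu hgu (m : Phase d))
    obtain ⟨G, hG1, hG2, hG3⟩ := exists_schwartz_approx hu (memM1_tfShift hu hgu (l : Phase d))
    have ht := hB.tendsto hu hF1 hG1 (memM1_tfShift hu hgu (m : Phase d))
      (memM1_tfShift hu hgu (l : Phase d)) hF2 hG2
    rw [hMB]
    refine le_of_tendsto ((continuous_enorm.tendsto _).comp ht) (Eventually.of_forall fun n => ?_)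
    simp only [Function.comp_apply]
    rw [hB.extends_schwartz _ _ (hF1 n) (hG1 n), weylForm_eq_integral]
    have hF4 : ∀ w, ‖coeff (F n) w‖ₑ ≤ K (w - m) := fun w =>
      (hF3 n w).trans (coeffEnvelope_tfShift g m w).le
    have hG4 : ∀ z, ‖coeff (G n) z‖ₑ ≤ K (z - l) := fun z =>
      (hG3 n z).trans (coeffEnvelope_tfShift g l z).le
    calc _ ≤ ∫⁻ x : Phase d × Phase d, K (x.1 - m) * K (x.2 - l) * H (x.2 - x.1)
            ∂(volume.prod volume) := by
          refine (enorm_integral_le_lintegral_enorm _).trans (lintegral_mono fun x => ?_)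
          rw [enorm_mul, enorm_mul, RCLike.enorm_conj]
          gcongr
          · exact hF4 _
          · exact hG4 _
          · exact hH _ _
      _ = ∫⁻ w, K (w - m) * ∫⁻ z, K (z - l) * H (z - w) := by
          rw [lintegral_prod _ (by fun_prop)]
          refine lintegral_congr fun w => ?_
          rw [← lintegral_const_mul _ (by fun_prop)]
          simp_rw [mul_assoc]
      _ = ∫⁻ w, K (w - m) * R (l - w) := by
          refine lintegral_congr fun w => ?_
          congr 1
          rw [hR, nconv, ← lintegral_sub_left_eq_self
            (fun s => K (-s) * H ((l : Phase d) - w - s)) (l : Phase d)]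
          refine lintegral_congr fun z => ?_
          congr 2 <;> abel
      _ = _ := by
          unfold nconv
          rw [← lintegral_sub_right_eq_self
            (fun s => K s * R ((l - m : Λ) - s)) (m : Phase d)]
          refine lintegral_congr fun w => ?_
          congr 2
          push_cast
          abel
  · have h1 : ((b * (I * I).toNNReal : ℝ≥0) : ℝ≥0∞) = b * (I * I) := by
      rw [ENNReal.coe_mul, ENNReal.coe_toNNReal (ENNReal.mul_ne_top hKv hKv)]
    have h2 := hb (nconv volume K R) (measurable_nconv hKm hRm) (Moderate.nconv hKm hRm hRmod) 0
    simp only [add_zero] at h2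
    refine h2.trans ?_
    rw [h1, mul_assoc, mul_assoc]
    gcongr
    refine (lintegral_nconv_mul_le hKm hRm hωm hω.submul).trans ?_
    gcongr
    exact hω.lintegral_nconv_neg_mul_le hKm hHm

end GaborMatrix

/-! ### Change of window for symbols -/

section WindowChange

variable {d : ℕ}

/-- The pairing is antilinear in the test function, which turns `ζ` into `-ζ`. -/
theorem symbolStft_eq (σ : 𝓢'(Phase d, ℂ)) (z ζ : Phase d) :
    symbolStft σ z ζ = σ (symbolShiftSchwartz z (-ζ) (phaseGaussian d Real.pi_pos)) := by
  refine distPairing_eq σ _ _ fun p => ?_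
  rw [coe_symbolShiftSchwartz]
  simp only [symbolShift, map_mul, conj_cexp_two_pi, phaseGaussian_apply, gaussianSymbol,
    Complex.conj_ofReal, Prod.fst_neg, Prod.snd_neg, inner_neg_left, neg_add]

/-- Up to a constant, the modulus of the kernel in coherent states is that of the short-time Fourier
transform of the symbol, with the window `e^{-2π|p|²}`, at the midpoint of the two states. -/
theorem enorm_weylKernel (σ : 𝓢'(Phase d, ℂ)) (w z : Phase d) :
    ‖weylKernel σ w z‖ₑ = ENNReal.ofReal ((gaussConst d)⁻¹ * (gaussConst d)⁻¹) *
      ‖σ (symbolShiftSchwartz ((1 / 2 : ℝ) • (w + z)) (wignerFreq w z)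
        (phaseGaussian d Real.two_pi_pos))‖ₑ := by
  have hg := gaussConst_pos d
  rw [weylKernel, coherentWigner, map_smul, smul_eq_mul, enorm_mul]
  congr 1
  rw [← ofReal_norm, norm_mul, norm_cexp_two_pi, mul_one, ← Complex.ofReal_pow, gaussNorm_sq,
    ← Complex.ofReal_inv, ← Complex.ofReal_mul, Complex.norm_real,
    Real.norm_of_nonneg (by positivity)]

/-- The Fourier transform of a Gaussian on the time-frequency plane. -/
theorem integral_phase_gaussian_mul_cexp {b : ℝ} (hb : 0 < b) (p : Phase d) :
    ∫ η : Phase d, ((Real.exp (-b * (‖η.1‖ ^ 2 + ‖η.2‖ ^ 2)) : ℝ) : ℂ) *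
        Complex.exp (2 * Real.pi * Complex.I *
          ((inner ℝ η.1 p.1 + inner ℝ η.2 p.2 : ℝ) : ℂ)) =
      ((((Real.pi / b) ^ ((d : ℝ) / 2)) ^ 2 : ℝ) : ℂ) *
        ((Real.exp (-(Real.pi ^ 2 / b) * (‖p.1‖ ^ 2 + ‖p.2‖ ^ 2)) : ℝ) : ℂ) := by
  have h1 : ∀ η : Phase d, ((Real.exp (-b * (‖η.1‖ ^ 2 + ‖η.2‖ ^ 2)) : ℝ) : ℂ) *
        Complex.exp (2 * Real.pi * Complex.I *
          ((inner ℝ η.1 p.1 + inner ℝ η.2 p.2 : ℝ) : ℂ)) =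
      (((Real.exp (-(b * ‖η.1‖ ^ 2)) : ℝ) : ℂ) *
        Complex.exp (2 * Real.pi * Complex.I * ((inner ℝ p.1 η.1 : ℝ) : ℂ))) *
      (((Real.exp (-(b * ‖η.2‖ ^ 2)) : ℝ) : ℂ) *
        Complex.exp (2 * Real.pi * Complex.I * ((inner ℝ p.2 η.2 : ℝ) : ℂ))) := by
    intro η
    rw [mul_mul_mul_comm, ← Complex.exp_add, ← Complex.ofReal_mul, ← Real.exp_add,
      real_inner_comm p.1, real_inner_comm p.2]
    congr 2
    · congr 2
      ring
    · push_cast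
      ring
  simp_rw [h1]
  rw [Measure.volume_eq_prod, integral_prod_mul (fun t : Config d =>
      ((Real.exp (-(b * ‖t‖ ^ 2)) : ℝ) : ℂ) *
        Complex.exp (2 * Real.pi * Complex.I * ((inner ℝ p.1 t : ℝ) : ℂ)))
    (fun t : Config d => ((Real.exp (-(b * ‖t‖ ^ 2)) : ℝ) : ℂ) *
        Complex.exp (2 * Real.pi * Complex.I * ((inner ℝ p.2 t : ℝ) : ℂ))),
    integral_gaussian_mul_cexp hb, integral_gaussian_mul_cexp hb]
  have h2 : Real.exp (-(Real.pi ^ 2 / b) * (‖p.1‖ ^ 2 + ‖p.2‖ ^ 2)) =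
      Real.exp (-(Real.pi ^ 2 * ‖p.1‖ ^ 2 / b)) * Real.exp (-(Real.pi ^ 2 * ‖p.2‖ ^ 2 / b)) := by
    rw [← Real.exp_add]
    congr 1
    ring
  rw [h2]
  push_cast
  ring

theorem norm_phaseGaussian {b : ℝ} (hb : 0 < b) (p : Phase d) :
    ‖phaseGaussian d hb p‖ = Real.exp (-b * (‖p.1‖ ^ 2 + ‖p.2‖ ^ 2)) := by
  rw [phaseGaussian_apply, Complex.norm_real, Real.norm_of_nonneg (Real.exp_pos _).le]

theorem integrable_one_add_norm_pow_mul_schwartz (F : 𝓢(Phase d, ℂ)) (N : ℕ) :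
    Integrable fun z => (1 + ‖z‖) ^ N * ‖F z‖ := by
  set M : ℕ := Module.finrank ℝ (Phase d) + 1 with hM
  obtain ⟨C, -, hC⟩ := F.exists_one_add_norm_pow_mul_le (N + M)
  have h1 : Integrable fun z : Phase d => (1 + ‖z‖) ^ (-(M : ℝ)) :=
    integrable_one_add_norm (by rw [hM]; push_cast; linarith)
  refine (h1.const_mul C).mono' (by fun_prop) (Eventually.of_forall fun z => ?_)
  rw [Real.norm_of_nonneg (by positivity), Real.rpow_neg (by positivity), Real.rpow_natCast,
    ← div_eq_mul_inv, le_div_iff₀ (by positivity)]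
  calc (1 + ‖z‖) ^ N * ‖F z‖ * (1 + ‖z‖) ^ M = (1 + ‖z‖) ^ (N + M) * ‖F z‖ := by
        rw [pow_add]; ring
    _ ≤ _ := hC z

/-- A superposition of time-frequency shifts of a Schwartz function, with rapidly decaying
coefficients, under a tempered distribution. -/
theorem enorm_superposition_le {F G R : 𝓢(Phase d, ℂ)} (σ : 𝓢'(Phase d, ℂ))
    {a b : Phase d → Phase d} (ha : Continuous a) (hb : Continuous b) {A : ℝ}
    (hA : ∀ η, 1 + ‖a η‖ ≤ A * (1 + ‖η‖)) (hB : ∀ η, 1 + ‖b η‖ ≤ A * (1 + ‖η‖))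
    {θ : Phase d → ℂ} (hθ : Continuous θ) (hθG : ∀ η, ‖θ η‖ = ‖G η‖)
    (hR : ∀ p, R p = ∫ η, θ η * symbolShift (a η) (b η) F p) :
    ‖σ R‖ₑ ≤ ∫⁻ η, ‖G η‖ₑ * ‖σ (symbolShiftSchwartz (a η) (b η) F)‖ₑ := by
  set ψ : Phase d → 𝓢(Phase d, ℂ) := fun η => θ η • symbolShiftSchwartz (a η) (b η) F with hψ
  have hab : Continuous fun η => (a η, b η) := ha.prodMk hb
  have hs : Continuous fun η => symbolShiftSchwartz (a η) (b η) F := by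
    have h1 := (continuous_symbolShiftSchwartz F).comp hab
    simpa only [Function.comp_def] using h1
  have hψc : Continuous ψ := hθ.smul hs
  have hint : ∀ k n, Integrable fun η => SchwartzMap.seminorm ℂ k n (ψ η) := by
    intro k n
    obtain ⟨C, hC0, hC⟩ := exists_seminorm_symbolShiftSchwartz_le F k n
    have h2 : Continuous fun x => SchwartzMap.seminorm ℂ k n (ψ x) :=
      ((schwartz_withSeminorms ℂ (Phase d) ℂ).continuous_seminorm (k, n)).comp hψc
    refine ((integrable_one_add_norm_pow_mul_schwartz G (k + n)).const_mul
      (C * (A ^ k * A ^ n))).mono' h2.aestronglyMeasurable (Eventually.of_forall fun η => ?_)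
    rw [Real.norm_of_nonneg (apply_nonneg _ _), hψ]
    simp only [map_smul_eq_mul, hθG]
    calc ‖G η‖ * SchwartzMap.seminorm ℂ k n (symbolShiftSchwartz (a η) (b η) F)
        ≤ ‖G η‖ * (C * ((A * (1 + ‖η‖)) ^ k * (A * (1 + ‖η‖)) ^ n)) := by
          gcongr
          have hA0 : 0 ≤ A * (1 + ‖η‖) := le_trans (by positivity) (hA η)
          exact (hC _ _).trans (mul_le_mul_of_nonneg_left (mul_le_mul
            (pow_le_pow_left₀ (by positivity) (hA η) k) (pow_le_pow_left₀ (by positivity) (hB η) n)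
            (by positivity) (by positivity)) hC0)
      _ = _ := by rw [mul_pow, mul_pow, pow_add]; ring
  obtain ⟨I, hI, hσ⟩ := SchwartzMap.exists_integral_param hψc hint
  have hIR : I = R := by
    ext p
    rw [hI, hR]
    refine integral_congr_ae (Eventually.of_forall fun η => ?_)
    simp only [hψ, _root_.smul_apply, smul_eq_mul, coe_symbolShiftSchwartz]
  rw [← hIR, hσ]
  refine (enorm_integral_le_lintegral_enorm _).trans (lintegral_mono fun η => ?_)
  simp only [hψ, map_smul, smul_eq_mul, enorm_mul]
  rw [← ofReal_norm (θ η), hθG, ofReal_norm]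

/-- The Gaussian `e^{-2π|p|²}` is a superposition of modulations of `e^{-π|p|²}`, since the latter
is its own Fourier transform. -/
theorem enorm_narrow_window_le (σ : 𝓢'(Phase d, ℂ)) (x ζ : Phase d) :
    ‖σ (symbolShiftSchwartz x ζ (phaseGaussian d Real.two_pi_pos))‖ₑ ≤
      ∫⁻ η, ‖phaseGaussian d Real.pi_pos η‖ₑ *
        ‖σ (symbolShiftSchwartz x (ζ + η) (phaseGaussian d Real.pi_pos))‖ₑ := by
  refine enorm_superposition_le σ (a := fun _ => x) (b := fun η => ζ + η) (A := 1 + ‖x‖ + ‖ζ‖)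
    continuous_const (by fun_prop) (fun η => ?_) (fun η => ?_)
    (θ := fun η => phaseGaussian d Real.pi_pos η * Complex.exp (2 * Real.pi * Complex.I *
      ((-(inner ℝ η.1 x.1 + inner ℝ η.2 x.2) : ℝ) : ℂ)))
    (by fun_prop) (fun η => by rw [norm_mul, norm_cexp_two_pi, mul_one]) fun p => ?_
  · nlinarith [norm_nonneg x, norm_nonneg ζ, norm_nonneg η]
  · nlinarith [norm_nonneg x, norm_nonneg ζ, norm_nonneg η, norm_add_le ζ η]
  · have h := integral_phase_gaussian_mul_cexp Real.pi_pos (p - x)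
    rw [div_self Real.pi_ne_zero, Real.one_rpow, one_pow, Complex.ofReal_one, one_mul] at h
    have h1 : ∀ η : Phase d, (phaseGaussian d Real.pi_pos η * Complex.exp (2 * Real.pi * Complex.I *
        ((-(inner ℝ η.1 x.1 + inner ℝ η.2 x.2) : ℝ) : ℂ))) *
        symbolShift x (ζ + η) (phaseGaussian d Real.pi_pos) p =
        (Complex.exp (2 * Real.pi * Complex.I *
          ((inner ℝ ζ.1 p.1 + inner ℝ ζ.2 p.2 : ℝ) : ℂ)) *
          phaseGaussian d Real.pi_pos (p - x)) *
        (((Real.exp (-Real.pi * (‖η.1‖ ^ 2 + ‖η.2‖ ^ 2)) : ℝ) : ℂ) *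
        Complex.exp (2 * Real.pi * Complex.I *
          ((inner ℝ η.1 (p - x).1 + inner ℝ η.2 (p - x).2 : ℝ) : ℂ))) := by
      intro η
      have h2 : Complex.exp (2 * Real.pi * Complex.I *
          ((-(inner ℝ η.1 x.1 + inner ℝ η.2 x.2) : ℝ) : ℂ)) *
          Complex.exp (2 * Real.pi * Complex.I *
            ((inner ℝ (ζ + η).1 p.1 + inner ℝ (ζ + η).2 p.2 : ℝ) : ℂ)) =
          Complex.exp (2 * Real.pi * Complex.I *
            ((inner ℝ ζ.1 p.1 + inner ℝ ζ.2 p.2 : ℝ) : ℂ)) *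
          Complex.exp (2 * Real.pi * Complex.I *
            ((inner ℝ η.1 (p - x).1 + inner ℝ η.2 (p - x).2 : ℝ) : ℂ)) := by
        rw [← Complex.exp_add, ← Complex.exp_add]
        congr 1
        simp only [Prod.fst_add, Prod.snd_add, Prod.fst_sub, Prod.snd_sub, inner_add_left,
          inner_sub_right]
        push_cast
        ring
      simp only [symbolShift]
      rw [phaseGaussian_apply _ η]
      linear_combination (((Real.exp (-Real.pi * (‖η.1‖ ^ 2 + ‖η.2‖ ^ 2)) : ℝ) : ℂ) *
        phaseGaussian d Real.pi_pos (p - x)) * h2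
    simp_rw [h1]
    rw [integral_const_mul, h, coe_symbolShiftSchwartz, symbolShift, phaseGaussian_apply,
      phaseGaussian_apply, mul_assoc (Complex.exp _), ← Complex.ofReal_mul, ← Real.exp_add]
    congr 3
    field_simp
    ring

/-- The Gaussian `e^{-π|p|²}` is a superposition of translates of `e^{-2π|p|²}`, being a multiple
of the convolution of the latter with itself. -/
theorem enorm_wide_window_le (σ : 𝓢'(Phase d, ℂ)) (x ζ : Phase d) :
    ENNReal.ofReal (((1 / 4 : ℝ) ^ ((d : ℝ) / 2)) ^ 2) *
        ‖σ (symbolShiftSchwartz x ζ (phaseGaussian d Real.pi_pos))‖ₑ ≤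
      ∫⁻ η, ‖phaseGaussian d Real.two_pi_pos η‖ₑ *
        ‖σ (symbolShiftSchwartz (x + η) ζ (phaseGaussian d Real.two_pi_pos))‖ₑ := by
  have h4 : (0 : ℝ) < 4 * Real.pi := by positivity
  set c : ℝ := ((1 / 4 : ℝ) ^ ((d : ℝ) / 2)) ^ 2 with hc
  have hc0 : 0 < c := by positivity
  have h0 : ENNReal.ofReal c * ‖σ (symbolShiftSchwartz x ζ (phaseGaussian d Real.pi_pos))‖ₑ =
      ‖σ ((c : ℂ) • symbolShiftSchwartz x ζ (phaseGaussian d Real.pi_pos))‖ₑ := by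
    rw [map_smul, smul_eq_mul, enorm_mul, ← ofReal_norm (c : ℂ), Complex.norm_real,
      Real.norm_of_nonneg hc0.le]
  rw [h0]
  refine enorm_superposition_le σ (a := fun η => x + η) (b := fun _ => ζ) (A := 1 + ‖x‖ + ‖ζ‖)
    (by fun_prop) continuous_const (fun η => ?_) (fun η => ?_)
    (θ := phaseGaussian d Real.two_pi_pos) (by fun_prop) (fun η => rfl) fun p => ?_
  · nlinarith [norm_nonneg x, norm_nonneg ζ, norm_nonneg η, norm_add_le x η]
  · nlinarith [norm_nonneg x, norm_nonneg ζ, norm_nonneg η]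
  · set q : Phase d := p - x with hq
    have h1 : ∀ η : Phase d, phaseGaussian d Real.two_pi_pos η *
        symbolShift (x + η) ζ (phaseGaussian d Real.two_pi_pos) p =
        (Complex.exp (2 * Real.pi * Complex.I *
          ((inner ℝ ζ.1 p.1 + inner ℝ ζ.2 p.2 : ℝ) : ℂ)) * phaseGaussian d Real.pi_pos q) *
          phaseGaussian d h4 (η - (1 / 2 : ℝ) • q) := by
      intro η
      have e1 : p - (x + η) = q - η := by rw [hq]; abel
      have e2 : ∀ s t : Config d, 2 * (‖t‖ ^ 2 + ‖s - t‖ ^ 2) =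
          ‖s‖ ^ 2 + 4 * ‖t - (1 / 2 : ℝ) • s‖ ^ 2 := by
        intro s t
        rw [norm_sub_sq_real, norm_sub_sq_real, inner_smul_right, norm_smul, mul_pow,
          real_inner_comm s t]
        norm_num
        ring
      have e3 : Real.exp (-(2 * Real.pi) * (‖η.1‖ ^ 2 + ‖η.2‖ ^ 2)) *
          Real.exp (-(2 * Real.pi) * (‖(q - η).1‖ ^ 2 + ‖(q - η).2‖ ^ 2)) =
          Real.exp (-Real.pi * (‖q.1‖ ^ 2 + ‖q.2‖ ^ 2)) *
          Real.exp (-(4 * Real.pi) * (‖(η - (1 / 2 : ℝ) • q).1‖ ^ 2 +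
            ‖(η - (1 / 2 : ℝ) • q).2‖ ^ 2)) := by
        rw [← Real.exp_add, ← Real.exp_add]
        congr 1
        have f1 := e2 q.1 η.1
        have f2 := e2 q.2 η.2
        simp only [Prod.fst_sub, Prod.snd_sub, Prod.smul_fst, Prod.smul_snd]
        linear_combination (-Real.pi) * f1 + (-Real.pi) * f2
      have e4 := congrArg (fun x : ℝ => (x : ℂ)) e3
      simp only [Complex.ofReal_mul] at e4
      simp only [symbolShift, e1, phaseGaussian_apply]
      linear_combination (Complex.exp (2 * Real.pi * Complex.I *
          ((inner ℝ ζ.1 p.1 + inner ℝ ζ.2 p.2 : ℝ) : ℂ))) * e4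
    have h2 : ∫ η, phaseGaussian d h4 (η - (1 / 2 : ℝ) • q) = (c : ℂ) := by
      rw [integral_sub_right_eq_self (fun η => phaseGaussian d h4 η)]
      have h3 := integral_phase_gaussian_mul_cexp (d := d) h4 0
      have h5 : Real.pi / (4 * Real.pi) = 1 / 4 := by field_simp
      simp only [Prod.fst_zero, Prod.snd_zero, inner_zero_right, add_zero, Complex.ofReal_zero,
        mul_zero, Complex.exp_zero, mul_one, norm_zero, h5] at h3
      simp_rw [phaseGaussian_apply]
      rw [h3]
      simp [hc]
    simp_rw [h1]
    rw [integral_const_mul, h2, _root_.smul_apply, coe_symbolShiftSchwartz, symbolShift,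
      smul_eq_mul]
    ring

/-- The symplectic rotation preserves the Lebesgue measure. -/
theorem lintegral_comp_jInv {F : Phase d → ℝ≥0∞} (hF : Measurable F) :
    ∫⁻ ζ, F (jInv ζ) = ∫⁻ z, F z := by
  have hj : Measurable (jInv (d := d)) := by unfold jInv; fun_prop
  have h1 : ∫⁻ ζ, F (jInv ζ) = ∫⁻ x : Config d, ∫⁻ ω : Config d, F (-ω, x) :=
    lintegral_phase (hF.comp hj)
  rw [h1, lintegral_phase hF, lintegral_lintegral_swap (by fun_prop)]
  exact lintegral_neg_eq_self (fun y : Config d => ∫⁻ x : Config d, F (y, x))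

end WindowChange

/-! ### The Sjöstrand class and convolution-dominated matrices -/

section Sjostrand

variable {d : ℕ}

/-- The integrand `sup_z |V_Φ σ(z, ζ)|` of the Sjöstrand norm. -/
noncomputable def sjostrandSup (σ : 𝓢'(Phase d, ℂ)) (ζ : Phase d) : ℝ≥0∞ :=
  ⨆ z : Phase d, ‖symbolStft σ z ζ‖ₑ

/-- The integrand of the Sjöstrand norm is lower semicontinuous. -/
theorem measurable_sjostrandSup (σ : 𝓢'(Phase d, ℂ)) : Measurable (sjostrandSup σ) := by
  have h : LowerSemicontinuous (sjostrandSup σ) := by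
    refine lowerSemicontinuous_iSup fun z => Continuous.lowerSemicontinuous ?_
    simp_rw [symbolStft_eq]
    have h0 : Continuous fun ζ : Phase d => ((z, -ζ) : Phase d × Phase d) := by fun_prop
    have h1 := (continuous_symbolShiftSchwartz (phaseGaussian d Real.pi_pos)).comp h0
    have h2 := ((map_continuous σ).comp h1).enorm
    simpa only [Function.comp_def] using h2
  exact h.measurable

theorem measurable_jInv : Measurable (jInv (d := d)) := by unfold jInv; fun_prop

theorem jInv_add (x y : Phase d) : jInv (x + y) = jInv x + jInv y := by
  simp only [jInv, Prod.fst_add, Prod.snd_add, neg_add, Prod.mk_add_mk]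

theorem enorm_phaseGaussian_pi_le_expEnvelope (η : Phase d) :
    ‖phaseGaussian d Real.pi_pos η‖ₑ ≤ expEnvelope (Real.exp 1) η := by
  rw [← ofReal_norm, norm_phaseGaussian, expEnvelope]
  refine ENNReal.ofReal_le_ofReal ?_
  rw [← Real.exp_add]
  refine Real.exp_le_exp.2 ?_
  have h1 : ‖η‖ ^ 2 ≤ ‖η.1‖ ^ 2 + ‖η.2‖ ^ 2 := by
    rw [Prod.norm_def]
    rcases max_choice ‖η.1‖ ‖η.2‖ with h | h <;> rw [h] <;> simp
  nlinarith [sq_nonneg (‖η‖ - 1), norm_nonneg η, Real.pi_gt_three]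

/-- For a symbol in the Sjöstrand class, the matrix of the Weyl operator with respect to the
coherent states is dominated by a convolution kernel. -/
theorem exists_kernel_bound_of_sjostrand {v : Phase d → ℝ} (hv : AdmissibleWeight v) :
    ∃ C C' : ℝ≥0, ∀ σ : 𝓢'(Phase d, ℂ), ∃ H : Phase d → ℝ≥0∞, Measurable H ∧
      (∀ w z, ‖weylKernel σ w z‖ₑ ≤ H (z - w)) ∧
      ∫⁻ x, H x * ENNReal.ofReal (v x) ≤ C * sjostrandNorm (fun ζ => v (jInv ζ)) σ ∧
      ∀ x, H x ≤ C' * sjostrandNorm (fun ζ => v (jInv ζ)) σ := by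
  have hω := hv.subexpWeight
  have hωm := hω.measurable
  have hjm := measurable_jInv (d := d)
  have hg := gaussConst_pos d
  set c : ℝ≥0∞ := ENNReal.ofReal ((gaussConst d)⁻¹ * (gaussConst d)⁻¹) with hc
  have hct : c ≠ ∞ := ENNReal.ofReal_ne_top
  set Γ : Phase d → ℝ≥0∞ := expEnvelope (Real.exp 1) with hΓ
  have hΓm : Measurable Γ := measurable_expEnvelope _
  set ω' : Phase d → ℝ≥0∞ := fun ζ => ENNReal.ofReal (v (jInv ζ)) with hω'
  have hω'm : Measurable ω' := hωm.comp hjm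
  have hω'sub : ∀ x y, ω' (x + y) ≤ ω' x * ω' y := fun x y => by
    simp only [hω', jInv_add]
    exact hω.submul _ _
  set I : ℝ≥0∞ := ∫⁻ ζ, Γ ζ * ω' ζ with hI
  have hIt : I ≠ ∞ := by
    have h1 : ∀ ζ : Phase d, Γ ζ = Γ (jInv ζ) := by
      intro ζ
      rw [hΓ, expEnvelope, expEnvelope, jInv, Prod.norm_def, Prod.norm_def, norm_neg, max_comm]
    have h2 : I = ∫⁻ x, Γ x * ENNReal.ofReal (v x) := by
      rw [← lintegral_comp_jInv (by fun_prop)]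
      exact lintegral_congr fun ζ => by rw [← h1]
    rw [h2]
    exact hω.lintegral_expEnvelope_mul_ne_top _
  have hΓb : ∀ s, Γ s ≤ ENNReal.ofReal (Real.exp 1) := fun s => by
    rw [hΓ, expEnvelope]
    refine ENNReal.ofReal_le_ofReal (mul_le_of_le_one_right (Real.exp_pos 1).le ?_)
    rw [Real.exp_le_one_iff]
    simp
  refine ⟨(c * I).toNNReal, (c * ENNReal.ofReal (Real.exp 1)).toNNReal, fun σ => ?_⟩
  set S := sjostrandSup σ with hS
  have hSm : Measurable S := measurable_sjostrandSup σ
  have hnorm : sjostrandNorm (fun ζ => v (jInv ζ)) σ = ∫⁻ ζ, S ζ * ω' ζ := rfl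
  set j : Phase d → Phase d := fun x => (x.2, -x.1) with hj
  have hjmeas : Measurable j := by fun_prop
  have hjinv : ∀ x, jInv (j x) = x := fun x => by simp [jInv, hj]
  have hjinv' : ∀ x, j (jInv x) = x := fun x => by simp [jInv, hj]
  have hPm : Measurable (nconv volume Γ S) := measurable_nconv hΓm hSm
  refine ⟨fun x => c * nconv volume Γ S (j x), by fun_prop, fun w z => ?_, ?_, fun x => ?_⟩
  · rw [enorm_weylKernel]
    refine mul_le_mul_right ?_ c
    refine (enorm_narrow_window_le σ _ _).trans (lintegral_mono fun η => ?_)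
    refine mul_le_mul' (enorm_phaseGaussian_pi_le_expEnvelope η) ?_
    refine le_trans (le_of_eq ?_) (le_iSup (fun y => ‖symbolStft σ y (j (z - w) - η)‖ₑ)
      ((1 / 2 : ℝ) • (w + z)))
    simp only [symbolStft_eq]
    congr 3
    rw [hj, wignerFreq]
    ext1
    · simp only [Prod.fst_add, Prod.fst_neg, Prod.fst_sub, Prod.snd_sub]
      abel
    · simp only [Prod.snd_add, Prod.snd_neg, Prod.fst_sub, Prod.snd_sub]
      abel
  · rw [ENNReal.coe_toNNReal (ENNReal.mul_ne_top hct hIt), hnorm, mul_assoc]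
    simp_rw [mul_assoc]
    rw [lintegral_const_mul' _ _ hct, ← lintegral_comp_jInv (by fun_prop)]
    gcongr
    simp_rw [hjinv']
    exact lintegral_nconv_mul_le hΓm hSm hω'm hω'sub
  · rw [ENNReal.coe_toNNReal (ENNReal.mul_ne_top hct ENNReal.ofReal_ne_top), hnorm, mul_assoc]
    refine mul_le_mul_right ?_ c
    calc nconv volume Γ S (j x) ≤ ∫⁻ s, ENNReal.ofReal (Real.exp 1) * S (j x - s) :=
          lintegral_mono fun s => mul_le_mul_left (hΓb s) _
      _ = ENNReal.ofReal (Real.exp 1) * ∫⁻ s, S s := by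
          rw [lintegral_const_mul' _ _ ENNReal.ofReal_ne_top, lintegral_sub_left_eq_self]
      _ ≤ _ := by
          gcongr with ζ
          have : (1 : ℝ≥0∞) ≤ ω' ζ := hω.one_le _
          simpa using mul_le_mul_right this (S ζ)

/-- If the matrix of the Weyl operator with respect to the coherent states is dominated by a
convolution kernel, then the symbol is in the Sjöstrand class. -/
theorem exists_sjostrandNorm_le {v : Phase d → ℝ} (hv : AdmissibleWeight v) :
    ∃ C : ℝ≥0, ∀ (σ : 𝓢'(Phase d, ℂ)) (H : Phase d → ℝ≥0∞), Measurable H →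
      (∀ w z, ‖weylKernel σ w z‖ₑ ≤ H (z - w)) →
      sjostrandNorm (fun ζ => v (jInv ζ)) σ ≤ C * ∫⁻ x, H x * ENNReal.ofReal (v x) := by
  have hωm := hv.subexpWeight.measurable
  have hg := gaussConst_pos d
  set c : ℝ≥0∞ := ENNReal.ofReal ((gaussConst d)⁻¹ * (gaussConst d)⁻¹) with hc
  have hc0 : c ≠ 0 := by
    rw [hc, ne_eq, ENNReal.ofReal_eq_zero, not_le]
    positivity
  have hct : c ≠ ∞ := ENNReal.ofReal_ne_top
  set b : ℝ≥0∞ := ENNReal.ofReal (((1 / 4 : ℝ) ^ ((d : ℝ) / 2)) ^ 2) with hb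
  have hb0 : b ≠ 0 := by
    rw [hb, ne_eq, ENNReal.ofReal_eq_zero, not_le]
    positivity
  have hbt : b ≠ ∞ := ENNReal.ofReal_ne_top
  set I : ℝ≥0∞ := ∫⁻ η, ‖phaseGaussian d Real.two_pi_pos η‖ₑ with hI
  have hIt : I ≠ ∞ := ((phaseGaussian d Real.two_pi_pos).integrable).hasFiniteIntegral.ne
  have hCt : b⁻¹ * (I * c⁻¹) ≠ ∞ := ENNReal.mul_ne_top (ENNReal.inv_ne_top.2 hb0)
    (ENNReal.mul_ne_top hIt (ENNReal.inv_ne_top.2 hc0))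
  refine ⟨(b⁻¹ * (I * c⁻¹)).toNNReal, fun σ H hHm hH => ?_⟩
  rw [ENNReal.coe_toNNReal hCt]
  have h1 : ∀ x ζ : Phase d,
      ‖σ (symbolShiftSchwartz x (-ζ) (phaseGaussian d Real.two_pi_pos))‖ₑ ≤
        c⁻¹ * H (jInv ζ) := by
    intro x ζ
    -- the coherent states whose Wigner distribution is centred at `x` with frequency `-ζ`
    have h2 := hH (x - (1 / 2 : ℝ) • jInv ζ) (x + (1 / 2 : ℝ) • jInv ζ)
    have e1 : (1 / 2 : ℝ) • (x - (1 / 2 : ℝ) • jInv ζ + (x + (1 / 2 : ℝ) • jInv ζ)) = x := by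
      module
    have e2 : x + (1 / 2 : ℝ) • jInv ζ - (x - (1 / 2 : ℝ) • jInv ζ) = jInv ζ := by module
    have e3 : wignerFreq (x - (1 / 2 : ℝ) • jInv ζ) (x + (1 / 2 : ℝ) • jInv ζ) = -ζ := by
      have e4 : ∀ w z : Phase d, wignerFreq w z = (-(z - w).2, (z - w).1) := fun w z => by
        simp [wignerFreq]
      rw [e4, e2]
      rfl
    rw [enorm_weylKernel, e1, e2, e3] at h2
    rwa [← ENNReal.mul_le_iff_le_inv hc0 hct]
  have h3 : ∀ ζ, sjostrandSup σ ζ ≤ b⁻¹ * (I * c⁻¹) * H (jInv ζ) := by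
    intro ζ
    refine iSup_le fun x => ?_
    rw [symbolStft_eq, mul_assoc, ← ENNReal.mul_le_iff_le_inv hb0 hbt, mul_assoc, hI,
      ← lintegral_mul_const _ (phaseGaussian d Real.two_pi_pos).continuous.enorm.measurable]
    refine (enorm_wide_window_le σ x (-ζ)).trans (lintegral_mono fun η => ?_)
    gcongr
    exact h1 _ _
  calc sjostrandNorm (fun ζ => v (jInv ζ)) σ
      ≤ ∫⁻ ζ, b⁻¹ * (I * c⁻¹) * (H (jInv ζ) * ENNReal.ofReal (v (jInv ζ))) := by
        refine lintegral_mono fun ζ => ?_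
        rw [← mul_assoc]
        exact mul_le_mul_left (h3 ζ) _
    _ = _ := by
        rw [lintegral_const_mul' _ _ hCt,
          lintegral_comp_jInv (F := fun x => H x * ENNReal.ofReal (v x)) (hHm.mul hωm)]

end Sjostrand

section Norms

variable {d : ℕ} {v : Phase d → ℝ} {Λ : Submodule ℤ (Phase d)}

theorem convDomNorm_lt_top_iff (hv : AdmissibleWeight v) (M : Λ → Λ → ℂ) :
    convDomNorm v M < ∞ ↔ MemConvDom v M := by
  have key : ∀ h : Λ → ℝ, Summable (fun l : Λ => |h l| * v (l : Phase d)) ↔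
      ∑' l : Λ, ‖h l‖ₑ * ENNReal.ofReal (v (l : Phase d)) < ∞ := by
    intro h
    have h1 : ∀ l : Λ, ‖h l‖ₑ * ENNReal.ofReal (v (l : Phase d)) =
        ENNReal.ofReal (|h l| * v (l : Phase d)) := fun l => by
      rw [ENNReal.ofReal_mul (abs_nonneg _), ← Real.norm_eq_abs, ofReal_norm]
    simp_rw [h1]
    constructor
    · intro hs
      rw [← ENNReal.ofReal_tsum_of_nonneg
        (fun l => mul_nonneg (abs_nonneg _) (hv.nonneg _)) hs]
      exact ENNReal.ofReal_lt_top
    · intro hs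
      refine (ENNReal.summable_toReal hs.ne).congr fun l => ?_
      rw [ENNReal.toReal_ofReal (mul_nonneg (abs_nonneg _) (hv.nonneg _))]
  rw [convDomNorm]
  simp only [iInf_lt_iff, MemConvDom, key]
  constructor
  · rintro ⟨h, h1, h2⟩
    exact ⟨h, h2, h1⟩
  · rintro ⟨h, h1, h2⟩
    exact ⟨h, h2, h1⟩

/-- A bound in terms of all dominating sequences is a bound in terms of the norm. The constant must
not vanish, since `convDomNorm` is infinite if there are no such sequences. -/
theorem le_mul_convDomNorm {M : Λ → Λ → ℂ} {a : ℝ≥0∞} {C : ℝ≥0} (hC : C ≠ 0)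
    (h : ∀ P : Λ → ℝ≥0∞, (∀ l m, ‖M l m‖ₑ ≤ P (l - m)) →
      a ≤ C * ∑' l : Λ, P l * ENNReal.ofReal (v l)) : a ≤ C * convDomNorm v M := by
  have hC' : (C : ℝ≥0∞) ≠ 0 := by exact_mod_cast hC
  rw [mul_comm, ← ENNReal.div_le_iff hC' ENNReal.coe_ne_top]
  refine le_iInf₂ fun f hf => ?_
  rw [ENNReal.div_le_iff hC' ENNReal.coe_ne_top, mul_comm]
  refine h (fun l => ‖f l‖ₑ) fun l m => ?_
  rw [← ofReal_norm, ← ofReal_norm]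
  exact ENNReal.ofReal_le_ofReal ((hf l m).trans (le_abs_self _))

theorem convDomNorm_le (hv : AdmissibleWeight v) {M : Λ → Λ → ℂ} {P : Λ → ℝ≥0∞}
    (hP : ∀ l m, ‖M l m‖ₑ ≤ P (l - m)) :
    convDomNorm v M ≤ ∑' l : Λ, P l * ENNReal.ofReal (v l) := by
  by_cases hfin : ∑' l : Λ, P l * ENNReal.ofReal (v l) = ∞
  · rw [hfin]
    exact le_top
  have hPt : ∀ l, P l ≠ ∞ := by
    intro l
    refine ne_top_of_le_ne_top (ENNReal.ne_top_of_tsum_ne_top hfin l) ?_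
    simpa using mul_le_mul_right (hv.subexpWeight.one_le (l : Phase d)) (P l)
  refine (iInf₂_le (fun l => (P l).toReal) fun l m => ?_).trans (le_of_eq ?_)
  · rw [← toReal_enorm]
    exact ENNReal.toReal_mono (hPt _) (hP l m)
  · refine tsum_congr fun l => ?_
    rw [Real.enorm_eq_ofReal ENNReal.toReal_nonneg, ENNReal.ofReal_toReal (hPt l)]

end Norms

theorem mainTheorem2 (d : ℕ) (v : Phase d → ℝ) (hv : AdmissibleWeight v)
    (Λ : Submodule ℤ (Phase d)) [DiscreteTopology Λ] [IsZLattice ℝ Λ]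
    (g : Config d → ℂ) (hg : MemM1 v g) (hframe : IsGaborFrame g Λ) :
    (∀ σ : 𝓢'(Phase d, ℂ), MemSjostrand (fun ζ => v (jInv ζ)) σ ↔
      ∃ M : Λ → Λ → ℂ, IsGaborMatrix g Λ σ M ∧ MemConvDom v M) ∧
    (∀ (σ : 𝓢'(Phase d, ℂ)) (M : Λ → Λ → ℂ), IsGaborMatrix g Λ σ M →
      (MemSjostrand (fun ζ => v (jInv ζ)) σ ↔ MemConvDom v M)) ∧
    ∃ c C : ℝ≥0, 0 < c ∧ 0 < C ∧
      ∀ (σ : 𝓢'(Phase d, ℂ)) (M : Λ → Λ → ℂ), IsGaborMatrix g Λ σ M →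
        (c : ℝ≥0∞) * sjostrandNorm (fun ζ => v (jInv ζ)) σ ≤ convDomNorm v M ∧
        convDomNorm v M ≤ (C : ℝ≥0∞) * sjostrandNorm (fun ζ => v (jInv ζ)) σ := by
  obtain ⟨C₁, h₁⟩ := exists_kernel_bound_of_gaborMatrix hv hg hframe
  obtain ⟨C₂, h₂⟩ := exists_gaborMatrix_bound_of_kernel (Λ := Λ) hv hg
  obtain ⟨C₃, C₃', h₃⟩ := exists_kernel_bound_of_sjostrand hv
  obtain ⟨C₄, h₄⟩ := exists_sjostrandNorm_le hv
  have hlow : ∀ (σ : 𝓢'(Phase d, ℂ)) (M : Λ → Λ → ℂ), IsGaborMatrix g Λ σ M →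
      sjostrandNorm (fun ζ => v (jInv ζ)) σ ≤ ((C₄ * C₁ + 1 : ℝ≥0) : ℝ≥0∞) * convDomNorm v M := by
    intro σ M hM
    refine le_mul_convDomNorm (by positivity) fun P hP => ?_
    obtain ⟨H, hHm, hH1, hH2⟩ := h₁ σ M hM P hP
    calc _ ≤ C₄ * ∫⁻ x, H x * ENNReal.ofReal (v x) := h₄ σ H hHm hH2
      _ ≤ C₄ * (C₁ * ∑' l : Λ, P l * ENNReal.ofReal (v l)) := by gcongr
      _ ≤ _ := by
          rw [← mul_assoc]
          gcongr
          push_cast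
          exact le_self_add
  have hup : ∀ (σ : 𝓢'(Phase d, ℂ)) (M : Λ → Λ → ℂ), IsGaborMatrix g Λ σ M →
      convDomNorm v M ≤ ((C₂ * C₃ + 1 : ℝ≥0) : ℝ≥0∞) * sjostrandNorm (fun ζ => v (jInv ζ)) σ := by
    intro σ M hM
    obtain ⟨H, hHm, hH1, hH2, -⟩ := h₃ σ
    obtain ⟨P, hP1, hP2⟩ := h₂ σ M hM H hHm hH1
    calc _ ≤ ∑' l : Λ, P l * ENNReal.ofReal (v l) := convDomNorm_le hv hP1
      _ ≤ C₂ * ∫⁻ x, H x * ENNReal.ofReal (v x) := hP2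
      _ ≤ C₂ * (C₃ * sjostrandNorm (fun ζ => v (jInv ζ)) σ) := by gcongr
      _ ≤ _ := by
          rw [← mul_assoc]
          gcongr
          push_cast
          exact le_self_add
  have hiff : ∀ (σ : 𝓢'(Phase d, ℂ)) (M : Λ → Λ → ℂ), IsGaborMatrix g Λ σ M →
      (MemSjostrand (fun ζ => v (jInv ζ)) σ ↔ MemConvDom v M) := by
    intro σ M hM
    rw [← convDomNorm_lt_top_iff hv]
    exact ⟨fun h => (hup σ M hM).trans_lt (ENNReal.mul_lt_top ENNReal.coe_lt_top h),
      fun h => (hlow σ M hM).trans_lt (ENNReal.mul_lt_top ENNReal.coe_lt_top h)⟩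
  refine ⟨fun σ => ⟨fun hσ => ?_, fun ⟨M, hM, hMv⟩ => (hiff σ M hM).2 hMv⟩, hiff,
    (C₄ * C₁ + 1)⁻¹, C₂ * C₃ + 1, by positivity, by positivity, fun σ M hM => ⟨?_, hup σ M hM⟩⟩
  · -- the kernel is bounded, so the Weyl form extends to `M¹_v` itself
    obtain ⟨H, -, hH1, -, hH3⟩ := h₃ σ
    set s := sjostrandNorm (fun ζ => v (jInv ζ)) σ with hs
    have hst : C₃' * s ≠ ∞ := ENNReal.mul_ne_top ENNReal.coe_ne_top hσ.ne
    have hker : ∀ w z, ‖weylKernel σ w z‖ ≤ (C₃' * s).toReal * (v w * v z) := by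
      intro w z
      have h5 : ‖weylKernel σ w z‖ ≤ (C₃' * s).toReal := by
        rw [← toReal_enorm]
        exact ENNReal.toReal_mono hst ((hH1 w z).trans (hH3 _))
      have h6 := one_le_mul_of_one_le_of_one_le (hv.one_le w) (hv.one_le z)
      exact h5.trans (le_mul_of_one_le_right ENNReal.toReal_nonneg h6)
    have hM : IsGaborMatrix g Λ σ fun l m : Λ => ∫ x : Phase d × Phase d,
        coeff (tfShift (m : Phase d) g) x.1 * conj (coeff (tfShift (l : Phase d) g) x.2) *
          weylKernel σ x.1 x.2 ∂(volume.prod volume) :=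
      Or.inr ⟨v, _, hv, hg, isWeylExtension_integral hv ENNReal.toReal_nonneg hker,
        fun l m => rfl⟩
    exact ⟨_, hM, (hiff σ _ hM).1 hσ⟩
  · have hne : (C₄ * C₁ + 1 : ℝ≥0) ≠ 0 := by positivity
    rw [ENNReal.coe_inv hne, ← ENNReal.div_eq_inv_mul,
      ENNReal.div_le_iff (by exact_mod_cast hne) ENNReal.coe_ne_top, mul_comm]
    exact hlow σ M hM
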